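/- **Setting.** Let $V$ be an $n$-dimensional real vector space, $\Gamma\subset V$ a lattice of rank $n$, $\Gamma^*=\{\alpha\in V^*:\langle\alpha,\gamma\rangle\in\mathbb Z\ \forall\gamma\in\Gamma\}$ the dual lattice, and let $\Phi=[\beta_1,\dots,\beta_N]$ be a sequence of (not necessarily distinct) elements of $\Gamma^*$ that spans $V^*$ and lies in an open half-space: $\langle\beta_i,v\rangle>0$ for all $i$, for some $v\in V$. For $a\in V^*$ let $\Pi_\Phi(a)=\{x\in\mathbb R_{\ge0}^N:\sum_i x_i\beta_i=a\}$, and for $f:\mathbb R^N\to\mathbb C$ put $\mathcal S[f,\Phi](a)=\sum_{\xi\in\Pi_\Phi(a)\cap\mathbb Z^N}f(\xi)$. For an abelian group $W$, $\mathrm{EP}(W)$ denotes the $\mathbb C$-algebra of functions $W\to\mathbb C$ generated by the additive characters $W\to\mathbb C$ and the multiplicative characters $W\to\mathbb C^*$. Write $C(\cdot)$ for the closed convex cone generated by a family, $\Box(\Phi)=\sum_i[0,1]\beta_i$ and $\Box(\Phi,\mathbf h)=\sum_i[0,1]h_i\beta_i$. A vector of $V^*$ is regular if it lies in no cone generated by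 fewer than $n$ of the $\beta_i$; a chamber is a connected component of the set of regular vectors. A basis $\sigma$ means a linearly independent $n$-tuple of elements of $\Phi$; $\mathrm{vol}(\sigma)$ is the volume of $\sum_{\alpha\in\sigma}[0,1]\alpha$ for the measure giving volume $1$ to a minimal parallelepiped of $\Gamma^*$. Let $R$ be the ring of rational functions on $V_{\mathbb C}$ with poles along the hyperplanes $\beta_i=0$, and $S\subset R$ the span of the $f_\sigma=\prod_{\alpha\in\sigma}\alpha^{-1}$ over all bases $\sigma$. The total residue $\mathrm{Tres}:R\to S$ is the projection in the decomposition $R=\big(\sum_{v\in V_{\mathbb C}}\partial_vR\big)\oplus S$; for a formal meromorphic function $g$ near $0$ (a formal power series divided by a product of $\beta_i$'s), $\mathrm{Tres}\,g$ is $\mathrm{Tres}$ of the homogeneous component of $g$ of degree $-n$. For a chamber $\mathfrak c$, the Jeffrey–Kirwan residue $J\langle\mathfrak c,\cdot\rangle$ is the linear functional on $S$ with $J\langle\mathfrak c,f_\sigma\rangle=\mathrm{vol}(\sigma)^{-1}$ if $\mathfrak c\subset C(\sigma)$, and $0$ otherwise. For a positive integer $h$ let $c(x,h)=\frac{(x+1)(x+2)\cdots(x+h-1)}{(h-1)!}$.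 For $\mathbf y\in\mathbb C^N$ and a list $\mathbf h=(h_1,\dots,h_N)$ of positive integers let $f_{\mathbf h,\mathbf y}(x)=e^{\langle\mathbf y,x\rangle}\prod_{i=1}^Nc(x_i,h_i)$ on $\mathbb R^N$. Let $G(\Phi,\mathbf y,\mathfrak c)$ be the set of $p\in V_{\mathbb C}$ such that, for some basis $\sigma$ with $\mathfrak c\subset C(\sigma)$, $e^{\langle\beta_j,p\rangle}=e^{-y_j}$ for all $\beta_j\in\sigma$, and let $RG(\Phi,\mathbf y,\mathfrak c)\subset G(\Phi,\mathbf y,\mathfrak c)$ be a set of representatives of $G(\Phi,\mathbf y,\mathfrak c)$ modulo $2\pi i\Gamma$. **Theorem.** Let $\mathfrak c$ be a chamber. (0) The objects above are well defined: every element of $R$ is congruent modulo $\sum_v\partial_vR$ to exactly one element of $S$; the functional $J\langle\mathfrak c,\cdot\rangle$ exists and is unique; for all $\mathbf y$, $\mathbf h$, $p\in V_{\mathbb C}$ and $\lambda\in V^*$ the homogeneous component of degree $-n$ of the function of $z$ in (1) lies in $R$; and a finite set $RG(\Phi,\mathbf y,\mathfrak c)$ exists. (1) Let $\mathbf y\in\mathbb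 C^N$ and let $\mathbf h$ be a list of $N$ positive integers. For every choice of a finite $RG(\Phi,\mathbf y,\mathfrak c)$, the function $$\mathcal P[\mathfrak c,\mathbf y,\mathbf h,\Phi](\lambda)=\sum_{p\in RG(\Phi,\mathbf y,\mathfrak c)}e^{-\langle\lambda,p\rangle}\,J\Big\langle\mathfrak c,\ \mathrm{Tres}\Big(\frac{e^{\langle\lambda,z\rangle}}{\prod_{i=1}^N\big(1-e^{\langle\beta_i,p\rangle}e^{y_i}e^{-\langle\beta_i,z\rangle}\big)^{h_i}}\Big)\Big\rangle$$ belongs to $\mathrm{EP}(\Gamma^*)$, and $\mathcal S[f_{\mathbf h,\mathbf y},\Phi](\lambda)=\mathcal P[\mathfrak c,\mathbf y,\mathbf h,\Phi](\lambda)$ for every $\lambda\in(\mathfrak c-\Box(\Phi,\mathbf h))\cap\Gamma^*$. (2) For every $f\in\mathrm{EP}(\mathbb R^N)$ there is a function $\mathcal P[\mathfrak c,f,\Phi]\in\mathrm{EP}(\Gamma^*)$ such that $\mathcal S[f,\Phi](\lambda)=\mathcal P[\mathfrak c,f,\Phi](\lambda)$ for every $\lambda\in(\mathfrak c-\Box(\Phi))\cap\Gamma^*$.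 (3) If $\mathfrak c\subset C(\Phi)$, then $\overline{\mathfrak c}\subset\mathfrak c-\Box(\Phi)$. -/

import Mathlib

open scoped Pointwise

noncomputable section

namespace PartitionResidue

/-! Throughout, `V` is a finite-dimensional real vector space, `StrongDual ℝ V` is its dual `V^*`,
a rank-`n` lattice `Γ` in `V` is the set of integral combinations of a basis `b` of `V`, and a
sequence `Φ = [β_1, …, β_N]` of linear forms is a map `β : Fin N → StrongDual ℝ V`. -/

/-- The complexification `V_ℂ` of `V`, realised as the complex vector space of real-linear maps
`V^* → ℂ`. The value `p α` is the pairing `⟨α, p⟩`. -/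
abbrev Complexification (V : Type*) [NormedAddCommGroup V] [NormedSpace ℝ V] : Type _ :=
  StrongDual ℝ V →L[ℝ] ℂ

/-- The space of exponential-polynomial functions on an abelian group `W`: the algebra of complex
functions generated by the additive characters `W → ℂ` and the multiplicative characters
`W → ℂ^*`. -/
def expPoly (W : Type*) [AddCommGroup W] : Subalgebra ℂ (W → ℂ) :=
  Algebra.adjoin ℂ ({f | ∃ φ : W →+ ℂ, f = fun w => φ w} ∪ {f | ∃ χ : AddChar W ℂ, f = fun w => χ w})

/-- The closed convex cone generated by a finite family. -/
def cone {ι W : Type*} [Fintype ι] [AddCommGroup W] [Module ℝ W] (u : ι → W) : Set W :=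
  {a | ∃ t : ι → ℝ, (∀ i, 0 ≤ t i) ∧ a = ∑ i, t i • u i}

/-- The zonotope `∑ [0,1] u_i` of a finite family. -/
def box {ι W : Type*} [Fintype ι] [AddCommGroup W] [Module ℝ W] (u : ι → W) : Set W :=
  {a | ∃ t : ι → ℝ, (∀ i, t i ∈ Set.Icc (0 : ℝ) 1) ∧ a = ∑ i, t i • u i}

/-- The polynomial `c(x,h) = (x+1)(x+2)⋯(x+h-1) / (h-1)!`, for `h ≥ 1`. -/
def cPoly (x : ℝ) (h : ℕ) : ℝ :=
  (∏ k ∈ Finset.range (h - 1), (x + ((k : ℝ) + 1))) / ((h - 1).factorial : ℝ)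

/-- The function `f_{h,y}(x) = e^{⟨y,x⟩} ∏ c(x_i,h_i)` on `ℝ^N`. -/
def fhy {N : ℕ} (h : Fin N → ℕ) (y : Fin N → ℂ) (x : Fin N → ℝ) : ℂ :=
  Complex.exp (∑ i, y i * (x i : ℂ)) * ∏ i, (cPoly (x i) (h i) : ℂ)

section

variable {V : Type*} [NormedAddCommGroup V] [NormedSpace ℝ V] {n N : ℕ}

/-- The lattice `Γ` with `ℤ`-basis `b`. -/
def lattice (b : Module.Basis (Fin n) ℝ V) : Submodule ℤ V :=
  Submodule.span ℤ (Set.range b)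

/-- The dual lattice `Γ^*`: the linear forms that are integral on `Γ`. -/
def dualLattice (b : Module.Basis (Fin n) ℝ V) : AddSubgroup (StrongDual ℝ V) where
  carrier := {α | ∀ γ ∈ lattice b, ∃ k : ℤ, α γ = (k : ℝ)}
  zero_mem' := fun _ _ => ⟨0, by simp⟩
  add_mem' := by
    intro α α' hα hα' γ hγ
    obtain ⟨k, hk⟩ := hα γ hγ
    obtain ⟨l, hl⟩ := hα' γ hγ
    exact ⟨k + l, by simp [hk, hl]⟩
  neg_mem' := by
    intro α hα γ hγ
    obtain ⟨k, hk⟩ := hα γ hγ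
    exact ⟨-k, by simp [hk]⟩

/-- The volume of the parallelepiped `∑ [0,1] u_i` in `V^*`, for the measure that gives volume `1`
to a minimal parallelepiped of `Γ^*`: the numbers `u_i(b_j)` are the coordinates of `u_i` in the
`ℤ`-basis of `Γ^*` dual to `b`. -/
def latticeVolume (b : Module.Basis (Fin n) ℝ V) (u : Fin n → StrongDual ℝ V) : ℝ :=
  |(Matrix.of fun i j => u i (b j)).det|

/-- The partition polytope `Π_Φ(a)`. -/
def partitionPolytope (β : Fin N → StrongDual ℝ V) (a : StrongDual ℝ V) : Set (Fin N → ℝ) :=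
  {x | (∀ i, 0 ≤ x i) ∧ ∑ i, x i • β i = a}

/-- The sum `S[f,Φ](a)` of the values of `f` over the integral points of `Π_Φ(a)`. There are only
finitely many such points if the `β_i` lie in an open half-space. -/
def latticeSum (f : (Fin N → ℝ) → ℂ) (β : Fin N → StrongDual ℝ V) (a : StrongDual ℝ V) : ℂ :=
  ∑ᶠ x ∈ partitionPolytope β a ∩ {x | ∀ i, ∃ k : ℤ, x i = (k : ℝ)}, f x

/-- The singular vectors: those in a cone generated by fewer than `n` elements of `Φ`. -/
def singularSet (n : ℕ) (β : Fin N → StrongDual ℝ V) : Set (StrongDual ℝ V) :=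
  {a | ∃ s : Finset (Fin N), s.card < n ∧ a ∈ cone (fun i : s => β i)}

/-- The (big) chambers: the connected components of the set of regular vectors. -/
def IsChamber (n : ℕ) (β : Fin N → StrongDual ℝ V) (c : Set (StrongDual ℝ V)) : Prop :=
  ∃ a ∈ (singularSet n β)ᶜ, c = connectedComponentIn (singularSet n β)ᶜ a

/-! ### Rational functions with poles on the arrangement, and the total residue -/

/-- The complement in `V_ℂ` of the hyperplanes `β_i = 0`. A rational function on `V_ℂ` with poles
along these hyperplanes is the same thing as its restriction to this set. -/
def complementSet (β : Fin N → StrongDual ℝ V) : Set (Complexification V) :=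
  {z | ∀ i, z (β i) ≠ 0}

/-- The ring `R_𝒜` of rational functions on `V_ℂ` with poles along the hyperplanes `β_i = 0`,
generated by the linear forms and the functions `1/β_i`. -/
def rationalFunctions (β : Fin N → StrongDual ℝ V) : Subalgebra ℂ (complementSet β → ℂ) :=
  Algebra.adjoin ℂ
    ({f | ∃ α : StrongDual ℝ V,
        f = fun z : complementSet β => (z : Complexification V) α} ∪
      {f | ∃ i, f = fun z : complementSet β => ((z : Complexification V) (β i))⁻¹})

/-- The derivative `∂_v f` of a function on the complement of the hyperplanes. -/
def dirDeriv (β : Fin N → StrongDual ℝ V) (v : Complexification V) (f : complementSet β → ℂ) :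
    complementSet β → ℂ :=
  fun z => lineDeriv ℂ (Function.extend Subtype.val f 0) (z : Complexification V) v

/-- The space `∑_v ∂_v R_𝒜`. -/
def derivatives (β : Fin N → StrongDual ℝ V) : Submodule ℂ (complementSet β → ℂ) :=
  Submodule.span ℂ {g | ∃ v, ∃ f ∈ rationalFunctions β, g = dirDeriv β v f}

/-- The function `f_σ = ∏_{α ∈ σ} 1/α`, for the `n`-tuple `σ = (β_{σ 1}, …, β_{σ n})`. -/
def simpleFraction (β : Fin N → StrongDual ℝ V) (σ : Fin n → Fin N) : complementSet β → ℂ :=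
  fun z => ∏ i, ((z : Complexification V) (β (σ i)))⁻¹

/-- The space `S_𝒜` of simple elements, spanned by the `f_σ` with `σ` a basis of `V^*`
(here `n = dim V`). -/
def simpleElements (n : ℕ) (β : Fin N → StrongDual ℝ V) : Submodule ℂ (complementSet β → ℂ) :=
  Submodule.span ℂ
    {f | ∃ σ : Fin n → Fin N, LinearIndependent ℝ (β ∘ σ) ∧ f = simpleFraction β σ}

open Classical in
/-- The total residue `Tres : R_𝒜 → S_𝒜`, the projection in the direct sum decomposition
`R_𝒜 = (∑_v ∂_v R_𝒜) ⊕ S_𝒜`. -/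
def totalResidue (n : ℕ) (β : Fin N → StrongDual ℝ V) (f : complementSet β → ℂ) :
    simpleElements n β :=
  if hf : ∃ s : simpleElements n β, f - (s : complementSet β → ℂ) ∈ derivatives β then hf.choose
  else 0

/-- The homogeneous component of degree `k` of a formal meromorphic function
`g = P / ∏_{i=1}^R β_i` on `V_ℂ` near `0` (`P` a formal power series). Such a function is given by
its expansions `g(tz) = ∑_k P_[k](z) t^{k-R} / ∏ β_i(z)` along the lines `t ↦ tz`, which are formal
Laurent series in `t`; the component of degree `k` of `g` is the coefficient of `t^k`. -/
def homogeneousComponent {β : Fin N → StrongDual ℝ V} (k : ℤ)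
    (g : complementSet β → LaurentSeries ℂ) : complementSet β → ℂ :=
  fun z => (g z).coeff k

/-- The total residue of a formal meromorphic function near `0`: the total residue of its
homogeneous component of degree `-n`, that is, of `P_[R-n] / ∏_{i=1}^R β_i`. -/
def totalResidueFormal (n : ℕ) (β : Fin N → StrongDual ℝ V)
    (g : complementSet β → LaurentSeries ℂ) : simpleElements n β :=
  totalResidue n β (homogeneousComponent (-(n : ℤ)) g)

/-! ### The Jeffrey–Kirwan residue -/

open Classical in
/-- `J` is the linear functional on `S_𝒜` with `J(f_σ) = 1/vol(σ)` if `𝔠 ⊆ C(σ)`, and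
`J(f_σ) = 0` otherwise, for every basis `σ` of `V^*` formed by elements of `Φ`. -/
def IsJKFunctional (b : Module.Basis (Fin n) ℝ V) (β : Fin N → StrongDual ℝ V)
    (c : Set (StrongDual ℝ V)) (J : simpleElements n β →ₗ[ℂ] ℂ) : Prop :=
  ∀ (σ : Fin n → Fin N) (hσ : LinearIndependent ℝ (β ∘ σ)),
    J ⟨simpleFraction β σ, Submodule.subset_span ⟨σ, hσ, rfl⟩⟩ =
      if c ⊆ cone (β ∘ σ) then ((latticeVolume b (β ∘ σ) : ℝ) : ℂ)⁻¹ else 0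

open Classical in
/-- The Jeffrey–Kirwan residue `J⟨𝔠, s⟩` of a simple element `s`, with respect to the volume form
of `Γ^*`. -/
def jkResidue (b : Module.Basis (Fin n) ℝ V) (β : Fin N → StrongDual ℝ V)
    (c : Set (StrongDual ℝ V)) (s : simpleElements n β) : ℂ :=
  if hJ : ∃ J : simpleElements n β →ₗ[ℂ] ℂ, IsJKFunctional b β c J then hJ.choose s else 0

/-! ### The residue formula -/

/-- The power series `e^{a t}` as a Laurent series in `t`. -/
def expSeries (a : ℂ) : LaurentSeries ℂ :=
  HahnSeries.ofPowerSeries ℤ ℂ (PowerSeries.rescale a (PowerSeries.exp ℂ))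

/-- The formal meromorphic function
`z ↦ e^{⟨a,z⟩} / ∏_i (1 - e^{⟨β_i,p⟩} e^{y_i} e^{-⟨β_i,z⟩})^{h_i}`, given by its expansions along
the lines `t ↦ tz`. -/
def kernelFunction (β : Fin N → StrongDual ℝ V) (y : Fin N → ℂ) (h : Fin N → ℕ)
    (p : Complexification V) (a : StrongDual ℝ V) : complementSet β → LaurentSeries ℂ :=
  fun z => expSeries ((z : Complexification V) a) /
    ∏ i, (1 - HahnSeries.C (Complex.exp (p (β i)) * Complex.exp (y i)) *
      expSeries (-((z : Complexification V) (β i)))) ^ h i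

/-- The set of `p ∈ V_ℂ` such that, for some basis `σ` formed by elements of `Φ` with `𝔠 ⊆ C(σ)`,
one has `e^{⟨β_j,p⟩} = e^{-y_j}` for all `β_j ∈ σ`. -/
def poleSet (n : ℕ) (β : Fin N → StrongDual ℝ V) (y : Fin N → ℂ) (c : Set (StrongDual ℝ V)) :
    Set (Complexification V) :=
  {p | ∃ σ : Fin n → Fin N, LinearIndependent ℝ (β ∘ σ) ∧ c ⊆ cone (β ∘ σ) ∧
    ∀ i, Complex.exp (p (β (σ i))) = Complex.exp (-y (σ i))}

/-- `p - q ∈ 2πi Γ`. -/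
def LatticeEquiv (b : Module.Basis (Fin n) ℝ V) (p q : Complexification V) : Prop :=
  ∃ γ ∈ lattice b, ∀ α : StrongDual ℝ V,
    p α - q α = 2 * (Real.pi : ℂ) * Complex.I * ((α γ : ℝ) : ℂ)

/-- `RG` is a finite set that contains exactly one point of each class modulo `2πi Γ` of the
set of poles. -/
def IsReducedPoleSet (b : Module.Basis (Fin n) ℝ V) (β : Fin N → StrongDual ℝ V) (y : Fin N → ℂ)
    (c : Set (StrongDual ℝ V)) (RG : Finset (Complexification V)) : Prop :=
  (∀ p ∈ RG, p ∈ poleSet n β y c) ∧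
    ∀ q ∈ poleSet n β y c, ∃! p, p ∈ RG ∧ LatticeEquiv b p q

/-- The function `𝒫[𝔠,y,h,Φ]` on `Γ^*`, written with the reduced set of poles `RG`. -/
def residueFormula (b : Module.Basis (Fin n) ℝ V) (β : Fin N → StrongDual ℝ V) (y : Fin N → ℂ)
    (h : Fin N → ℕ) (c : Set (StrongDual ℝ V)) (RG : Finset (Complexification V))
    (a : dualLattice b) : ℂ :=
  ∑ p ∈ RG, Complex.exp (-(p (a : StrongDual ℝ V))) *
    jkResidue b β c (totalResidueFormal n β (kernelFunction β y h p a))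

end

end PartitionResidue

end

/-! Both sides of the residue formula are studied as functions of the multiplicities h as well as of
the lattice point, with zero entries of h allowed (such a factor is simply absent). With u_i =
e^{y_i}, the weighted partition function and the residue sum both satisfy the two systems in
`IsPartitionFamily`. The difference equation D_{h+e_i}(a) - u_i D_{h+e_i}(a - β_i) = D_h(a)
expresses cancellation of one factor of the generating function. The Euler equation v(a) D_h(a) = ∑
h_i v(β_i) (D_{h+e_i}(a) - D_h(a)) says on the residue side that a total residue kills ∂_v of the
kernel (`residue_euler`), and on the partition side that a = ∑ x_i β_i (`partitionSum_euler`). The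
formula thus becomes a uniqueness theorem, `IsPartitionFamily.eq_zero`: a solution vanishes on c -
Box(Φ, h) for all h if it does so for the h whose support contains no basis and for the indicators
of bases.

Uniqueness is an induction on (∑ h_i, size of the support). Modulo functions that vanish deep inside
c, the inductive hypothesis makes D_h invariant under the twisted translations T_j along the
support, and makes D_{h+e_i} killed by the products (1 - T_j)(1 - T_k). Linear relations among the
β_i then express D_h through the (1 - T_{σ j}) D_{h+e_i} for a basis σ, and summing the Euler
equations over the dual basis gives n D_h = (∑ h_i) D_h. Hence D_h vanishes deep in c unless ∑ h_i =
n (`IsPartitionFamily.eventually_eq_zero`). The difference equation transports this vanishing back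
to all of c - Box(Φ, h) along a lattice path that follows a half-line
(`IsPartitionFamily.eq_zero_of_deep`).

The initial data are elementary. For degenerate h both functions vanish. For a basis σ with c ⊆
C(σ), the poles of σ modulo 2πiΓ form a set of vol(σ) elements, which cancels the factor 1/vol(σ) of
the Jeffrey–Kirwan residue, and the character sum over them detects whether a lies in the lattice
spanned by σ.

For the well-definedness claims, partial fractions write every element of R as a combination of
Laurent monomials in bases (`monoSpan_eq_top`). Those with some exponent different from -1 span the
derivatives, and they meet the simple elements only in 0 by decay along lines and homogeneity
(`disjoint_monoSpan_derivation`). The Jeffrey–Kirwan functional exists because vol(σ) f_σ is the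
Laplace transform of the cone C(σ): a relation among the f_σ is a relation among indicators of
cones, by Fourier inversion at a point of c (`sum_jk_eq_zero`).

General exponential polynomials reduce to the f_{h,y}, which span their restrictions to ℤ^N
(`restrict_mem_fhySpan`). The last assertion uses that a chamber inside C(Φ) is an open convex cone
(`IsChamber.mem_iff`). -/

noncomputable section

namespace PartitionResidue

open Module

/-! ### Cones -/

section Cones

variable {ι W : Type*} [AddCommGroup W] [Module ℝ W]

/-- Conic Carathéodory: a positive combination can be rewritten as a positive combination of a
linearly independent subfamily. -/
theorem exists_linearIndepOn_pos_sum (u : ι → W) (s : Finset ι) (x : ι → ℝ)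
    (hx : ∀ i ∈ s, 0 < x i) :
    ∃ t ⊆ s, LinearIndepOn ℝ u (t : Set ι) ∧
      ∃ x' : ι → ℝ, (∀ i ∈ t, 0 < x' i) ∧ ∑ i ∈ t, x' i • u i = ∑ i ∈ s, x i • u i := by
  classical
  induction s using Finset.strongInduction generalizing x with
  | H s ih =>
  by_cases hs : LinearIndepOn ℝ u (s : Set ι)
  · exact ⟨s, subset_rfl, hs, x, hx, rfl⟩
  -- A dependence relation may be negated, so some coefficient can be taken positive.
  have key : ∃ g : ι → ℝ, ∑ i ∈ s, g i • u i = 0 ∧ ∃ i ∈ s, 0 < g i := by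
    rw [linearIndepOn_finset_iff] at hs
    push Not at hs
    obtain ⟨g, hg, i, hi, hgi⟩ := hs
    rcases lt_or_gt_of_ne hgi with h | h
    · exact ⟨fun i => - g i, by simp [hg], i, hi, by simpa using h⟩
    · exact ⟨g, hg, i, hi, h⟩
  obtain ⟨g, hg, i₀, hi₀, hgi₀⟩ := key
  -- Subtracting the relation scaled by the least ratio x/g kills the coefficient at j and keeps the
  -- others nonnegative.
  obtain ⟨j, hj, hmin⟩ := Finset.exists_min_image (s.filter fun i => 0 < g i)
    (fun i => x i / g i) ⟨i₀, by simp [hi₀, hgi₀]⟩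
  simp only [Finset.mem_filter] at hj hmin
  set r := x j / g j with hr
  have hr0 : 0 < r := div_pos (hx j hj.1) hj.2
  set z : ι → ℝ := fun i => x i - r * g i with hz
  have hz0 : ∀ i ∈ s, 0 ≤ z i := by
    intro i hi
    simp only [hz]
    by_cases h : 0 < g i
    · have := hmin i ⟨hi, h⟩
      rw [le_div_iff₀ h] at this
      linarith
    · have := hx i hi
      nlinarith
  have hzj : z j = 0 := by
    simp only [hz, hr]
    field_simp [hj.2.ne']
    ring
  have hsum : ∑ i ∈ s, z i • u i = ∑ i ∈ s, x i • u i := by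
    simp only [hz, sub_smul, Finset.sum_sub_distrib, mul_smul, ← Finset.smul_sum, hg, smul_zero,
      sub_zero]
  have hss : s.filter (fun i => 0 < z i) ⊂ s := by
    rw [Finset.filter_ssubset]
    exact ⟨j, hj.1, by simp [hzj]⟩
  obtain ⟨t, ht, hti, x', hx', h⟩ := ih _ hss z (fun i hi => (Finset.mem_filter.1 hi).2)
  refine ⟨t, ht.trans (Finset.filter_subset _ _), hti, x', hx', h.trans ?_⟩
  rw [← hsum, Finset.sum_filter]
  refine Finset.sum_congr rfl fun i hi => ?_
  split_ifs with h
  · rfl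
  · rw [le_antisymm (not_lt.1 h) (hz0 i hi), zero_smul]

/-- A family that spans and has as many elements as the dimension, as a basis. -/
def basisOf {n : ℕ} [FiniteDimensional ℝ W] (hn : finrank ℝ W = n) (w : Fin n → W)
    (hw : LinearIndependent ℝ w) : Basis (Fin n) ℝ W :=
  Basis.mk hw (by rw [hw.span_eq_top_of_card_eq_finrank' (by simp [hn])])

@[simp] theorem basisOf_apply {n : ℕ} [FiniteDimensional ℝ W] (hn : finrank ℝ W = n)
    (w : Fin n → W) (hw : LinearIndependent ℝ w) (i : Fin n) : basisOf hn w hw i = w i := by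
  simp [basisOf]

theorem mem_cone_iff_repr {n : ℕ} [FiniteDimensional ℝ W] (hn : finrank ℝ W = n) (w : Fin n → W)
    (hw : LinearIndependent ℝ w) (a : W) :
    a ∈ cone w ↔ ∀ i, 0 ≤ (basisOf hn w hw).repr a i := by
  constructor
  · rintro ⟨t, ht, rfl⟩ i
    have : ∑ i, t i • w i = ∑ i, t i • basisOf hn w hw i := by simp
    rw [this, Basis.repr_sum_self]
    exact ht i
  · intro h
    refine ⟨fun i => (basisOf hn w hw).repr a i, h, ?_⟩
    conv_lhs => rw [← (basisOf hn w hw).sum_repr a]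
    simp

theorem sum_mem_cone_subtype (u : ι → W) (s t : Finset ι) (hst : t ⊆ s) (x : ι → ℝ)
    (hx : ∀ i ∈ t, 0 ≤ x i) : ∑ i ∈ t, x i • u i ∈ cone (fun i : s => u i) := by
  classical
  refine ⟨fun i => if (i : ι) ∈ t then x i else 0, fun i => ?_, ?_⟩
  · dsimp; split_ifs with h
    exacts [hx _ h, le_rfl]
  · rw [Finset.sum_coe_sort s (fun i => (if i ∈ t then x i else 0) • u i)]
    rw [← Finset.sum_subset hst]
    · exact Finset.sum_congr rfl fun i hi => by simp [hi]
    · intro i _ hi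
      simp [hi]

theorem exists_linearIndepOn_of_mem_cone (u : ι → W) (s : Finset ι) {a : W}
    (ha : a ∈ cone (fun i : s => u i)) :
    ∃ t ⊆ s, LinearIndepOn ℝ u (t : Set ι) ∧
      ∃ x : ι → ℝ, (∀ i ∈ t, 0 < x i) ∧ a = ∑ i ∈ t, x i • u i := by
  classical
  obtain ⟨x, hx, rfl⟩ := ha
  set z : ι → ℝ := fun i => if h : i ∈ s then x ⟨i, h⟩ else 0 with hz
  have h1 : ∑ i : s, x i • u i = ∑ i ∈ s.filter (fun i => 0 < z i), z i • u i := by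
    rw [Finset.sum_filter, ← Finset.sum_coe_sort s]
    refine Finset.sum_congr rfl fun i _ => ?_
    have : z i = x i := by simp [hz]
    rw [this]
    split_ifs with h
    · rfl
    · rw [le_antisymm (not_lt.1 h) (hx i), zero_smul]
  obtain ⟨t, ht, hti, x', hx', h⟩ := exists_linearIndepOn_pos_sum u
    (s.filter (fun i => 0 < z i)) z (fun i hi => (Finset.mem_filter.1 hi).2)
  exact ⟨t, ht.trans (Finset.filter_subset _ _), hti, x', hx', by rw [h1, h]⟩

theorem mem_cone_coe_univ [Fintype ι] (u : ι → W) {a : W} (ha : a ∈ cone u) :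
    a ∈ cone (fun i : (Finset.univ : Finset ι) => u i) := by
  obtain ⟨x, hx, rfl⟩ := ha
  exact sum_mem_cone_subtype u _ _ subset_rfl x fun i _ => hx i

/-- A cone element modulo the span of an independent family `s`: it is a combination of `s` and a
disjoint family `t`, together independent, with positive coefficients on `t`. -/
theorem exists_extension_of_mem_cone [Fintype ι] [DecidableEq ι] (u : ι → W) (s : Finset ι)
    (hs : LinearIndepOn ℝ u (s : Set ι)) {a : W} (ha : a ∈ cone u) :
    ∃ t : Finset ι, Disjoint s t ∧ LinearIndepOn ℝ u ((s ∪ t : Finset ι) : Set ι) ∧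
      ∃ x : ι → ℝ, (∀ i ∈ t, 0 < x i) ∧ a = ∑ i ∈ s ∪ t, x i • u i := by
  set P := Submodule.span ℝ (u '' s)
  obtain ⟨x, hx, rfl⟩ := ha
  -- Carathéodory is applied in the quotient by the span of s. Lifting back leaves an error in that
  -- span, so nothing is known about the signs on s.
  obtain ⟨t, ht, hti, x', hx', h⟩ := exists_linearIndepOn_pos_sum (P.mkQ ∘ u)
    (Finset.univ.filter fun i => 0 < x i) x (fun i hi => (Finset.mem_filter.1 hi).2)
  have hun := hs.union_of_quotient hti
  have hdis : Disjoint s t := by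
    rw [Finset.disjoint_left]
    intro i his hit
    have := hti.ne_zero hit
    refine this ?_
    rw [Function.comp_apply, Submodule.mkQ_apply, Submodule.Quotient.mk_eq_zero]
    exact Submodule.subset_span ⟨i, his, rfl⟩
  have hxx : ∑ i, x i • u i = ∑ i ∈ Finset.univ.filter (fun i => 0 < x i), x i • u i := by
    rw [Finset.sum_filter]
    refine Finset.sum_congr rfl fun i _ => ?_
    split_ifs with h
    · rfl
    · rw [le_antisymm (not_lt.1 h) (hx i), zero_smul]
  have hmem : ∑ i, x i • u i - ∑ i ∈ t, x' i • u i ∈ P := by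
    rw [← Submodule.ker_mkQ P, LinearMap.mem_ker, map_sub, hxx, sub_eq_zero]
    simpa using h.symm
  rw [Submodule.mem_span_image_finset_iff_exists_fun] at hmem
  obtain ⟨d₀, hd⟩ := hmem
  obtain ⟨d, rfl⟩ : ∃ d : ι → ℝ, d₀ = fun i : s => d i :=
    ⟨fun i => if h : i ∈ s then d₀ ⟨i, h⟩ else 0, by ext i; simp⟩
  rw [Finset.sum_coe_sort s (fun i => d i • u i)] at hd
  refine ⟨t, hdis, by simpa using hun, fun i => if i ∈ t then x' i else d i,
    fun i hi => by simpa [hi] using hx' i hi, ?_⟩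
  rw [Finset.sum_union hdis]
  have e1 : ∑ i ∈ s, (if i ∈ t then x' i else d i) • u i = ∑ i ∈ s, d i • u i :=
    Finset.sum_congr rfl fun i hi => by simp [Finset.disjoint_left.1 hdis hi]
  have e2 : ∑ i ∈ t, (if i ∈ t then x' i else d i) • u i = ∑ i ∈ t, x' i • u i :=
    Finset.sum_congr rfl fun i hi => by simp [hi]
  rw [e1, e2, hd]
  abel

/-- The cone is the image of the closed orthant under an injective linear map between
finite-dimensional spaces, which is a closed embedding. -/
theorem isClosed_cone_of_linearIndependent {κ F : Type*} [Fintype κ] [NormedAddCommGroup F]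
    [NormedSpace ℝ F] [FiniteDimensional ℝ F] (u : κ → F) (hu : LinearIndependent ℝ u) :
    IsClosed (cone u) := by
  have hinj : LinearMap.ker (Fintype.linearCombination ℝ u) = ⊥ :=
    LinearMap.ker_eq_bot.2 (linearIndependent_iff_injective_fintypeLinearCombination.1 hu)
  have hemb := LinearMap.isClosedEmbedding_of_injective hinj
  have : cone u = (Fintype.linearCombination ℝ u) '' {x | ∀ i, 0 ≤ x i} := by
    ext a
    constructor
    · rintro ⟨t, ht, rfl⟩
      exact ⟨t, ht, by simp [Fintype.linearCombination_apply]⟩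
    · rintro ⟨t, ht, rfl⟩
      exact ⟨t, ht, by simp [Fintype.linearCombination_apply]⟩
  rw [this]
  apply hemb.isClosedMap
  simp only [Set.ofPred_forall]
  exact isClosed_iInter fun i => isClosed_le continuous_const (continuous_apply i)

end Cones

end PartitionResidue

end

noncomputable section

namespace PartitionResidue

open Module

/-! ### Chambers -/

section Chambers

variable {V : Type*} [NormedAddCommGroup V] [NormedSpace ℝ V] {n N : ℕ}

theorem finrank_strongDual (b : Basis (Fin n) ℝ V) : finrank ℝ (StrongDual ℝ V) = n := by
  have := Module.Finite.of_basis b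
  rw [← (LinearMap.toContinuousLinearMap (𝕜 := ℝ) (E := V) (F' := ℝ)).finrank_eq]
  have := Subspace.dual_finrank_eq (K := ℝ) (V := V)
  exact this.trans ((finrank_eq_card_basis b).trans (Fintype.card_fin n))

theorem exists_tuple {W : Type*} [AddCommGroup W] [Module ℝ W] (u : Fin N → W)
    (t : Finset (Fin N)) (ht : LinearIndepOn ℝ u (t : Set (Fin N))) (hn : t.card = n) :
    ∃ σ : Fin n → Fin N, Function.Injective σ ∧ LinearIndependent ℝ (u ∘ σ) ∧
      Finset.univ.image σ = t := by
  classical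
  set e := (t.equivFinOfCardEq hn).symm
  refine ⟨fun i => e i, Subtype.val_injective.comp e.injective,
    (linearIndependent_equiv e).2 ht, ?_⟩
  ext i
  simp only [Finset.mem_image, Finset.mem_univ, true_and]
  constructor
  · rintro ⟨k, rfl⟩
    exact (e k).2
  · intro h
    exact ⟨e.symm ⟨i, h⟩, by simp⟩

theorem sum_image_tuple {W : Type*} [AddCommGroup W] [Module ℝ W] (u : Fin N → W)
    (σ : Fin n → Fin N) (hσ : Function.Injective σ) (x : Fin N → ℝ) :
    ∑ i ∈ Finset.univ.image σ, x i • u i = ∑ k, x (σ k) • u (σ k) :=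
  Finset.sum_image fun _ _ _ _ h => hσ h

variable (β : Fin N → StrongDual ℝ V) {c : Set (StrongDual ℝ V)}

theorem cone_tuple_subset (σ : Fin n → Fin N) : cone (β ∘ σ) ⊆ cone β := by
  classical
  rintro a ⟨t, ht, rfl⟩
  refine ⟨fun i => ∑ k with σ k = i, t k, fun i => Finset.sum_nonneg fun k _ => ht k, ?_⟩
  simp only [Finset.sum_smul]
  rw [← Finset.sum_fiberwise Finset.univ σ (fun k => t k • (β ∘ σ) k)]
  refine Finset.sum_congr rfl fun i _ => Finset.sum_congr rfl fun k hk => ?_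
  rw [← (Finset.mem_filter.1 hk).2]
  rfl

/-- By Carathéodory only linearly independent subfamilies are needed, so the singular set is a
finite union of closed simplicial cones. -/
theorem isClosed_singularSet [FiniteDimensional ℝ V] : IsClosed (singularSet n β) := by
  have : singularSet n β = ⋃ t ∈ {t : Finset (Fin N) | t.card < n ∧
      LinearIndepOn ℝ β (t : Set (Fin N))}, cone (fun i : t => β i) := by
    ext a
    simp only [Set.mem_iUnion, Set.mem_ofPred_eq, exists_prop]
    constructor
    · rintro ⟨s, hs, ha⟩
      obtain ⟨t, ht, hti, x, hx, rfl⟩ := exists_linearIndepOn_of_mem_cone β s ha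
      exact ⟨t, ⟨(Finset.card_le_card ht).trans_lt hs, hti⟩,
        sum_mem_cone_subtype β t t subset_rfl x fun i hi => (hx i hi).le⟩
    · rintro ⟨t, ⟨ht, -⟩, ha⟩
      exact ⟨t, ht, ha⟩
  rw [this]
  refine Set.Finite.isClosed_biUnion (Set.toFinite _) fun t ht => ?_
  exact isClosed_cone_of_linearIndependent _ ht.2

variable {β}

theorem IsChamber.isOpen [FiniteDimensional ℝ V] (hc : IsChamber n β c) : IsOpen c := by
  obtain ⟨a, ha, rfl⟩ := hc
  exact (isClosed_singularSet β).isOpen_compl.connectedComponentIn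

theorem IsChamber.nonempty (hc : IsChamber n β c) : c.Nonempty := by
  obtain ⟨a, ha, rfl⟩ := hc
  exact ⟨a, mem_connectedComponentIn ha⟩

theorem IsChamber.notMem_singularSet (hc : IsChamber n β c) {x : StrongDual ℝ V} (hx : x ∈ c) :
    x ∉ singularSet n β := by
  obtain ⟨a, ha, rfl⟩ := hc
  exact connectedComponentIn_subset _ _ hx

theorem IsChamber.isPreconnected (hc : IsChamber n β c) : IsPreconnected c := by
  obtain ⟨a, ha, rfl⟩ := hc
  exact isPreconnected_connectedComponentIn

theorem IsChamber.subset_of_isPreconnected (hc : IsChamber n β c) {s : Set (StrongDual ℝ V)}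
    (hs : IsPreconnected s) (hreg : ∀ x ∈ s, x ∉ singularSet n β) (hsc : (s ∩ c).Nonempty) :
    s ⊆ c := by
  obtain ⟨a, ha, rfl⟩ := hc
  obtain ⟨x, hxs, hxc⟩ := hsc
  rw [connectedComponentIn_eq hxc]
  exact hs.subset_connectedComponentIn hxs hreg

/-! ### Chambers as open convex cones. -/

variable [FiniteDimensional ℝ V] (hn : finrank ℝ (StrongDual ℝ V) = n)

include hn

/-- A vanishing coordinate puts the point on a facet, which is generated by n - 1 vectors of the
family. -/
theorem mem_singularSet_of_repr_eq_zero (σ : Fin n → Fin N) (hσ : LinearIndependent ℝ (β ∘ σ))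
    {a : StrongDual ℝ V} (ha : a ∈ cone (β ∘ σ)) (i : Fin n)
    (hi : (basisOf hn _ hσ).repr a i = 0) : a ∈ singularSet n β := by
  classical
  have hinj : Function.Injective σ := fun i j h => hσ.injective (by simp [h])
  refine ⟨(Finset.univ.erase i).image σ, ?_, ?_⟩
  · rw [Finset.card_image_of_injective _ hinj, Finset.card_erase_of_mem (Finset.mem_univ i)]
    simp
    exact i.pos
  · have h0 := (mem_cone_iff_repr hn _ hσ a).1 ha
    have : a = ∑ j ∈ (Finset.univ.erase i).image σ,
        (if h : ∃ k, σ k = j then (basisOf hn _ hσ).repr a h.choose else 0) • β j := by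
      rw [Finset.sum_image fun _ _ _ _ h => hinj h]
      conv_lhs => rw [← (basisOf hn _ hσ).sum_repr a]
      rw [← Finset.add_sum_erase _ _ (Finset.mem_univ i), hi, zero_smul, zero_add]
      refine Finset.sum_congr rfl fun k _ => ?_
      have h : ∃ k', σ k' = σ k := ⟨k, rfl⟩
      rw [dif_pos h, hinj h.choose_spec]
      simp
    rw [this]
    refine sum_mem_cone_subtype β _ _ subset_rfl _ fun j _ => ?_
    split_ifs with h
    exacts [h0 _, le_rfl]

theorem repr_pos_of_mem_cone (σ : Fin n → Fin N) (hσ : LinearIndependent ℝ (β ∘ σ))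
    {a : StrongDual ℝ V} (ha : a ∈ cone (β ∘ σ)) (hreg : a ∉ singularSet n β) (i : Fin n) :
    0 < (basisOf hn _ hσ).repr a i :=
  lt_of_le_of_ne ((mem_cone_iff_repr hn _ hσ a).1 ha i)
    fun h => hreg (mem_singularSet_of_repr_eq_zero hn σ hσ ha i h.symm)

theorem continuous_basisOf_repr (w : Fin n → StrongDual ℝ V) (hw : LinearIndependent ℝ w)
    (i : Fin n) : Continuous fun a => (basisOf hn w hw).repr a i :=
  LinearMap.continuous_of_finiteDimensional ((basisOf hn w hw).coord i)

/-- No regular vector lies on the boundary of C(σ), so the interior of C(σ) is open and closed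
relative to the connected set c. -/
theorem IsChamber.subset_cone (hc : IsChamber n β c) (σ : Fin n → Fin N)
    (hσ : LinearIndependent ℝ (β ∘ σ)) {a : StrongDual ℝ V} (ha : a ∈ c)
    (haσ : a ∈ cone (β ∘ σ)) : c ⊆ cone (β ∘ σ) := by
  refine (hc.isPreconnected.subset_of_closure_inter_subset
    (u := {x | ∀ i, 0 < (basisOf hn _ hσ).repr x i}) ?_ ?_ ?_).trans ?_
  · simp only [Set.ofPred_forall]
    exact isOpen_iInter_of_finite fun i =>
      isOpen_lt continuous_const (continuous_basisOf_repr hn _ hσ i)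
  · exact ⟨a, ha, repr_pos_of_mem_cone hn σ hσ haσ (hc.notMem_singularSet ha)⟩
  · rintro x ⟨hx, hxc⟩ i
    refine repr_pos_of_mem_cone hn σ hσ ?_ (hc.notMem_singularSet hxc) i
    refine closure_minimal ?_ (isClosed_cone_of_linearIndependent _ hσ) hx
    intro y hy
    exact (mem_cone_iff_repr hn _ hσ y).2 fun i => (hy i).le
  · intro y hy
    exact (mem_cone_iff_repr hn _ hσ y).2 fun i => (hy i).le

theorem exists_tuple_of_mem_cone {a : StrongDual ℝ V} (hreg : a ∉ singularSet n β)
    (ha : a ∈ cone β) :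
    ∃ σ : Fin n → Fin N, LinearIndependent ℝ (β ∘ σ) ∧ a ∈ cone (β ∘ σ) := by
  obtain ⟨t, -, hti, x, hx, rfl⟩ := exists_linearIndepOn_of_mem_cone β _ (mem_cone_coe_univ β ha)
  have hle : t.card ≤ n := by
    have := LinearIndependent.fintype_card_le_finrank (R := ℝ) hti
    simpa [hn] using this
  have hcard : t.card = n := by
    refine le_antisymm hle (not_lt.1 fun h => hreg ⟨t, h, ?_⟩)
    exact sum_mem_cone_subtype β t t subset_rfl x fun i hi => (hx i hi).le
  obtain ⟨σ, hinj, hσ, rfl⟩ := exists_tuple β t hti hcard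
  refine ⟨σ, hσ, fun k => x (σ k), fun k => (hx _ (by simp)).le, ?_⟩
  rw [sum_image_tuple β σ hinj x]
  rfl

/-- A chamber inside `C(Φ)` is the intersection of the interiors of the simplicial cones that
contain it. -/
theorem IsChamber.mem_iff (hc : IsChamber n β c) (hcβ : c ⊆ cone β) (x : StrongDual ℝ V) :
    x ∈ c ↔ ∀ (σ : Fin n → Fin N) (hσ : LinearIndependent ℝ (β ∘ σ)), c ⊆ cone (β ∘ σ) →
      ∀ i, 0 < (basisOf hn _ hσ).repr x i := by
  classical
  constructor
  · intro hx σ hσ hcσ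
    exact repr_pos_of_mem_cone hn σ hσ (hcσ hx) (hc.notMem_singularSet hx)
  intro hx
  obtain ⟨a, ha⟩ := hc.nonempty
  -- The open simplicial cones are convex, so the positivity conditions hold along the whole segment
  -- from a to x. It remains to see that the segment stays regular.
  have hD : ∀ t ∈ Set.Icc (0 : ℝ) 1, ∀ (σ : Fin n → Fin N) (hσ : LinearIndependent ℝ (β ∘ σ)),
      c ⊆ cone (β ∘ σ) → ∀ i, 0 < (basisOf hn _ hσ).repr (AffineMap.lineMap a x t) i := by
    intro t ht σ hσ hcσ i
    have h1 := repr_pos_of_mem_cone hn σ hσ (hcσ ha) (hc.notMem_singularSet ha) i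
    have h2 := hx σ hσ hcσ i
    rw [AffineMap.lineMap_apply_module]
    simp only [map_add, map_smul, Finsupp.add_apply, Finsupp.smul_apply, smul_eq_mul]
    rcases ht.1.eq_or_lt with h | h
    · subst h; simpa using h1
    · have : 0 ≤ 1 - t := by linarith [ht.2]
      positivity
  have hcont : Continuous fun t : ℝ => AffineMap.lineMap a x t := AffineMap.lineMap_continuous
  by_cases hsing : ∀ t ∈ Set.Icc (0 : ℝ) 1, AffineMap.lineMap a x t ∉ singularSet n β
  · have := hc.subset_of_isPreconnected
      (s := (fun t : ℝ => AffineMap.lineMap a x t) '' Set.Icc (0 : ℝ) 1)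
      (isPreconnected_Icc.image _ hcont.continuousOn)
      (by rintro _ ⟨t, ht, rfl⟩; exact hsing t ht) ⟨a, ⟨0, by simp, by simp⟩, ha⟩
    exact this ⟨1, by simp, by simp⟩
  exfalso
  push Not at hsing
  set T := {t ∈ Set.Icc (0 : ℝ) 1 | AffineMap.lineMap a x t ∈ singularSet n β} with hT
  have hTc : IsClosed T := isClosed_Icc.inter ((isClosed_singularSet β).preimage hcont)
  have hTn : T.Nonempty := hsing
  have hTb : BddBelow T := ⟨0, fun t ht => ht.1.1⟩
  -- The first singular point of the segment; everything before it lies in c.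
  set t₀ := sInf T
  obtain ⟨ht₀, hst₀⟩ : t₀ ∈ T := hTc.csInf_mem hTn hTb
  set x₀ := AffineMap.lineMap a x t₀ with hx₀
  have ht₀pos : 0 < t₀ := by
    refine ht₀.1.lt_of_ne fun h => hc.notMem_singularSet ha ?_
    simpa [hx₀, ← h] using hst₀
  have hbefore : ∀ t ∈ Set.Ico 0 t₀, AffineMap.lineMap a x t ∈ c := by
    intro t ht
    have := hc.subset_of_isPreconnected
      (s := (fun t : ℝ => AffineMap.lineMap a x t) '' Set.Ico (0 : ℝ) t₀)
      (isPreconnected_Ico.image _ hcont.continuousOn)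
      (by
        rintro _ ⟨t, ht, rfl⟩ hs
        exact (csInf_le hTb ⟨⟨ht.1, ht.2.le.trans ht₀.2⟩, hs⟩).not_gt ht.2)
      ⟨a, ⟨0, by simp [ht₀pos], by simp⟩, ha⟩
    exact this ⟨t, ht, rfl⟩
  obtain ⟨s', hs'card, hs'⟩ := hst₀
  obtain ⟨s, hss', hs, y, hy, hx₀s⟩ := exists_linearIndepOn_of_mem_cone β s' hs'
  have hscard : s.card < n := (Finset.card_le_card hss').trans_lt hs'card
  -- The point x₀ has positive coefficients on s, and a is written on s ∪ τ with positive
  -- coefficients on τ. Moving slightly from x₀ towards a therefore gives a point of the cone on s ∪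
  -- τ.
  obtain ⟨τ, hdis, hli, d, hd, had⟩ := exists_extension_of_mem_cone β s hs (hcβ ha)
  obtain ⟨ε, hε0, hε1, hε⟩ : ∃ ε : ℝ, 0 < ε ∧ ε ≤ 1 ∧ ∀ i ∈ s, 0 ≤ (1 - ε) * y i + ε * d i := by
    have : ∀ᶠ ε : ℝ in nhdsWithin 0 (Set.Ioi 0), ∀ i ∈ s, 0 < (1 - ε) * y i + ε * d i := by
      refine Filter.Eventually.filter_mono nhdsWithin_le_nhds ?_
      refine (Filter.eventually_all_finset s).2 fun i hi => ?_
      have : Filter.Tendsto (fun ε : ℝ => (1 - ε) * y i + ε * d i) (nhds 0) (nhds (y i)) := by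
        have : Continuous (fun ε : ℝ => (1 - ε) * y i + ε * d i) := by fun_prop
        simpa using this.tendsto 0
      exact this.eventually (lt_mem_nhds (hy i hi))
    obtain ⟨ε, h1, h3⟩ := (this.and (Ioo_mem_nhdsGT one_pos)).exists
    exact ⟨ε, h3.1, h3.2.le, fun i hi => (h1 i hi).le⟩
  set z : Fin N → ℝ := fun i => if i ∈ s then (1 - ε) * y i + ε * d i else ε * d i
  have hz : ∀ i ∈ s ∪ τ, 0 ≤ z i := by
    intro i hi
    simp only [z]
    split_ifs with h
    · exact hε i h
    · exact (mul_pos hε0 (hd i ((Finset.mem_union.1 hi).resolve_left h))).le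
  have hp : (1 - ε) • x₀ + ε • a = ∑ i ∈ s ∪ τ, z i • β i := by
    rw [had, hx₀s, Finset.sum_union hdis, Finset.sum_union hdis, smul_add, ← add_assoc,
      Finset.smul_sum, Finset.smul_sum, Finset.smul_sum, ← Finset.sum_add_distrib]
    congr 1
    · refine Finset.sum_congr rfl fun i hi => ?_
      simp only [z, if_pos hi, add_smul, mul_smul]
    · refine Finset.sum_congr rfl fun i hi => ?_
      simp only [z, if_neg (Finset.disjoint_right.1 hdis hi), mul_smul]
  have hpc : (1 - ε) • x₀ + ε • a ∈ c := by
    have : (1 - ε) • x₀ + ε • a = AffineMap.lineMap a x ((1 - ε) * t₀) := by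
      rw [hx₀, AffineMap.lineMap_apply_module, AffineMap.lineMap_apply_module]
      module
    rw [this]
    refine hbefore _ ⟨mul_nonneg (by linarith) ht₀.1, by nlinarith⟩
  -- The moved point lies in c, hence is regular, so the independent family s ∪ τ cannot have fewer
  -- than n elements.
  have hcard : (s ∪ τ).card = n := by
    refine le_antisymm ?_ (not_lt.1 fun h => hc.notMem_singularSet hpc ⟨s ∪ τ, h, ?_⟩)
    · have := LinearIndependent.fintype_card_le_finrank (R := ℝ) hli
      simpa [hn] using this
    · rw [hp]
      exact sum_mem_cone_subtype β _ _ subset_rfl z hz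
  obtain ⟨σ, hinj, hσ, hσim⟩ := exists_tuple β (s ∪ τ) hli hcard
  have hpσ : (1 - ε) • x₀ + ε • a ∈ cone (β ∘ σ) := by
    rw [hp, ← hσim, sum_image_tuple β σ hinj]
    exact ⟨fun k => z (σ k), fun k => hz _ (by rw [← hσim]; simp), rfl⟩
  have hcσ := hc.subset_cone hn σ hσ hpc hpσ
  -- As s has fewer than n elements, x₀ has a zero coordinate in the basis σ, although c ⊆ C(σ).
  -- This contradicts `hD` at t₀.
  obtain ⟨k, hk⟩ : ∃ k, σ k ∉ s := by
    by_contra! h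
    have : (Finset.univ.image σ).card ≤ s.card :=
      Finset.card_le_card (by rw [Finset.image_subset_iff]; exact fun k _ => h k)
    rw [hσim, hcard] at this
    omega
  have h1 := hD t₀ ht₀ σ hσ hcσ k
  have h2 : (AffineMap.lineMap a x t₀) =
      ∑ k, (if σ k ∈ s then y (σ k) else 0) • basisOf hn _ hσ k := by
    rw [← hx₀, hx₀s]
    simp only [basisOf_apply, Function.comp]
    rw [← sum_image_tuple β σ hinj (fun i => if i ∈ s then y i else 0), hσim,
      ← Finset.sum_subset Finset.subset_union_left]
    · exact Finset.sum_congr rfl fun i hi => by simp [hi]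
    · intro i _ hi
      simp [hi]
  rw [h2, Basis.repr_sum_self] at h1
  simp [hk] at h1

theorem IsChamber.add_mem_of_closure (hc : IsChamber n β c) (hcβ : c ⊆ cone β)
    {x y : StrongDual ℝ V} (hx : x ∈ closure c) (hy : y ∈ c) : x + y ∈ c := by
  rw [hc.mem_iff hn hcβ]
  intro σ hσ hcσ i
  have h1 := (hc.mem_iff hn hcβ y).1 hy σ hσ hcσ i
  have h2 := (mem_cone_iff_repr hn _ hσ x).1
    (closure_minimal hcσ (isClosed_cone_of_linearIndependent _ hσ) hx) i
  simp only [map_add, Finsupp.add_apply]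
  linarith

theorem IsChamber.add_mem (hc : IsChamber n β c) (hcβ : c ⊆ cone β)
    {x y : StrongDual ℝ V} (hx : x ∈ c) (hy : y ∈ c) : x + y ∈ c :=
  hc.add_mem_of_closure hn hcβ (subset_closure hx) hy

theorem IsChamber.smul_mem (hc : IsChamber n β c) (hcβ : c ⊆ cone β)
    {x : StrongDual ℝ V} (hx : x ∈ c) {t : ℝ} (ht : 0 < t) : t • x ∈ c := by
  rw [hc.mem_iff hn hcβ]
  intro σ hσ hcσ i
  have h1 := (hc.mem_iff hn hcβ x).1 hx σ hσ hcσ i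
  simp only [map_smul, Finsupp.smul_apply, smul_eq_mul]
  positivity

/-- A regular point of C(Φ) lies in some C(σ), and that cone then swallows the whole chamber. -/
theorem IsChamber.disjoint_cone (hc : IsChamber n β c) (hcβ : ¬ c ⊆ cone β)
    {x : StrongDual ℝ V} (hx : x ∈ c) : x ∉ cone β := by
  intro hxβ
  obtain ⟨σ, hσ, hxσ⟩ := exists_tuple_of_mem_cone hn (hc.notMem_singularSet hx) hxβ
  exact hcβ ((hc.subset_cone hn σ hσ hx hxσ).trans (cone_tuple_subset β σ))

theorem IsChamber.closure_subset (hc : IsChamber n β c) (hcβ : c ⊆ cone β) :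
    closure c ⊆ c - box β := by
  intro a ha
  obtain ⟨x, hx⟩ := hc.nonempty
  obtain ⟨t, ht, hxt⟩ := hcβ hx
  -- M exceeds every t_i, so x/M lies in the zonotope; it is the small push that carries a point of
  -- the closure into c.
  set M := 1 + ∑ i, t i
  have hM : 0 < M := by
    have := Finset.sum_nonneg fun i (_ : i ∈ Finset.univ) => ht i
    positivity
  refine ⟨a + M⁻¹ • x, hc.add_mem_of_closure hn hcβ ha
    (hc.smul_mem hn hcβ hx (inv_pos.2 hM)), M⁻¹ • x, ⟨fun i => M⁻¹ * t i, fun i => ⟨?_, ?_⟩, ?_⟩, ?_⟩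
  · exact mul_nonneg (inv_pos.2 hM).le (ht i)
  · rw [inv_mul_le_iff₀ hM, mul_one]
    have := Finset.single_le_sum (fun i _ => ht i) (Finset.mem_univ i)
    linarith
  · rw [hxt, Finset.smul_sum]
    simp [mul_smul]
  · simp

end Chambers

end PartitionResidue

end

noncomputable section

namespace PartitionResidue

open Module

/-! ### Rational functions and their derivatives -/

section Rational

variable {V : Type*} [NormedAddCommGroup V] [NormedSpace ℝ V] {n N : ℕ}
variable {β : Fin N → StrongDual ℝ V}

theorem continuousSMul_of_normedSpace {E : Type*} [NormedAddCommGroup E] [NormedSpace ℂ E] :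
    ContinuousSMul ℂ E := inferInstance

theorem continuousAdd_of_normedAddCommGroup {E : Type*} [NormedAddCommGroup E] :
    ContinuousAdd E := inferInstance

instance : ContinuousSMul ℂ (Complexification V) :=
  continuousSMul_of_normedSpace (E := Complexification V)

instance : ContinuousAdd (Complexification V) :=
  continuousAdd_of_normedAddCommGroup (E := Complexification V)

@[simp] theorem complexification_zero_smul (v : Complexification V) : (0 : ℂ) • v = 0 :=
  zero_smul ℂ v

/-- Extension by zero of a function on the complement of the hyperplanes. -/
abbrev zeroExtend (f : complementSet β → ℂ) : Complexification V → ℂ :=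
  Function.extend Subtype.val f 0

theorem zeroExtend_apply (f : complementSet β → ℂ) {w : Complexification V}
    (hw : w ∈ complementSet β) : zeroExtend f w = f ⟨w, hw⟩ :=
  Subtype.val_injective.extend_apply f 0 ⟨w, hw⟩

theorem zeroExtend_apply_of_notMem (f : complementSet β → ℂ) {w : Complexification V}
    (hw : w ∉ complementSet β) : zeroExtend f w = 0 :=
  Function.extend_apply' _ _ _ fun ⟨a, ha⟩ => hw (ha ▸ a.2)

theorem zeroExtend_add (f g : complementSet β → ℂ) (w : Complexification V) :
    zeroExtend (f + g) w = zeroExtend f w + zeroExtend g w := by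
  by_cases hw : w ∈ complementSet β
  · simp only [zeroExtend_apply _ hw, Pi.add_apply]
  · simp only [zeroExtend_apply_of_notMem _ hw, add_zero]

theorem zeroExtend_mul (f g : complementSet β → ℂ) (w : Complexification V) :
    zeroExtend (f * g) w = zeroExtend f w * zeroExtend g w := by
  by_cases hw : w ∈ complementSet β
  · simp only [zeroExtend_apply _ hw, Pi.mul_apply]
  · simp only [zeroExtend_apply_of_notMem _ hw, mul_zero]

theorem zeroExtend_smul (a : ℂ) (f : complementSet β → ℂ) (w : Complexification V) :
    zeroExtend (a • f) w = a * zeroExtend f w := by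
  by_cases hw : w ∈ complementSet β
  · simp only [zeroExtend_apply _ hw, Pi.smul_apply, smul_eq_mul]
  · simp only [zeroExtend_apply_of_notMem _ hw, mul_zero]

theorem isOpen_complementSet : IsOpen (complementSet β) := by
  simp only [complementSet, Set.ofPred_forall]
  exact isOpen_iInter_of_finite fun i =>
    isOpen_ne_fun (by fun_prop) continuous_const

theorem continuous_line (z v : Complexification V) : Continuous fun t : ℂ => z + t • v := by
  fun_prop

theorem eventually_line_mem (z : complementSet β) (v : Complexification V) :
    ∀ᶠ t : ℂ in nhds 0, (z : Complexification V) + t • v ∈ complementSet β :=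
  (continuous_line (z : Complexification V) v).continuousAt.eventually_mem
    (isOpen_complementSet.mem_nhds (by simp only [complexification_zero_smul, add_zero]; exact z.2))

/-- `f'` is the derivative of `f` in the direction `v` on the complement of the hyperplanes. -/
def HasDirDeriv (v : Complexification V) (f f' : complementSet β → ℂ) : Prop :=
  ∀ z : complementSet β, HasLineDerivAt ℂ (zeroExtend f) (f' z) (z : Complexification V) v

theorem HasDirDeriv.dirDeriv_eq {v : Complexification V} {f f' : complementSet β → ℂ}
    (h : HasDirDeriv v f f') : dirDeriv β v f = f' :=
  funext fun z => (h z).lineDeriv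

theorem HasDirDeriv.add {v : Complexification V} {f f' g g' : complementSet β → ℂ}
    (hf : HasDirDeriv v f f') (hg : HasDirDeriv v g g') :
    HasDirDeriv v (f + g) (f' + g') := fun z =>
  (HasDerivAt.add (hf z) (hg z)).congr_of_eventuallyEq
    (Filter.Eventually.of_forall fun _ => zeroExtend_add _ _ _)

theorem HasDirDeriv.smul (a : ℂ) {v : Complexification V} {f f' : complementSet β → ℂ}
    (hf : HasDirDeriv v f f') : HasDirDeriv v (a • f) (a • f') := fun z =>
  (HasDerivAt.const_mul a (hf z)).congr_of_eventuallyEq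
    (Filter.Eventually.of_forall fun _ => zeroExtend_smul _ _ _)

theorem HasDirDeriv.mul {v : Complexification V} {f f' g g' : complementSet β → ℂ}
    (hf : HasDirDeriv v f f') (hg : HasDirDeriv v g g') :
    HasDirDeriv v (f * g) (f' * g + f * g') := fun z => by
  have := (HasDerivAt.mul (hf z) (hg z)).congr_of_eventuallyEq
    (Filter.Eventually.of_forall fun _ => zeroExtend_mul _ _ _)
  simpa [HasLineDerivAt, zeroExtend_apply _ z.2] using this

theorem hasDirDeriv_algebraMap (v : Complexification V) (a : ℂ) :
    HasDirDeriv v (algebraMap ℂ (complementSet β → ℂ) a) 0 := fun z => by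
  refine (hasDerivAt_const (0 : ℂ) a).congr_of_eventuallyEq ?_
  filter_upwards [eventually_line_mem z v] with t ht
  simp [zeroExtend_apply _ ht]

theorem hasDirDeriv_linear (v : Complexification V) (α : StrongDual ℝ V) :
    HasDirDeriv v (fun z : complementSet β => (z : Complexification V) α)
      (algebraMap ℂ _ (v α)) := fun z => by
  have h : HasDerivAt (fun t : ℂ => (z : Complexification V) α + t * v α) (v α) 0 := by
    simpa using ((hasDerivAt_id (0 : ℂ)).mul_const (v α)).const_add ((z : Complexification V) α)
  refine h.congr_of_eventuallyEq ?_
  filter_upwards [eventually_line_mem z v] with t ht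
  simp [zeroExtend_apply _ ht]

theorem hasDirDeriv_zpow (v : Complexification V) (i : Fin N) (k : ℤ) :
    HasDirDeriv v (fun z : complementSet β => (z : Complexification V) (β i) ^ k)
      (fun z => k * v (β i) * (z : Complexification V) (β i) ^ (k - 1)) := fun z => by
  have h : HasDerivAt (fun t : ℂ => (z : Complexification V) (β i) + t * v (β i)) (v (β i)) 0 := by
    simpa using ((hasDerivAt_id (0 : ℂ)).mul_const (v (β i))).const_add ((z : Complexification V) (β i))
  have h2 : HasDerivAt (fun t : ℂ => ((z : Complexification V) (β i) + t * v (β i)) ^ k)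
      (k * v (β i) * (z : Complexification V) (β i) ^ (k - 1)) 0 := by
    have h3 := (hasDerivAt_zpow k ((z : Complexification V) (β i) + 0 * v (β i))
      (Or.inl (by simpa using z.2 i))).comp (0 : ℂ) h
    refine h3.congr_deriv ?_
    simp
    ring
  refine h2.congr_of_eventuallyEq ?_
  filter_upwards [eventually_line_mem z v] with t ht
  simp [zeroExtend_apply _ ht]

theorem linear_mem (α : StrongDual ℝ V) :
    (fun z : complementSet β => (z : Complexification V) α) ∈ rationalFunctions β :=
  Algebra.subset_adjoin (Or.inl ⟨α, rfl⟩)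

theorem inv_mem (i : Fin N) :
    (fun z : complementSet β => ((z : Complexification V) (β i))⁻¹) ∈ rationalFunctions β :=
  Algebra.subset_adjoin (Or.inr ⟨i, rfl⟩)

theorem zpow_mem (i : Fin N) (k : ℤ) :
    (fun z : complementSet β => ((z : Complexification V) (β i)) ^ k) ∈ rationalFunctions β := by
  cases k with
  | ofNat k =>
    have := pow_mem (linear_mem (β := β) (β i)) k
    simpa [Pi.pow_def] using this
  | negSucc k =>
    have := pow_mem (inv_mem (β := β) i) (k + 1)
    simpa [Pi.pow_def, zpow_negSucc] using this

theorem exists_hasDirDeriv (v : Complexification V) {f : complementSet β → ℂ}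
    (hf : f ∈ rationalFunctions β) : ∃ f' ∈ rationalFunctions β, HasDirDeriv v f f' := by
  induction hf using Algebra.adjoin_induction with
  | mem f hf =>
    rcases hf with ⟨α, rfl⟩ | ⟨i, rfl⟩
    · exact ⟨_, algebraMap_mem _ _, hasDirDeriv_linear v α⟩
    · have := hasDirDeriv_zpow (β := β) v i (-1)
      simp only [zpow_neg_one] at this
      refine ⟨_, ?_, this⟩
      have h := (rationalFunctions β).smul_mem (zpow_mem (β := β) i (-1 - 1))
        (((-1 : ℤ) : ℂ) * v (β i))
      exact h
  | algebraMap a => exact ⟨0, zero_mem _, hasDirDeriv_algebraMap v a⟩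
  | add f g _ _ hf hg =>
    obtain ⟨f', hf', h1⟩ := hf
    obtain ⟨g', hg', h2⟩ := hg
    exact ⟨_, add_mem hf' hg', h1.add h2⟩
  | mul f g hfR hgR hf hg =>
    obtain ⟨f', hf', h1⟩ := hf
    obtain ⟨g', hg', h2⟩ := hg
    exact ⟨_, add_mem (mul_mem hf' hgR) (mul_mem hfR hg'), h1.mul h2⟩

theorem hasDirDeriv_dirDeriv (v : Complexification V) {f : complementSet β → ℂ}
    (hf : f ∈ rationalFunctions β) : HasDirDeriv v f (dirDeriv β v f) := by
  obtain ⟨f', -, h⟩ := exists_hasDirDeriv v hf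
  rwa [h.dirDeriv_eq]

theorem dirDeriv_mem (v : Complexification V) {f : complementSet β → ℂ}
    (hf : f ∈ rationalFunctions β) : dirDeriv β v f ∈ rationalFunctions β := by
  obtain ⟨f', hf', h⟩ := exists_hasDirDeriv v hf
  rwa [h.dirDeriv_eq]

variable (β) in
/-- The directional derivative as a derivation of the ring of rational functions. -/
def derivation (v : Complexification V) :
    Derivation ℂ (rationalFunctions β) (rationalFunctions β) :=
  Derivation.mk'
    { toFun := fun f => ⟨dirDeriv β v f, dirDeriv_mem v f.2⟩
      map_add' := fun f g => Subtype.ext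
        ((hasDirDeriv_dirDeriv v f.2).add (hasDirDeriv_dirDeriv v g.2)).dirDeriv_eq
      map_smul' := fun a f => Subtype.ext
        ((hasDirDeriv_dirDeriv v f.2).smul a).dirDeriv_eq }
    (fun f g => Subtype.ext <| by
      have := ((hasDirDeriv_dirDeriv v f.2).mul (hasDirDeriv_dirDeriv v g.2)).dirDeriv_eq
      simp only [LinearMap.coe_mk, AddHom.coe_mk]
      refine this.trans ?_
      simp only [smul_eq_mul, Subalgebra.coe_add, Subalgebra.coe_mul]
      ring)

theorem derivation_coe (v : Complexification V) (f : rationalFunctions β) :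
    (derivation β v f : complementSet β → ℂ) = dirDeriv β v f := rfl

variable (β) in
/-- A linear form as a rational function. -/
def linearFn (α : StrongDual ℝ V) : rationalFunctions β := ⟨_, linear_mem α⟩

variable (β) in
/-- An integral power of `β_i` as a rational function. -/
def powFn (i : Fin N) (k : ℤ) : rationalFunctions β := ⟨_, zpow_mem i k⟩

@[simp] theorem linearFn_apply (α : StrongDual ℝ V) (z : complementSet β) :
    (linearFn β α : complementSet β → ℂ) z = (z : Complexification V) α := rfl

@[simp] theorem powFn_apply (i : Fin N) (k : ℤ) (z : complementSet β) :
    (powFn β i k : complementSet β → ℂ) z = (z : Complexification V) (β i) ^ k := rfl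

theorem derivation_linearFn (v : Complexification V) (α : StrongDual ℝ V) :
    derivation β v (linearFn β α) = algebraMap ℂ _ (v α) :=
  Subtype.ext (hasDirDeriv_linear v α).dirDeriv_eq

theorem derivation_powFn (v : Complexification V) (i : Fin N) (k : ℤ) :
    derivation β v (powFn β i k) = ((k : ℂ) * v (β i)) • powFn β i (k - 1) :=
  Subtype.ext (hasDirDeriv_zpow v i k).dirDeriv_eq

theorem powFn_zero (i : Fin N) : powFn β i 0 = 1 :=
  Subtype.ext <| funext fun z => by simp

theorem powFn_one (i : Fin N) : powFn β i 1 = linearFn β (β i) :=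
  Subtype.ext <| funext fun z => by simp

theorem powFn_add (i : Fin N) (k l : ℤ) : powFn β i (k + l) = powFn β i k * powFn β i l :=
  Subtype.ext <| funext fun z => by simp [zpow_add₀ (z.2 i)]

theorem linearFn_sum {κ : Type*} (s : Finset κ) (r : κ → ℝ) (α : κ → StrongDual ℝ V) :
    linearFn β (∑ j ∈ s, r j • α j) = ∑ j ∈ s, (r j : ℂ) • linearFn β (α j) :=
  Subtype.ext <| funext fun z => by
    simp [Finset.sum_apply]

/-- Derivatives are defined among all functions on the complement; this moves membership into the
ring R, where `derivation` and the monomials live. -/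
theorem mem_derivatives_iff (f : rationalFunctions β) :
    (f : complementSet β → ℂ) ∈ derivatives β ↔
      f ∈ Submodule.span ℂ {g | ∃ v f', g = derivation β v f'} := by
  have : derivatives β = (Submodule.span ℂ {g | ∃ v f', g = derivation β v f'}).map
      (rationalFunctions β).val.toLinearMap := by
    rw [Submodule.map_span, derivatives]
    congr 1
    ext g
    constructor
    · rintro ⟨v, f, hf, rfl⟩
      exact ⟨derivation β v ⟨f, hf⟩, ⟨v, ⟨f, hf⟩, rfl⟩, rfl⟩
    · rintro ⟨_, ⟨v, f, rfl⟩, rfl⟩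
      exact ⟨v, f, f.2, rfl⟩
  rw [this]
  constructor
  · rintro ⟨g, hg, hgf⟩
    have : g = f := Subtype.ext hgf
    exact this ▸ hg
  · intro hf
    exact ⟨f, hf, rfl⟩

/-- The ring of rational functions is generated by the linear forms and the `1/β_i`. -/
theorem rational_induction {p : rationalFunctions β → Prop}
    (halg : ∀ a : ℂ, p (algebraMap ℂ _ a))
    (hlin : ∀ α, p (linearFn β α)) (hinv : ∀ i, p (powFn β i (-1)))
    (hadd : ∀ f g, p f → p g → p (f + g)) (hmul : ∀ f g, p f → p g → p (f * g))
    (f : rationalFunctions β) : p f := by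
  obtain ⟨f, hf⟩ := f
  induction hf using Algebra.adjoin_induction with
  | mem f hf =>
    rcases hf with ⟨α, rfl⟩ | ⟨i, rfl⟩
    · exact hlin α
    · have := hinv i
      simpa [powFn] using this
  | algebraMap a => exact halg a
  | add f g hf hg h1 h2 => exact hadd _ _ h1 h2
  | mul f g hf hg h1 h2 => exact hmul _ _ h1 h2

end Rational

end PartitionResidue

end

noncomputable section

namespace PartitionResidue

open Module

/-! ### Monomials in a basis and the total residue -/

section Monomials

variable {V : Type*} [NormedAddCommGroup V] [NormedSpace ℝ V] {n N : ℕ}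
variable {β : Fin N → StrongDual ℝ V}

variable (β) in
/-- The Laurent monomial `∏ β_{σ j}^{k_j}`. -/
def mono (σ : Fin n → Fin N) (k : Fin n → ℤ) : rationalFunctions β :=
  ∏ j, powFn β (σ j) (k j)

theorem mono_apply (σ : Fin n → Fin N) (k : Fin n → ℤ) (z : complementSet β) :
    (mono β σ k : complementSet β → ℂ) z = ∏ j, (z : Complexification V) (β (σ j)) ^ k j := by
  simp [mono, Finset.prod_apply]

theorem mono_add (σ : Fin n → Fin N) (k l : Fin n → ℤ) :
    mono β σ (k + l) = mono β σ k * mono β σ l := by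
  simp [mono, powFn_add, Finset.prod_mul_distrib]

theorem mono_single (σ : Fin n → Fin N) (j : Fin n) (l : ℤ) :
    mono β σ (Pi.single j l) = powFn β (σ j) l := by
  rw [mono, Fintype.prod_eq_single j]
  · simp
  · intro i hi
    simp [hi, powFn_zero]

theorem mono_zero (σ : Fin n → Fin N) : mono β σ 0 = 1 := by
  simp [mono, powFn_zero]

theorem derivation_prod {R : Type*} [CommRing R] [Algebra ℂ R] (D : Derivation ℂ R R)
    {κ : Type*} [DecidableEq κ] (s : Finset κ) (f : κ → R) :
    D (∏ i ∈ s, f i) = ∑ i ∈ s, (∏ j ∈ s.erase i, f j) * D (f i) := by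
  induction s using Finset.induction_on with
  | empty => simp
  | insert a s ha ih =>
    rw [Finset.prod_insert ha, D.leibniz, ih, Finset.sum_insert ha, Finset.erase_insert ha,
      Finset.smul_sum, add_comm]
    congr 1
    refine Finset.sum_congr rfl fun i hi => ?_
    have hia : i ≠ a := fun h => ha (h ▸ hi)
    rw [Finset.erase_insert_of_ne hia.symm, Finset.prod_insert (by simp [ha]), smul_eq_mul,
      mul_assoc]

theorem derivation_mono (v : Complexification V) (σ : Fin n → Fin N) (k : Fin n → ℤ) :
    derivation β v (mono β σ k) =
      ∑ j, ((k j : ℂ) * v (β (σ j))) • mono β σ (k - Pi.single j 1) := by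
  rw [mono, derivation_prod]
  refine Finset.sum_congr rfl fun j _ => ?_
  rw [derivation_powFn, mul_smul_comm]
  congr 1
  rw [mono, ← Finset.mul_prod_erase _ _ (Finset.mem_univ j), mul_comm]
  congr 1
  · simp
  · refine Finset.prod_congr rfl fun i hi => ?_
    simp [(Finset.mem_erase.1 hi).1]

variable (β) in
/-- The span of the monomials in bases of `V^*` whose exponents satisfy a given condition. -/
def monoSpan (P : (Fin n → ℤ) → Prop) : Submodule ℂ (rationalFunctions β) :=
  Submodule.span ℂ {f | ∃ (σ : Fin n → Fin N) (k : Fin n → ℤ),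
    LinearIndependent ℝ (β ∘ σ) ∧ P k ∧ f = mono β σ k}

theorem mono_mem_monoSpan {P : (Fin n → ℤ) → Prop} {σ : Fin n → Fin N} {k : Fin n → ℤ}
    (hσ : LinearIndependent ℝ (β ∘ σ)) (hk : P k) : mono β σ k ∈ monoSpan β P :=
  Submodule.subset_span ⟨σ, k, hσ, hk, rfl⟩

theorem monoSpan_le {P : (Fin n → ℤ) → Prop} {M : Submodule ℂ (rationalFunctions β)}
    (h : ∀ (σ : Fin n → Fin N) (k : Fin n → ℤ), LinearIndependent ℝ (β ∘ σ) → P k →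
      mono β σ k ∈ M) : monoSpan β P ≤ M := by
  rw [monoSpan, Submodule.span_le]
  rintro _ ⟨σ, k, hσ, hk, rfl⟩
  exact h σ k hσ hk

theorem exists_basis_tuple_mem [FiniteDimensional ℝ V] (hn : finrank ℝ (StrongDual ℝ V) = n)
    {t : Set (Fin N)} (hspan : Submodule.span ℝ (β '' t) = ⊤) :
    ∃ σ : Fin n → Fin N, LinearIndependent ℝ (β ∘ σ) ∧ ∀ j, σ j ∈ t := by
  obtain ⟨s, hst, -, hs, hli⟩ := exists_linearIndepOn_extension (linearIndepOn_empty ℝ β)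
    (Set.empty_subset t)
  lift s to Finset (Fin N) using Set.toFinite s
  have htop : Submodule.span ℝ (β '' s) = ⊤ := by
    rw [← top_le_iff, ← hspan, Submodule.span_le]
    exact hs
  have hcard : s.card = n := by
    have h := finrank_span_eq_card (R := ℝ) hli
    have e : Set.range (fun i : (s : Set (Fin N)) => β i) = β '' s := by
      rw [Set.image_eq_range]
    rw [e, htop, finrank_top, hn] at h
    simpa using h.symm
  obtain ⟨σ, -, h, rfl⟩ := exists_tuple β s hli hcard
  exact ⟨σ, h, fun j => hst (by simp)⟩

theorem exists_basis_tuple [FiniteDimensional ℝ V] (hn : finrank ℝ (StrongDual ℝ V) = n)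
    (hspan : Submodule.span ℝ (Set.range β) = ⊤) :
    ∃ σ : Fin n → Fin N, LinearIndependent ℝ (β ∘ σ) :=
  (exists_basis_tuple_mem hn (t := Set.univ) (by rwa [Set.image_univ])).imp fun _ h => h.1

variable [FiniteDimensional ℝ V] (hn : finrank ℝ (StrongDual ℝ V) = n)

/-- The vector of the dual basis of `β ∘ σ`, in the complexification. -/
def dualVec (σ : Fin n → Fin N) (hσ : LinearIndependent ℝ (β ∘ σ)) (j : Fin n) :
    Complexification V :=
  Complex.ofRealCLM.comp (LinearMap.toContinuousLinearMap ((basisOf hn _ hσ).coord j))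

theorem dualVec_apply (σ : Fin n → Fin N) (hσ : LinearIndependent ℝ (β ∘ σ)) (j i : Fin n) :
    dualVec hn σ hσ j (β (σ i)) = if i = j then 1 else 0 := by
  have : β (σ i) = basisOf hn _ hσ i := by simp
  rw [this]
  simp only [dualVec, ContinuousLinearMap.comp_apply, LinearMap.coe_toContinuousLinearMap',
    Basis.coord_apply, Basis.repr_self, Finsupp.single_apply]
  split_ifs <;> simp

theorem dualVec_ne_zero (σ : Fin n → Fin N) (hσ : LinearIndependent ℝ (β ∘ σ)) (j : Fin n) :
    dualVec hn σ hσ j ≠ 0 := by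
  intro h
  have := dualVec_apply hn σ hσ j j
  simp [h] at this

/-- In the coordinates given by β ∘ σ, a dual basis direction is a coordinate direction, so only one
exponent is touched. -/
theorem derivation_dualVec_mono (σ : Fin n → Fin N) (hσ : LinearIndependent ℝ (β ∘ σ))
    (j : Fin n) (k : Fin n → ℤ) :
    derivation β (dualVec hn σ hσ j) (mono β σ k) = (k j : ℂ) • mono β σ (k - Pi.single j 1) := by
  rw [derivation_mono, Fintype.sum_eq_single j]
  · simp [dualVec_apply]
  · intro i hi
    simp [dualVec_apply, hi]

include hn

theorem exists_apply_ne_zero (σ : Fin n → Fin N) (hσ : LinearIndependent ℝ (β ∘ σ))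
    {v : Complexification V} (hv : v ≠ 0) : ∃ j, v (β (σ j)) ≠ 0 := by
  by_contra! h
  refine hv (ContinuousLinearMap.ext fun α => ?_)
  rw [← (basisOf hn _ hσ).sum_repr α]
  simp [h]

theorem linearFn_mul_mono_mem (σ : Fin n → Fin N) (hσ : LinearIndependent ℝ (β ∘ σ))
    (k : Fin n → ℤ) (α : StrongDual ℝ V) :
    linearFn β α * mono β σ k ∈ monoSpan β (n := n) fun _ => True := by
  have : linearFn β α = ∑ j, (((basisOf hn _ hσ).repr α j : ℝ) : ℂ) • linearFn β (β (σ j)) := by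
    rw [← linearFn_sum]
    conv_lhs => rw [← (basisOf hn _ hσ).sum_repr α]
    simp
  rw [this, Finset.sum_mul]
  refine sum_mem fun j _ => ?_
  rw [smul_mul_assoc]
  refine Submodule.smul_mem _ _ ?_
  rw [← powFn_one, ← mono_single, ← mono_add]
  exact mono_mem_monoSpan hσ trivial

theorem linearFn_mul_mem (α : StrongDual ℝ V) {f : rationalFunctions β}
    (hf : f ∈ monoSpan β (n := n) fun _ => True) :
    linearFn β α * f ∈ monoSpan β (n := n) fun _ => True := by
  have : monoSpan β (n := n) (fun _ => True) ≤
      (monoSpan β (n := n) fun _ => True).comap (LinearMap.mulLeft ℂ (linearFn β α)) :=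
    monoSpan_le fun σ k hσ _ => linearFn_mul_mono_mem hn σ hσ k α
  exact this hf

/-- The exchange step of linear algebra: β_i may replace any basis vector that occurs in its
expansion. -/
theorem linearIndependent_update (σ : Fin n → Fin N) (hσ : LinearIndependent ℝ (β ∘ σ))
    (j : Fin n) (i : Fin N) (hr : (basisOf hn _ hσ).repr (β i) j ≠ 0) :
    LinearIndependent ℝ (β ∘ Function.update σ j i) := by
  rw [Fintype.linearIndependent_iff]
  intro g hg
  have hcoord : (∑ m, g m • (β ∘ Function.update σ j i) m) =
      g j • β i + ∑ m ∈ Finset.univ.erase j, g m • (basisOf hn _ hσ) m := by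
    rw [← Finset.add_sum_erase _ _ (Finset.mem_univ j)]
    congr 1
    · simp
    · refine Finset.sum_congr rfl fun m hm => ?_
      simp [(Finset.mem_erase.1 hm).1]
  rw [hcoord] at hg
  have hj : g j = 0 := by
    have h := congrArg (fun a => (basisOf hn _ hσ).repr a j) hg
    simp only [map_add, map_smul, map_sum, Finsupp.add_apply, Finsupp.smul_apply,
      Finsupp.finsetSum_apply, Basis.repr_self, Finsupp.single_apply, smul_eq_mul, mul_ite, mul_one, mul_zero, map_zero,
      Finsupp.zero_apply] at h
    rw [Finset.sum_eq_zero, add_zero] at h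
    · exact (mul_eq_zero.1 h).resolve_right hr
    · intro m hm
      simp [(Finset.mem_erase.1 hm).1]
  intro m
  by_cases hm : m = j
  · rw [hm, hj]
  rw [hj, zero_smul, zero_add] at hg
  exact linearIndependent_iff'.1 (basisOf hn _ hσ).linearIndependent _ g hg m
    (Finset.mem_erase.2 ⟨hm, Finset.mem_univ m⟩)

/-- Partial fractions, by induction on the total pole order T of the monomial. The exponent q is
left free because the reduction step increases it. -/
theorem powFn_mul_mono_mem (i : Fin N) (T : ℕ) : ∀ (q : ℕ) (σ : Fin n → Fin N)
    (_ : LinearIndependent ℝ (β ∘ σ)) (k : Fin n → ℤ), ∑ j, (-k j).toNat ≤ T →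
    powFn β i (-q) * mono β σ k ∈ monoSpan β (n := n) fun _ => True := by
  induction T using Nat.strong_induction_on with
  | _ T ih =>
  intro q σ hσ k hT
  by_cases hcase : ∃ j, 0 ≤ k j ∧ (basisOf hn _ hσ).repr (β i) j ≠ 0
  · obtain ⟨j, hkj, hr⟩ := hcase
    -- Here β_{σ j} is not in the denominator, so β_i takes its place in the basis and the power of
    -- β_{σ j} becomes a polynomial factor.
    have e : powFn β i (-q) * mono β σ k =
        linearFn β (β (σ j)) ^ (k j).toNat *
          mono β (Function.update σ j i) (Function.update k j (-q)) := by
      apply Subtype.ext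
      funext z
      simp only [Subalgebra.coe_mul, Pi.mul_apply, powFn_apply, mono_apply, SubmonoidClass.coe_pow,
        Pi.pow_apply, linearFn_apply]
      rw [← Finset.mul_prod_erase _ _ (Finset.mem_univ j),
        ← Finset.mul_prod_erase _ _ (Finset.mem_univ j)]
      have e2 : ∏ x ∈ Finset.univ.erase j, (z : Complexification V)
            (β (Function.update σ j i x)) ^ (Function.update k j (-(q : ℤ)) x) =
          ∏ x ∈ Finset.univ.erase j, (z : Complexification V) (β (σ x)) ^ k x :=
        Finset.prod_congr rfl fun m hm => by simp [(Finset.mem_erase.1 hm).1]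
      rw [e2]
      have e3 : (z : Complexification V) (β (σ j)) ^ k j =
          (z : Complexification V) (β (σ j)) ^ (k j).toNat := by
        conv_lhs => rw [← Int.toNat_of_nonneg hkj, zpow_natCast]
      simp only [Function.update_self, e3]
      ring
    rw [e]
    have hmem : mono β (Function.update σ j i) (Function.update k j (-(q : ℤ))) ∈
        monoSpan β (n := n) fun _ => True :=
      mono_mem_monoSpan (linearIndependent_update hn σ hσ j i hr) trivial
    generalize (k j).toNat = m
    induction m with
    | zero => simpa using hmem
    | succ m ihm =>
      rw [pow_succ', mul_assoc]
      exact linearFn_mul_mem hn _ ihm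
  · push Not at hcase
    -- Every basis vector occurring in β_i is now in the denominator. Inserting β_i/β_i and
    -- expanding the numerator cancels one denominator factor in each term.
    have e : powFn β i (-q) * mono β σ k =
        ∑ j, (((basisOf hn _ hσ).repr (β i) j : ℝ) : ℂ) •
          (powFn β i (-(q + 1 : ℕ)) * mono β σ (k + Pi.single j 1)) := by
      have h1 : powFn β i (-q) = powFn β i (-(q + 1 : ℕ)) * linearFn β (β i) := by
        rw [← powFn_one, ← powFn_add]
        congr 1
        push_cast
        ring
      have h2 : linearFn β (β i) =
          ∑ j, (((basisOf hn _ hσ).repr (β i) j : ℝ) : ℂ) • linearFn β (β (σ j)) := by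
        rw [← linearFn_sum]
        conv_lhs => rw [← (basisOf hn _ hσ).sum_repr (β i)]
        simp
      rw [h1, h2, Finset.mul_sum, Finset.sum_mul]
      refine Finset.sum_congr rfl fun j _ => ?_
      rw [mono_add, mono_single, powFn_one, mul_smul_comm, smul_mul_assoc]
      congr 1
      ring
    rw [e]
    refine sum_mem fun j _ => ?_
    by_cases hr : (basisOf hn _ hσ).repr (β i) j = 0
    · rw [hr]
      simp
    have hkj : k j < 0 := not_le.1 fun h => hr (hcase j h)
    refine Submodule.smul_mem _ _ (ih (∑ l, (-(k + Pi.single j 1 : Fin n → ℤ) l).toNat) ?_ (q + 1) σ hσ _ le_rfl)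
    refine lt_of_lt_of_le (Finset.sum_lt_sum (fun l _ => ?_) ⟨j, Finset.mem_univ j, ?_⟩) hT
    · by_cases hl : l = j
      · subst hl
        simp
      · simp [hl]
    · simp
      omega

/-- The span contains 1 and is stable under multiplication by the generators of R. -/
theorem monoSpan_eq_top (hspan : Submodule.span ℝ (Set.range β) = ⊤) :
    monoSpan β (n := n) (fun _ => True) = ⊤ := by
  obtain ⟨σ, hσ⟩ := exists_basis_tuple hn hspan
  have key : ∀ f : rationalFunctions β, ∀ g ∈ monoSpan β (n := n) (fun _ => True),
      f * g ∈ monoSpan β (n := n) (fun _ => True) := by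
    intro f
    induction f using rational_induction with
    | halg a =>
      intro g hg
      rw [← Algebra.smul_def]
      exact Submodule.smul_mem _ _ hg
    | hlin α => exact fun g hg => linearFn_mul_mem hn α hg
    | hinv i =>
      intro g hg
      have : monoSpan β (n := n) (fun _ => True) ≤
          (monoSpan β (n := n) fun _ => True).comap (LinearMap.mulLeft ℂ (powFn β i (-1))) :=
        monoSpan_le fun σ k hσ _ => by
          simpa using powFn_mul_mono_mem hn i _ 1 σ hσ k le_rfl
      exact this hg
    | hadd f g hf hg =>
      intro h hh
      rw [add_mul]
      exact add_mem (hf h hh) (hg h hh)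
    | hmul f g hf hg =>
      intro h hh
      rw [mul_assoc]
      exact hf _ (hg h hh)
  rw [eq_top_iff]
  intro f _
  have := key f 1 (by rw [← mono_zero σ]; exact mono_mem_monoSpan hσ trivial)
  rwa [mul_one] at this

end Monomials

end PartitionResidue

end

noncomputable section

namespace PartitionResidue

open Module Filter

section TotalResidue

variable {V : Type*} [NormedAddCommGroup V] [NormedSpace ℝ V] {n N : ℕ}
variable {β : Fin N → StrongDual ℝ V}

/-! ### Products of derivations -/

/-- The commutator is itself a derivation, so it is enough that it vanishes on generators. -/
theorem derivation_comm (v w : Complexification V) (f : rationalFunctions β) :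
    derivation β v (derivation β w f) = derivation β w (derivation β v f) := by
  rw [← sub_eq_zero, ← Derivation.commutator_apply]
  induction f using rational_induction with
  | halg a => exact Derivation.map_algebraMap _ a
  | hlin α => simp [Derivation.commutator_apply, derivation_linearFn]
  | hinv i =>
    simp only [Derivation.commutator_apply, derivation_powFn, Derivation.map_smul, smul_smul]
    rw [← sub_smul]
    convert zero_smul ℂ _ using 2
    ring
  | hadd f g hf hg => rw [map_add, hf, hg, add_zero]
  | hmul f g hf hg => rw [Derivation.leibniz, hf, hg, smul_zero, smul_zero, add_zero]

variable (β) in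
/-- The monoid of products of derivations in non-zero directions. -/
def derivationMonoid : Submonoid (Module.End ℂ (rationalFunctions β)) :=
  Submonoid.closure {A | ∃ v : Complexification V, v ≠ 0 ∧ A = (derivation β v).toLinearMap}

theorem derivationMonoid_commute {A B : Module.End ℂ (rationalFunctions β)}
    (hA : A ∈ derivationMonoid β) (hB : B ∈ derivationMonoid β) : Commute A B := by
  induction hA using Submonoid.closure_induction with
  | one => exact Commute.one_left B
  | mul x y _ _ hx hy => exact hx.mul_left hy
  | mem A hA =>
    obtain ⟨v, -, rfl⟩ := hA
    induction hB using Submonoid.closure_induction with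
    | one => exact Commute.one_right _
    | mul x y _ _ hx hy => exact hx.mul_right hy
    | mem B hB =>
      obtain ⟨w, -, rfl⟩ := hB
      exact LinearMap.ext fun f => derivation_comm v w f

variable (β) in
/-- The rational functions killed by a product of derivations in non-zero directions. -/
def torsion : Submodule ℂ (rationalFunctions β) where
  carrier := {f | ∃ A ∈ derivationMonoid β, A f = 0}
  zero_mem' := ⟨1, one_mem _, rfl⟩
  add_mem' := by
    rintro f g ⟨A, hA, hf⟩ ⟨B, hB, hg⟩
    refine ⟨A * B, mul_mem hA hB, ?_⟩
    rw [map_add, Module.End.mul_apply A B g, hg, map_zero, add_zero,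
      (derivationMonoid_commute hA hB).eq, Module.End.mul_apply, hf, map_zero]
  smul_mem' := by
    rintro a f ⟨A, hA, hf⟩
    exact ⟨A, hA, by rw [map_smul, hf, smul_zero]⟩

/-! ### Behaviour along lines -/

theorem tendsto_zpow_line (a b : ℂ) {k : ℤ} (hk : k ≤ -1) :
    Tendsto (fun s : ℝ => (a + s * b) ^ k) atTop (nhds (if b = 0 then a ^ k else 0)) := by
  split_ifs with h
  · subst h
    simp
  · obtain ⟨m, rfl⟩ : ∃ m : ℕ, k = -((m + 1 : ℕ) : ℤ) := ⟨(-k - 1).toNat, by omega⟩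
    simp only [zpow_neg, zpow_natCast]
    refine tendsto_inv₀_cobounded.comp ?_
    refine (tendsto_pow_cobounded_cobounded (by simp)).comp ?_
    rw [← tendsto_norm_atTop_iff_cobounded]
    have h1 : Tendsto (fun s : ℝ => s * ‖b‖ - ‖a‖) atTop atTop :=
      tendsto_atTop_add_const_right _ _ (tendsto_id.atTop_mul_const (norm_pos_iff.2 h))
    refine tendsto_atTop_mono' _ ?_ h1
    filter_upwards [eventually_ge_atTop 0] with s hs
    have := norm_sub_norm_le ((s : ℂ) * b) (-a)
    rw [norm_mul, Complex.norm_real, Real.norm_of_nonneg hs, norm_neg, sub_neg_eq_add] at this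
    rwa [add_comm a]

theorem finite_line_notMem (z : complementSet β) (v : Complexification V) :
    {t : ℂ | (z : Complexification V) + t • v ∉ complementSet β}.Finite := by
  have : {t : ℂ | (z : Complexification V) + t • v ∉ complementSet β} ⊆
      ⋃ i, {-(z : Complexification V) (β i) / v (β i)} := by
    intro t ht
    simp only [complementSet, Set.mem_ofPred_eq, not_forall, not_not] at ht
    obtain ⟨i, hi⟩ := ht
    simp only [add_apply, smul_apply, smul_eq_mul] at hi
    refine Set.mem_iUnion.2 ⟨i, ?_⟩
    have hv : v (β i) ≠ 0 := by
      intro h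
      rw [h, mul_zero, add_zero] at hi
      exact z.2 i hi
    rw [Set.mem_singleton_iff, eq_div_iff hv]
    linear_combination hi
  exact (Set.finite_iUnion fun i => Set.finite_singleton _).subset this

theorem eventually_real_line_mem (z : complementSet β) (v : Complexification V) :
    ∀ᶠ s : ℝ in atTop, (z : Complexification V) + (s : ℂ) • v ∈ complementSet β := by
  have h := (finite_line_notMem z v).preimage (Complex.ofReal_injective.injOn)
  obtain ⟨M, hM⟩ := h.bddAbove
  filter_upwards [eventually_gt_atTop M] with s hs
  by_contra hc
  exact (hM (a := s) hc).not_gt hs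

/-- A complex line through a point of the complement meets the hyperplanes in finitely many points,
and these do not disconnect the plane ℂ. -/
theorem isPreconnected_line (z : complementSet β) (v : Complexification V) :
    IsPreconnected {t : ℂ | (z : Complexification V) + t • v ∈ complementSet β} := by
  have h := (finite_line_notMem z v).countable.isPathConnected_compl_of_one_lt_rank
    (by rw [Complex.rank_real_complex]; exact Nat.one_lt_ofNat)
  have e : {t : ℂ | (z : Complexification V) + t • v ∉ complementSet β}ᶜ =
      {t : ℂ | (z : Complexification V) + t • v ∈ complementSet β} := by
    ext t
    simp
  rw [e] at h
  exact h.isConnected.isPreconnected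

theorem zeroExtend_line_eq_of_derivation_eq_zero {v : Complexification V}
    {f : rationalFunctions β} (hf : derivation β v f = 0) (z : complementSet β) {t : ℂ}
    (ht : (z : Complexification V) + t • v ∈ complementSet β) :
    zeroExtend (f : complementSet β → ℂ) ((z : Complexification V) + t • v) =
      (f : complementSet β → ℂ) z := by
  set U := {t : ℂ | (z : Complexification V) + t • v ∈ complementSet β}
  have hU : IsOpen U := isOpen_complementSet.preimage (continuous_line _ _)
  have hd : ∀ t ∈ U, HasDerivAt (fun t : ℂ =>
      zeroExtend (f : complementSet β → ℂ) ((z : Complexification V) + t • v)) 0 t := by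
    intro t ht
    have h1 := hasDirDeriv_dirDeriv v f.2 ⟨_, ht⟩
    rw [← derivation_coe, hf] at h1
    have h2 : HasDerivAt (fun s : ℂ => zeroExtend (f : complementSet β → ℂ)
        (((z : Complexification V) + t • v) + s • v)) 0 (t - t) := by
      rw [sub_self]
      exact h1
    have h3 := h2.comp_sub_const t t
    refine h3.congr_of_eventuallyEq (Eventually.of_forall fun s => ?_)
    dsimp only
    congr 1
    ext α
    simp
    ring
  have h0 : (0 : ℂ) ∈ U := by
    simp only [U, Set.mem_ofPred_eq, complexification_zero_smul, add_zero]
    exact z.2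
  have := hU.is_const_of_deriv_eq_zero (isPreconnected_line z v)
    (fun t ht => (hd t ht).differentiableAt.differentiableWithinAt)
    (fun t ht => (hd t ht).deriv) ht h0
  rw [this, complexification_zero_smul, add_zero, zeroExtend_apply _ z.2]

/-! ### Simple elements, derivatives and the total residue. -/

variable [FiniteDimensional ℝ V] (hn : finrank ℝ (StrongDual ℝ V) = n)

include hn

/-- Some β_{σ j} is nonzero on v, so its negative power tends to 0 along the line, while the other
factors converge. -/
theorem tendsto_line_of_mem {f : rationalFunctions β}
    (hf : f ∈ monoSpan β (n := n) fun k => ∀ j, k j ≤ -1) (z : complementSet β)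
    {v : Complexification V} (hv : v ≠ 0) :
    Tendsto (fun s : ℝ => zeroExtend (f : complementSet β → ℂ)
      ((z : Complexification V) + (s : ℂ) • v)) atTop (nhds 0) := by
  induction hf using Submodule.span_induction with
  | zero =>
    refine tendsto_const_nhds.congr' ?_
    filter_upwards [eventually_real_line_mem z v] with s hs
    rw [zeroExtend_apply _ hs]
    rfl
  | add f g _ _ hf hg =>
    have := hf.add hg
    rw [add_zero] at this
    refine this.congr fun s => ?_
    exact (zeroExtend_add _ _ _).symm
  | smul a f _ hf =>
    have := hf.const_mul a
    rw [mul_zero] at this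
    exact this.congr fun s => (zeroExtend_smul _ _ _).symm
  | mem f hf =>
    obtain ⟨σ, k, hσ, hk, rfl⟩ := hf
    obtain ⟨j, hj⟩ := exists_apply_ne_zero hn σ hσ hv
    have := tendsto_finsetProd Finset.univ fun j _ =>
      tendsto_zpow_line ((z : Complexification V) (β (σ j))) (v (β (σ j))) (hk j)
    rw [Finset.prod_eq_zero (Finset.mem_univ j) (by simp [hj])] at this
    refine this.congr' ?_
    filter_upwards [eventually_real_line_mem z v] with s hs
    rw [zeroExtend_apply _ hs, mono_apply]
    simp

/-- Such an f is constant along lines in the direction v and decays on them. -/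
theorem eq_zero_of_derivation_eq_zero {f : rationalFunctions β}
    (hf : f ∈ monoSpan β (n := n) fun k => ∀ j, k j ≤ -1) {v : Complexification V} (hv : v ≠ 0)
    (hfv : derivation β v f = 0) : f = 0 := by
  refine Subtype.ext (funext fun z => ?_)
  have h1 := tendsto_line_of_mem hn hf z hv
  have h2 : Tendsto (fun s : ℝ => zeroExtend (f : complementSet β → ℂ)
      ((z : Complexification V) + (s : ℂ) • v)) atTop (nhds ((f : complementSet β → ℂ) z)) := by
    refine tendsto_const_nhds.congr' ?_
    filter_upwards [eventually_real_line_mem z v] with s hs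
    exact (zeroExtend_line_eq_of_derivation_eq_zero hfv z hs).symm
  exact tendsto_nhds_unique h2 h1

omit [FiniteDimensional ℝ V] hn in
theorem derivation_mem_monoSpan (v : Complexification V) {f : rationalFunctions β}
    (hf : f ∈ monoSpan β (n := n) fun k => ∀ j, k j ≤ -1) :
    derivation β v f ∈ monoSpan β (n := n) fun k => ∀ j, k j ≤ -1 := by
  have : monoSpan β (n := n) (fun k => ∀ j, k j ≤ -1) ≤
      (monoSpan β (n := n) fun k => ∀ j, k j ≤ -1).comap (derivation β v).toLinearMap := by
    refine monoSpan_le fun σ k hσ hk => ?_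
    change derivation β v (mono β σ k) ∈ monoSpan β _
    rw [derivation_mono]
    refine sum_mem fun j _ => Submodule.smul_mem _ _ (mono_mem_monoSpan hσ fun i => ?_)
    have := hk i
    by_cases hi : i = j
    · subst hi
      simp
      omega
    · simpa [hi] using this
  exact this hf

/-- The span of monomials with only negative exponents is stable under every ∂_v, and ∂_v is
injective on it for v ≠ 0. -/
theorem disjoint_torsion :
    Disjoint (monoSpan β (n := n) fun k => ∀ j, k j ≤ -1) (torsion β) := by
  rw [Submodule.disjoint_def]
  rintro f hf ⟨A, hA, hAf⟩
  have key : ∀ f ∈ monoSpan β (n := n) (fun k => ∀ j, k j ≤ -1),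
      A f ∈ monoSpan β (n := n) (fun k => ∀ j, k j ≤ -1) ∧ (A f = 0 → f = 0) := by
    clear hAf hf f
    induction hA using Submonoid.closure_induction with
    | one => exact fun f hf => ⟨hf, id⟩
    | mul A B _ _ h1 h2 =>
      exact fun f hf => ⟨(h1 _ (h2 f hf).1).1, fun h => (h2 f hf).2 ((h1 _ (h2 f hf).1).2 h)⟩
    | mem A hA =>
      obtain ⟨v, hv, rfl⟩ := hA
      exact fun f hf => ⟨derivation_mem_monoSpan v hf, eq_zero_of_derivation_eq_zero hn hf hv⟩
  exact (key f hf).2 hAf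

/-- A monomial that is polynomial of degree m in β_{σ j} is killed by m + 1 derivatives in the dual
direction j. -/
theorem mono_mem_torsion (σ : Fin n → Fin N) (hσ : LinearIndependent ℝ (β ∘ σ)) (j : Fin n)
    (m : ℕ) : ∀ k : Fin n → ℤ, k j = m → mono β σ k ∈ torsion β := by
  have hmem : (derivation β (dualVec hn σ hσ j)).toLinearMap ∈ derivationMonoid β :=
    Submonoid.subset_closure ⟨_, dualVec_ne_zero hn σ hσ j, rfl⟩
  induction m with
  | zero =>
    intro k hk
    refine ⟨_, hmem, ?_⟩
    change derivation β _ _ = 0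
    rw [derivation_dualVec_mono, hk]
    simp
  | succ m ih =>
    intro k hk
    obtain ⟨A, hA, h⟩ := ih (k - Pi.single j 1) (by simp [hk])
    refine ⟨A * (derivation β (dualVec hn σ hσ j)).toLinearMap, mul_mem hA hmem, ?_⟩
    change A (derivation β _ _) = 0
    rw [derivation_dualVec_mono, map_smul, h, smul_zero]

/-- Differentiation could produce the exponent -1 at j only from the exponent 0, and then the
coefficient k_j is zero. -/
theorem derivation_mem_monoSpan_ne (hspan : Submodule.span ℝ (Set.range β) = ⊤)
    (v : Complexification V) (f : rationalFunctions β) :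
    derivation β v f ∈ monoSpan β (n := n) fun k => k ≠ -1 := by
  have : monoSpan β (n := n) (fun _ => True) ≤
      (monoSpan β (n := n) fun k => k ≠ -1).comap (derivation β v).toLinearMap := by
    refine monoSpan_le fun σ k hσ _ => ?_
    change derivation β v (mono β σ k) ∈ monoSpan β _
    rw [derivation_mono]
    refine sum_mem fun j _ => ?_
    by_cases hkj : k j = 0
    · rw [hkj]
      simp
    · refine Submodule.smul_mem _ _ (mono_mem_monoSpan hσ fun h => hkj ?_)
      have := congrFun h j
      simpa using this
  rw [monoSpan_eq_top hn hspan] at this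
  exact this trivial

/-- A coordinate with exponent different from -1 can be integrated. -/
theorem mono_mem_span_derivation (σ : Fin n → Fin N) (hσ : LinearIndependent ℝ (β ∘ σ))
    (k : Fin n → ℤ) (hk : k ≠ -1) :
    mono β σ k ∈ Submodule.span ℂ {g | ∃ v f', g = derivation β v f'} := by
  obtain ⟨j, hj⟩ := Function.ne_iff.1 hk
  have h := derivation_dualVec_mono hn σ hσ j (k + Pi.single j 1)
  have hj' : ((k j : ℂ) + 1) ≠ 0 := by
    intro h
    apply hj
    have : (k j : ℂ) = ((-1 : ℤ) : ℂ) := by push_cast; linear_combination h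
    exact_mod_cast this
  have h2 : mono β σ k = ((k j : ℂ) + 1)⁻¹ •
      derivation β (dualVec hn σ hσ j) (mono β σ (k + Pi.single j 1)) := by
    rw [h, smul_smul, add_sub_cancel_right]
    simp [hj']
  rw [h2]
  exact Submodule.smul_mem _ _ (Submodule.subset_span ⟨_, _, rfl⟩)

theorem span_derivation_eq (hspan : Submodule.span ℝ (Set.range β) = ⊤) :
    Submodule.span ℂ {g | ∃ v f', g = derivation β v f'} =
      monoSpan β (n := n) fun k => k ≠ -1 := by
  refine le_antisymm ?_ (monoSpan_le fun σ k hσ hk => mono_mem_span_derivation hn σ hσ k hk)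
  rw [Submodule.span_le]
  rintro _ ⟨v, f, rfl⟩
  exact derivation_mem_monoSpan_ne hn hspan v f

omit [FiniteDimensional ℝ V] hn in
theorem smul_mem_complementSet (z : complementSet β) {r : ℝ} (hr : 0 < r) :
    (r : ℂ) • (z : Complexification V) ∈ complementSet β := fun i => by
  simpa [hr.ne'] using z.2 i

omit [FiniteDimensional ℝ V] hn in
theorem mono_smul (σ : Fin n → Fin N) (k : Fin n → ℤ) (z : complementSet β) {r : ℝ}
    (hr : 0 < r) : (mono β σ k : complementSet β → ℂ) ⟨_, smul_mem_complementSet z hr⟩ =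
      (r : ℂ) ^ (∑ j, k j) * (mono β σ k : complementSet β → ℂ) z := by
  have hr' : (r : ℂ) ≠ 0 := by exact_mod_cast hr.ne'
  have e : (r : ℂ) ^ (∑ j, k j) = ∏ j, (r : ℂ) ^ k j := by
    induction (Finset.univ : Finset (Fin n)) using Finset.induction_on with
    | empty => simp
    | insert a s ha ih => rw [Finset.sum_insert ha, zpow_add₀ hr', ih, Finset.prod_insert ha]
  rw [mono_apply, mono_apply, e, ← Finset.prod_mul_distrib]
  simp [mul_zpow]

omit [FiniteDimensional ℝ V] hn in
-- Compare r^n f(rz) as r → ∞: a simple element is homogeneous of degree -n, so this is constant,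
-- whereas the other monomials have degree below -n and give limit 0.
theorem disjoint_simple :
    Disjoint (monoSpan β (n := n) fun k => k = -1)
      (monoSpan β (n := n) fun k => (∀ j, k j ≤ -1) ∧ k ≠ -1) := by
  rw [Submodule.disjoint_def]
  intro f hf hf'
  refine Subtype.ext (funext fun z => ?_)
  have h1 : ∀ r : ℝ, (hr : 0 < r) → (r : ℂ) ^ n *
      (f : complementSet β → ℂ) ⟨_, smul_mem_complementSet z hr⟩ =
        (f : complementSet β → ℂ) z := by
    intro r hr
    have hr' : (r : ℂ) ≠ 0 := by exact_mod_cast hr.ne'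
    clear hf'
    induction hf using Submodule.span_induction with
    | zero => simp
    | add f g _ _ hf hg =>
      simp only [Subalgebra.coe_add, Pi.add_apply, mul_add, hf, hg]
    | smul a f _ hf =>
      simp only [Subalgebra.coe_smul, Pi.smul_apply, smul_eq_mul]
      rw [mul_left_comm, hf]
    | mem f hf =>
      obtain ⟨σ, k, -, rfl, rfl⟩ := hf
      rw [mono_smul σ _ z hr]
      simp [hr']
  have h2 : Tendsto (fun r : ℝ => if hr : 0 < r then
      (r : ℂ) ^ n * (f : complementSet β → ℂ) ⟨_, smul_mem_complementSet z hr⟩ else 0)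
      atTop (nhds 0) := by
    clear h1 hf
    induction hf' using Submodule.span_induction with
    | zero => simp
    | add f g _ _ hf hg =>
      have := hf.add hg
      rw [add_zero] at this
      refine this.congr fun r => ?_
      split_ifs
      · simp only [Subalgebra.coe_add, Pi.add_apply, mul_add]
      · simp
    | smul a f _ hf =>
      have := hf.const_mul a
      rw [mul_zero] at this
      refine this.congr fun r => ?_
      split_ifs
      · simp only [Subalgebra.coe_smul, Pi.smul_apply, smul_eq_mul]
        ring
      · simp
    | mem f hf =>
      obtain ⟨σ, k, -, ⟨hk1, hk2⟩, rfl⟩ := hf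
      obtain ⟨m, hm⟩ : ∃ m : ℕ, ∑ j, k j = -((n + (m + 1) : ℕ) : ℤ) := by
        obtain ⟨j, hj⟩ := Function.ne_iff.1 hk2
        have : ∑ j, k j < ∑ j : Fin n, (-1 : ℤ) :=
          Finset.sum_lt_sum (fun i _ => hk1 i)
            ⟨j, Finset.mem_univ j, lt_of_le_of_ne (hk1 j) hj⟩
        simp at this
        exact ⟨(-(∑ j, k j) - n - 1).toNat, by omega⟩
      have h3 : Tendsto (fun r : ℝ => ((r : ℂ) ^ (m + 1))⁻¹ *
          (mono β σ k : complementSet β → ℂ) z) atTop (nhds 0) := by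
        have : Tendsto (fun r : ℝ => ((r : ℂ) ^ (m + 1))⁻¹) atTop (nhds 0) := by
          refine tendsto_inv₀_cobounded.comp ?_
          refine (tendsto_pow_cobounded_cobounded (by simp)).comp ?_
          rw [← tendsto_norm_atTop_iff_cobounded]
          simpa using tendsto_abs_atTop_atTop
        simpa using this.mul_const _
      refine h3.congr' ?_
      filter_upwards [eventually_gt_atTop 0] with r hr
      have hr' : (r : ℂ) ≠ 0 := by exact_mod_cast hr.ne'
      rw [dif_pos hr, mono_smul σ k z hr, hm, zpow_neg, zpow_natCast]
      field_simp
      ring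
  refine tendsto_nhds_unique (tendsto_const_nhds.congr' ?_) h2
  filter_upwards [eventually_gt_atTop 0] with r hr
  rw [dif_pos hr, h1 r hr]

/-- The simple elements meet the derivatives trivially. -/
theorem disjoint_monoSpan_derivation :
    Disjoint (monoSpan β (n := n) fun k => k = -1) (monoSpan β (n := n) fun k => k ≠ -1) := by
  rw [Submodule.disjoint_def]
  intro f hf hf'
  -- A monomial with a nonnegative exponent is torsion, so the element splits into an all-negative
  -- part and a torsion part. The latter vanishes, being also a difference of all-negative elements.
  have hle : monoSpan β (n := n) (fun k => k ≠ -1) ≤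
      (monoSpan β (n := n) fun k => (∀ j, k j ≤ -1) ∧ k ≠ -1) ⊔ torsion β := by
    refine monoSpan_le fun σ k hσ hk => ?_
    by_cases h : ∀ j, k j ≤ -1
    · exact Submodule.mem_sup_left (mono_mem_monoSpan hσ ⟨h, hk⟩)
    · push Not at h
      obtain ⟨j, hj⟩ := h
      exact Submodule.mem_sup_right (mono_mem_torsion hn σ hσ j (k j).toNat k (by omega))
  obtain ⟨g, hg, t, ht, rfl⟩ := Submodule.mem_sup.1 (hle hf')
  have hmono : ∀ {P Q : (Fin n → ℤ) → Prop}, (∀ k, P k → Q k) → monoSpan β P ≤ monoSpan β Q :=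
    fun h => monoSpan_le fun σ k hσ hk => mono_mem_monoSpan hσ (h k hk)
  have ht0 : t = 0 := by
    refine Submodule.disjoint_def.1 (disjoint_torsion hn) t ?_ ht
    have h1 := hmono (Q := fun k => ∀ j, k j ≤ -1) (by rintro _ rfl j; simp) hf
    have h2 := hmono (Q := fun k => ∀ j, k j ≤ -1) (fun k hk => hk.1) hg
    simpa using sub_mem h1 h2
  rw [ht0, add_zero] at hf ⊢
  exact Submodule.disjoint_def.1 disjoint_simple g hf hg

omit [FiniteDimensional ℝ V] hn in
theorem simpleFraction_eq (σ : Fin n → Fin N) :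
    simpleFraction β σ = (mono β σ (-1) : complementSet β → ℂ) := by
  funext z
  simp [simpleFraction, mono_apply]

omit [FiniteDimensional ℝ V] hn in
theorem simpleElements_eq : simpleElements n β =
    (monoSpan β (n := n) fun k => k = -1).map (rationalFunctions β).val.toLinearMap := by
  rw [monoSpan, Submodule.map_span, simpleElements]
  congr 1
  ext f
  constructor
  · rintro ⟨σ, hσ, rfl⟩
    exact ⟨mono β σ (-1), ⟨σ, -1, hσ, rfl, rfl⟩, (simpleFraction_eq σ).symm⟩
  · rintro ⟨_, ⟨σ, k, hσ, rfl, rfl⟩, rfl⟩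
    exact ⟨σ, hσ, (simpleFraction_eq σ).symm⟩

/-- The decomposition of the ring of rational functions that defines the total residue. -/
theorem existsUnique_simple (hspan : Submodule.span ℝ (Set.range β) = ⊤)
    (f : rationalFunctions β) :
    ∃! s : simpleElements n β,
      (f : complementSet β → ℂ) - (s : complementSet β → ℂ) ∈ derivatives β := by
  have htop : f ∈ (monoSpan β (n := n) fun k => k = -1) ⊔ monoSpan β (n := n) fun k => k ≠ -1 := by
    have : monoSpan β (n := n) (fun _ => True) ≤
        (monoSpan β (n := n) fun k => k = -1) ⊔ monoSpan β (n := n) fun k => k ≠ -1 := by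
      refine monoSpan_le fun σ k hσ _ => ?_
      by_cases hk : k = -1
      · exact Submodule.mem_sup_left (mono_mem_monoSpan hσ hk)
      · exact Submodule.mem_sup_right (mono_mem_monoSpan hσ hk)
    rw [monoSpan_eq_top hn hspan] at this
    exact this trivial
  obtain ⟨s, hs, d, hd, rfl⟩ := Submodule.mem_sup.1 htop
  refine ⟨⟨s, by rw [simpleElements_eq]; exact ⟨s, hs, rfl⟩⟩, ?_, ?_⟩
  · have : ((s + d : rationalFunctions β) : complementSet β → ℂ) - (s : complementSet β → ℂ) =
        (d : complementSet β → ℂ) := by simp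
    simp only [this]
    rwa [mem_derivatives_iff, span_derivation_eq hn hspan]
  · rintro ⟨s', hs'⟩ h
    have hs'' := hs'
    rw [simpleElements_eq] at hs''
    obtain ⟨t, ht, rfl⟩ := hs''
    have h2 : (s + d) - t ∈ monoSpan β (n := n) fun k => k ≠ -1 := by
      rw [← span_derivation_eq hn hspan, ← mem_derivatives_iff]
      exact h
    have h3 : s - t = 0 := by
      refine Submodule.disjoint_def.1 (disjoint_monoSpan_derivation hn) _ (sub_mem hs ht) ?_
      have := sub_mem h2 hd
      convert this using 1
      ring
    rw [sub_eq_zero] at h3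
    subst h3
    rfl

/-- The total residue on the ring of rational functions, as a linear map. -/
def totalResidueLinear (hspan : Submodule.span ℝ (Set.range β) = ⊤) :
    rationalFunctions β →ₗ[ℂ] simpleElements n β :=
  have key : ∀ (f : rationalFunctions β) (s : simpleElements n β),
      (f : complementSet β → ℂ) - (s : complementSet β → ℂ) ∈ derivatives β →
        totalResidue n β f = s := fun f s hs => by
    have hex : ∃ s : simpleElements n β,
      (f : complementSet β → ℂ) - (s : complementSet β → ℂ) ∈ derivatives β := ⟨s, hs⟩
    rw [totalResidue, dif_pos hex]
    exact (existsUnique_simple hn hspan f).unique hex.choose_spec hs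
  have spec : ∀ f : rationalFunctions β, (f : complementSet β → ℂ) -
      (totalResidue n β f : complementSet β → ℂ) ∈ derivatives β := fun f => by
    obtain ⟨s, hs, -⟩ := existsUnique_simple hn hspan f
    rwa [key f s hs]
  { toFun := fun f => totalResidue n β f
    map_add' := fun f g => key _ _ <| by
      have := add_mem (spec f) (spec g)
      convert this using 1
      simp only [Subalgebra.coe_add, Submodule.coe_add]
      abel
    map_smul' := fun a f => key _ _ <| by
      have := Submodule.smul_mem _ a (spec f)
      convert this using 1
      simp only [Subalgebra.coe_smul, RingHom.id_apply, Submodule.coe_smul, smul_sub] }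

theorem totalResidueLinear_of_sub_mem (hspan : Submodule.span ℝ (Set.range β) = ⊤)
    (f : rationalFunctions β) (s : simpleElements n β)
    (hs : (f : complementSet β → ℂ) - (s : complementSet β → ℂ) ∈ derivatives β) :
    totalResidueLinear hn hspan f = s := by
  have hex : ∃ s : simpleElements n β,
    (f : complementSet β → ℂ) - (s : complementSet β → ℂ) ∈ derivatives β := ⟨s, hs⟩
  change totalResidue n β f = s
  rw [totalResidue, dif_pos hex]
  exact (existsUnique_simple hn hspan f).unique hex.choose_spec hs

theorem totalResidueLinear_derivation (hspan : Submodule.span ℝ (Set.range β) = ⊤)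
    (v : Complexification V) (f : rationalFunctions β) :
    totalResidueLinear hn hspan (derivation β v f) = 0 := by
  refine totalResidueLinear_of_sub_mem hn hspan _ _ ?_
  rw [Submodule.coe_zero, sub_zero, mem_derivatives_iff]
  exact Submodule.subset_span ⟨v, f, rfl⟩

theorem totalResidueLinear_mono (hspan : Submodule.span ℝ (Set.range β) = ⊤)
    (σ : Fin n → Fin N) (hσ : LinearIndependent ℝ (β ∘ σ)) :
    totalResidueLinear hn hspan (mono β σ (-1)) =
      ⟨simpleFraction β σ, Submodule.subset_span ⟨σ, hσ, rfl⟩⟩ := by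
  refine totalResidueLinear_of_sub_mem hn hspan _ _ ?_
  have : (mono β σ (-1) : complementSet β → ℂ) - simpleFraction β σ = 0 := by
    rw [simpleFraction_eq, sub_self]
  exact this ▸ zero_mem (derivatives β)

end TotalResidue

end PartitionResidue

end

noncomputable section

namespace PartitionResidue

open Module Filter MeasureTheory FourierTransform

section Laplace

variable {V : Type*} [NormedAddCommGroup V] [NormedSpace ℝ V] {n N : ℕ}

/-! ### Laplace transforms of simplicial cones -/

theorem measurableEmbedding_mulVec (M : Matrix (Fin n) (Fin n) ℝ) (hM : M.det ≠ 0) :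
    MeasurableEmbedding fun t : Fin n → ℝ => WithLp.toLp 2 (M.mulVec t) := by
  have h1 : MeasurableEmbedding (Matrix.toLin' M) := by
    refine (LinearMap.isClosedEmbedding_of_injective ?_).measurableEmbedding
    rw [LinearMap.ker_eq_bot]
    exact Matrix.mulVec_injective_iff_isUnit.2 ((Matrix.isUnit_iff_isUnit_det _).2 hM.isUnit)
  exact (MeasurableEquiv.toLp 2 (Fin n → ℝ)).measurableEmbedding.comp h1

theorem map_mulVec_volume (M : Matrix (Fin n) (Fin n) ℝ) (hM : M.det ≠ 0) :
    (volume : Measure (Fin n → ℝ)).map (fun t => WithLp.toLp 2 (M.mulVec t)) =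
      ENNReal.ofReal |M.det⁻¹| • (volume : Measure (EuclideanSpace ℝ (Fin n))) := by
  have h1 := Real.map_matrix_volume_pi_eq_smul_volume_pi hM
  have h2 := (PiLp.volume_preserving_toLp (Fin n)).map_eq
  have h3 : Measurable (Matrix.toLin' M) :=
    (LinearMap.continuous_of_finiteDimensional (Matrix.toLin' M)).measurable
  have h4 : (fun t : Fin n → ℝ => WithLp.toLp 2 (M.mulVec t)) =
      (WithLp.toLp 2) ∘ (Matrix.toLin' M) := by
    funext t
    simp
  have h5 : Measurable (WithLp.toLp 2 : (Fin n → ℝ) → EuclideanSpace ℝ (Fin n)) :=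
    (MeasurableEquiv.toLp 2 (Fin n → ℝ)).measurable
  rw [h4, ← Measure.map_map h5 h3, h1, Measure.map_smul, h2]

theorem integral_comp_mulVec (M : Matrix (Fin n) (Fin n) ℝ) (hM : M.det ≠ 0)
    (F : EuclideanSpace ℝ (Fin n) → ℂ) :
    ∫ x, F x = (|M.det| : ℝ) * ∫ t : Fin n → ℝ, F (WithLp.toLp 2 (M.mulVec t)) := by
  have h := (measurableEmbedding_mulVec M hM).integral_map (μ := volume) F
  rw [map_mulVec_volume M hM, integral_smul_measure, ENNReal.toReal_ofReal (abs_nonneg _)] at h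
  rw [← h, abs_inv, Complex.real_smul, ← mul_assoc, ← Complex.ofReal_mul,
    mul_inv_cancel₀ (abs_ne_zero.2 hM), Complex.ofReal_one, one_mul]

theorem integrable_comp_mulVec (M : Matrix (Fin n) (Fin n) ℝ) (hM : M.det ≠ 0)
    {F : EuclideanSpace ℝ (Fin n) → ℂ}
    (hF : Integrable fun t : Fin n → ℝ => F (WithLp.toLp 2 (M.mulVec t))) : Integrable F := by
  have h := ((measurableEmbedding_mulVec M hM).integrable_map_iff (μ := volume) (g := F)).2 hF
  rw [map_mulVec_volume M hM] at h
  refine (integrable_smul_measure ?_ ENNReal.ofReal_ne_top).1 h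
  simpa using hM

theorem integrable_exp_indicator {ζ : ℂ} (hζ : 0 < ζ.re) :
    Integrable fun s : ℝ => if 0 ≤ s then Complex.exp (-ζ * s) else 0 := by
  have h := integrableOn_exp_mul_complex_Ioi (a := -ζ) (by simpa using hζ) 0
  rw [← integrableOn_Ici_iff_integrableOn_Ioi, ← integrable_indicator_iff measurableSet_Ici] at h
  refine h.congr (Eventually.of_forall fun s => ?_)
  simp [Set.indicator]

theorem integral_exp_indicator {ζ : ℂ} (hζ : 0 < ζ.re) :
    ∫ s : ℝ, (if 0 ≤ s then Complex.exp (-ζ * s) else 0) = ζ⁻¹ := by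
  have h := integral_exp_mul_complex_Ioi (a := -ζ) (by simpa using hζ) 0
  rw [← integral_Ici_eq_integral_Ioi, ← integral_indicator measurableSet_Ici] at h
  have e : (fun s : ℝ => if 0 ≤ s then Complex.exp (-ζ * s) else 0) =
      (Set.Ici (0 : ℝ)).indicator fun s : ℝ => Complex.exp (-ζ * s) := by
    funext s
    simp [Set.indicator]
  rw [e, h]
  simp

variable (b : Basis (Fin n) ℝ V) (β : Fin N → StrongDual ℝ V)

/-- The matrix of a tuple of linear forms in the basis dual to `b`. -/
def coordMatrix (u : Fin n → StrongDual ℝ V) : Matrix (Fin n) (Fin n) ℝ :=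
  Matrix.of fun i j => u i (b j)

theorem coordMatrix_det_ne_zero (u : Fin n → StrongDual ℝ V) (hu : LinearIndependent ℝ u) :
    (coordMatrix b u).det ≠ 0 := by
  have h : LinearIndependent ℝ (coordMatrix b u).row := by
    rw [Fintype.linearIndependent_iff] at hu ⊢
    intro g hg
    refine hu g ?_
    refine ContinuousLinearMap.coe_injective (b.ext fun j => ?_)
    have := congrFun hg j
    simp only [Finset.sum_apply, Pi.smul_apply, Matrix.row, coordMatrix, Matrix.of_apply,
      Pi.zero_apply] at this
    simpa using this
  exact ((Matrix.isUnit_iff_isUnit_det _).1 (Matrix.linearIndependent_rows_iff_isUnit.1 h)).ne_zero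

variable [FiniteDimensional ℝ V]

/-- The linear form with given coordinates in the basis dual to `b`. -/
def ofCoords (x : EuclideanSpace ℝ (Fin n)) : StrongDual ℝ V :=
  ∑ j, x j • LinearMap.toContinuousLinearMap (b.coord j)

theorem continuous_ofCoords : Continuous (ofCoords b) := by
  unfold ofCoords
  fun_prop

theorem ofCoords_apply (x : EuclideanSpace ℝ (Fin n)) (j : Fin n) : ofCoords b x (b j) = x j := by
  simp [ofCoords, Finsupp.single_apply]

theorem ofCoords_coords (α : StrongDual ℝ V) :
    ofCoords b (WithLp.toLp 2 fun j => α (b j)) = α := by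
  refine ContinuousLinearMap.coe_injective (b.ext fun j => ?_)
  exact ofCoords_apply b _ j

theorem ofCoords_mulVec (u : Fin n → StrongDual ℝ V) (t : Fin n → ℝ) :
    ofCoords b (WithLp.toLp 2 ((coordMatrix b u).transpose.mulVec t)) = ∑ i, t i • u i := by
  refine ContinuousLinearMap.coe_injective (b.ext fun j => ?_)
  refine (ofCoords_apply b _ j).trans ?_
  simp [Matrix.mulVec, dotProduct, coordMatrix, mul_comm]

open Classical in
/-- The exponential `e^{-⟨a,z⟩}` restricted to the cone generated by `u`, in coordinates. -/
def coneExp (u : Fin n → StrongDual ℝ V) (z : Complexification V) (x : EuclideanSpace ℝ (Fin n)) :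
    ℂ :=
  if ofCoords b x ∈ cone u then Complex.exp (-z (ofCoords b x)) else 0

theorem coneExp_mulVec (u : Fin n → StrongDual ℝ V) (hu : LinearIndependent ℝ u)
    (z : Complexification V) (t : Fin n → ℝ) :
    coneExp b u z (WithLp.toLp 2 ((coordMatrix b u).transpose.mulVec t)) =
      ∏ i, if 0 ≤ t i then Complex.exp (-z (u i) * t i) else 0 := by
  have hmem : (∑ i, t i • u i) ∈ cone u ↔ ∀ i, 0 ≤ t i := by
    constructor
    · rintro ⟨s, hs, h⟩ i
      have := Fintype.linearIndependent_iff.1 hu (fun i => t i - s i)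
        (by simp only [sub_smul, Finset.sum_sub_distrib, h, sub_self]) i
      have := hs i
      linarith
    · exact fun h => ⟨t, h, rfl⟩
  rw [coneExp, ofCoords_mulVec, hmem]
  split_ifs with h
  · simp only [h, if_true, ← Complex.exp_sum]
    congr 1
    simp [mul_comm]
  · push Not at h
    obtain ⟨i, hi⟩ := h
    exact (Finset.prod_eq_zero (Finset.mem_univ i) (if_neg (not_le.2 hi))).symm

theorem integrable_coneExp (u : Fin n → StrongDual ℝ V) (hu : LinearIndependent ℝ u)
    (z : Complexification V) (hz : ∀ i, 0 < (z (u i)).re) : Integrable (coneExp b u z) := by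
  refine integrable_comp_mulVec (coordMatrix b u).transpose
    (by rw [Matrix.det_transpose]; exact coordMatrix_det_ne_zero b u hu) ?_
  simp only [coneExp_mulVec b u hu]
  exact Integrable.fintype_prod fun i => integrable_exp_indicator (hz i)

/-- In the coordinates along u the cone is the orthant and the integral splits into one-dimensional
ones; the Jacobian is the volume of u. -/
theorem integral_coneExp (u : Fin n → StrongDual ℝ V) (hu : LinearIndependent ℝ u)
    (z : Complexification V) (hz : ∀ i, 0 < (z (u i)).re) :
    ∫ x, coneExp b u z x = latticeVolume b u * ∏ i, (z (u i))⁻¹ := by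
  rw [integral_comp_mulVec (coordMatrix b u).transpose
    (by rw [Matrix.det_transpose]; exact coordMatrix_det_ne_zero b u hu)]
  simp only [coneExp_mulVec b u hu]
  rw [integral_fintype_prod_volume_eq_prod
    (fun i (s : ℝ) => if 0 ≤ s then Complex.exp (-z (u i) * s) else 0), Matrix.det_transpose]
  congr 1
  exact Finset.prod_congr rfl fun i _ => integral_exp_indicator (hz i)

/-- The point `x + 2πi w` of the complexification. -/
def complexPoint (x w : V) : Complexification V :=
  LinearMap.toContinuousLinearMap
    { toFun := fun α => (α x : ℂ) + 2 * Real.pi * Complex.I * (α w : ℂ)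
      map_add' := fun α γ => by simp; ring
      map_smul' := fun r α => by simp; ring }

theorem complexPoint_apply (x w : V) (α : StrongDual ℝ V) :
    complexPoint x w α = (α x : ℂ) + 2 * Real.pi * Complex.I * (α w : ℂ) := rfl

theorem complexPoint_re (x w : V) (α : StrongDual ℝ V) : (complexPoint x w α).re = α x := by
  simp [complexPoint_apply]

/-- The Fourier character moves the parameter from x to x + 2πi w. Fourier transforms in a are thus
Laplace transforms along an imaginary translate. -/
theorem exp_smul_coneExp (u : Fin n → StrongDual ℝ V) (x : V) (w a : EuclideanSpace ℝ (Fin n)) :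
    Complex.exp (((-2 * Real.pi * inner ℝ a w : ℝ) : ℂ) * Complex.I) •
      coneExp b u (complexPoint x 0) a = coneExp b u (complexPoint x (∑ j, w j • b j)) a := by
  simp only [coneExp]
  split_ifs
  · rw [smul_eq_mul, ← Complex.exp_add]
    congr 1
    have : inner ℝ a w = ofCoords b a (∑ j, w j • b j) := by
      simp only [map_sum, map_smul, ofCoords_apply, PiLp.inner_apply]
      rfl
    rw [this]
    simp only [complexPoint_apply, map_zero]
    push_cast
    ring
  · simp

/-! ### The Jeffrey–Kirwan functional. -/

open Classical in
/-- Linear relations between the simple fractions are respected by the values that define the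
Jeffrey–Kirwan residue. -/
theorem sum_jk_eq_zero {c : Set (StrongDual ℝ V)} (hc : IsChamber n β c)
    (hhalf : ∃ v : V, ∀ i, 0 < β i v) (S : Finset (Fin n → Fin N))
    (hS : ∀ σ ∈ S, LinearIndependent ℝ (β ∘ σ)) (d : (Fin n → Fin N) → ℂ)
    (hd : ∑ σ ∈ S, d σ • simpleFraction β σ = 0) :
    ∑ σ ∈ S, d σ * (if c ⊆ cone (β ∘ σ) then ((latticeVolume b (β ∘ σ) : ℝ) : ℂ)⁻¹ else 0) = 0 := by
  have hn := finrank_strongDual b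
  obtain ⟨x, hx⟩ := hhalf
  obtain ⟨a, ha⟩ := hc.nonempty
  -- Dividing by the volume compensates the Jacobian, so the Laplace transform of G is exactly the
  -- given relation ∑ d_σ f_σ.
  set e : (Fin n → Fin N) → ℂ := fun σ => d σ * ((latticeVolume b (β ∘ σ) : ℝ) : ℂ)⁻¹ with he
  have hvol : ∀ σ ∈ S, ((latticeVolume b (β ∘ σ) : ℝ) : ℂ) ≠ 0 := fun σ hσ => by
    exact_mod_cast abs_ne_zero.2 (coordMatrix_det_ne_zero b _ (hS σ hσ))
  set G : EuclideanSpace ℝ (Fin n) → ℂ := fun p =>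
    ∑ σ ∈ S, e σ * coneExp b (β ∘ σ) (complexPoint x 0) p with hG
  have hre : ∀ w : V, ∀ (σ : Fin n → Fin N) i, 0 < (complexPoint x w ((β ∘ σ) i)).re :=
    fun w σ i => by rw [complexPoint_re]; exact hx _
  have hGint : Integrable G := integrable_finsetSum _ fun σ hσ =>
    (integrable_coneExp b _ (hS σ hσ) _ (hre 0 σ)).const_mul _
  have hFG : 𝓕 G = fun _ => 0 := by
    funext w
    rw [Real.fourier_eq']
    have h1 : ∀ p, Complex.exp (((-2 * Real.pi * inner ℝ p w : ℝ) : ℂ) * Complex.I) • G p =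
        ∑ σ ∈ S, e σ * coneExp b (β ∘ σ) (complexPoint x (∑ j, w j • b j)) p := by
      intro p
      rw [hG]
      simp only [Finset.smul_sum]
      refine Finset.sum_congr rfl fun σ _ => ?_
      rw [← exp_smul_coneExp b, smul_eq_mul, smul_eq_mul, mul_left_comm]
    simp only [h1]
    rw [integral_finsetSum _ fun σ hσ =>
      (integrable_coneExp b _ (hS σ hσ) _ (hre _ σ)).const_mul _]
    -- Each β_i has positive real part at x + 2πi w, so the relation may be evaluated there.
    have hz : complexPoint x (∑ j, w j • b j) ∈ complementSet β := fun i h => by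
      have := hx i
      rw [← complexPoint_re x (∑ j, w j • b j), h] at this
      simp at this
    have h2 := congrFun hd ⟨_, hz⟩
    simp only [Finset.sum_apply, Pi.smul_apply, Pi.zero_apply, simpleFraction, smul_eq_mul] at h2
    rw [← h2]
    refine Finset.sum_congr rfl fun σ hσ => ?_
    rw [integral_const_mul, integral_coneExp b _ (hS σ hσ) _ (hre _ σ), he]
    have := hvol σ hσ
    field_simp
    rfl
  set p : EuclideanSpace ℝ (Fin n) := WithLp.toLp 2 fun j => a (b j) with hp
  have hpa : ofCoords b p = a := ofCoords_coords b a
  have hev : ∀ᶠ q in nhds p, ofCoords b q ∈ c :=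
    (continuous_ofCoords b).continuousAt.eventually_mem
      (by rw [hpa]; exact hc.isOpen.mem_nhds ha)
  have hlocal : ∀ σ ∈ S, ∀ q, ofCoords b q ∈ c → coneExp b (β ∘ σ) (complexPoint x 0) q =
      if c ⊆ cone (β ∘ σ) then Complex.exp (-complexPoint x 0 (ofCoords b q)) else 0 := by
    intro σ hσ q hq
    rw [coneExp]
    by_cases hcσ : c ⊆ cone (β ∘ σ)
    · rw [if_pos hcσ, if_pos (hcσ hq)]
    · rw [if_neg hcσ, if_neg fun h => hcσ (hc.subset_cone hn σ (hS σ hσ) hq h)]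
  -- Near a point of c each cone either contains everything in sight or nothing, so G is locally a
  -- fixed multiple of an exponential.
  have hcont : ContinuousAt G p := by
    refine tendsto_finsetSum _ fun σ hσ => Tendsto.const_mul _ ?_
    change ContinuousAt (coneExp b (β ∘ σ) (complexPoint x 0)) p
    have h : ContinuousAt (fun q => if c ⊆ cone (β ∘ σ) then
        Complex.exp (-complexPoint x 0 (ofCoords b q)) else 0) p := by
      have := continuous_ofCoords b
      split_ifs
      · fun_prop
      · fun_prop
    refine h.congr ?_
    filter_upwards [hev] with q hq
    exact (hlocal σ hσ q hq).symm
  have hinv := hGint.fourierInv_fourier_eq (by rw [hFG]; exact integrable_zero _ _ _) hcont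
  rw [hFG, Real.fourierInv_eq'] at hinv
  simp only [smul_zero, integral_zero] at hinv
  have hexp : Complex.exp (-complexPoint x 0 a) ≠ 0 := Complex.exp_ne_zero _
  refine (mul_eq_zero.1 ?_).resolve_left hexp
  refine Eq.trans ?_ hinv.symm
  rw [Finset.mul_sum, hG]
  refine Finset.sum_congr rfl fun σ hσ => ?_
  rw [hlocal σ hσ p (by rw [hpa]; exact ha), hpa, he]
  split_ifs
  · ring
  · simp

/-- The Jeffrey–Kirwan functional exists and is unique. -/
theorem existsUnique_isJKFunctional {c : Set (StrongDual ℝ V)} (hc : IsChamber n β c)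
    (hhalf : ∃ v : V, ∀ i, 0 < β i v) :
    ∃! J : simpleElements n β →ₗ[ℂ] ℂ, IsJKFunctional b β c J := by
  classical
  let K := {σ : Fin n → Fin N // LinearIndependent ℝ (β ∘ σ)}
  let s : K → simpleElements n β := fun σ =>
    ⟨simpleFraction β σ.1, Submodule.subset_span ⟨σ.1, σ.2, rfl⟩⟩
  let val : K → ℂ := fun σ =>
    if c ⊆ cone (β ∘ σ.1) then ((latticeVolume b (β ∘ σ.1) : ℝ) : ℂ)⁻¹ else 0
  have htop : Submodule.span ℂ (Set.range s) = ⊤ := by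
    rw [eq_top_iff]
    rintro ⟨f, hf⟩ -
    have h : Submodule.map (simpleElements n β).subtype (Submodule.span ℂ (Set.range s)) =
        simpleElements n β := by
      refine (Submodule.map_span _ _).trans (congrArg (Submodule.span ℂ) ?_)
      ext g
      constructor
      · rintro ⟨_, ⟨σ, rfl⟩, rfl⟩
        exact ⟨σ.1, σ.2, rfl⟩
      · rintro ⟨σ, hσ, rfl⟩
        exact ⟨_, ⟨⟨σ, hσ⟩, rfl⟩, rfl⟩
    have hf' := hf
    rw [← h] at hf'
    obtain ⟨g, hg, rfl⟩ := hf'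
    exact hg
  let L := Fintype.linearCombination ℂ s
  let M := Fintype.linearCombination ℂ val
  have hLsurj : Function.Surjective L := by
    rw [← LinearMap.range_eq_top, Fintype.range_linearCombination, htop]
  -- Relations among the f_σ are relations among the prescribed values, so these values factor
  -- through the surjection L onto the simple elements.
  have hker : LinearMap.ker L ≤ LinearMap.ker M := by
    intro d hd
    rw [LinearMap.mem_ker, Fintype.linearCombination_apply] at hd ⊢
    have h := sum_jk_eq_zero b β hc hhalf
      (Finset.univ.filter fun σ => LinearIndependent ℝ (β ∘ σ))
      (fun σ hσ => (Finset.mem_filter.1 hσ).2)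
      (fun σ => if h : LinearIndependent ℝ (β ∘ σ) then d ⟨σ, h⟩ else 0) ?_
    · rw [← h, Finset.sum_subtype (p := fun σ => LinearIndependent ℝ (β ∘ σ)) _ (by simp)]
      refine Finset.sum_congr rfl fun σ _ => ?_
      simp [σ.2, val]
    · have h2 := congrArg (Submodule.subtype _) hd
      rw [map_sum, map_zero] at h2
      rw [← h2, Finset.sum_subtype (p := fun σ => LinearIndependent ℝ (β ∘ σ)) _ (by simp)]
      refine Finset.sum_congr rfl fun σ _ => ?_
      simp [σ.2, s]
  obtain ⟨J, hJ⟩ : ∃ J : simpleElements n β →ₗ[ℂ] ℂ, J ∘ₗ L = M := by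
    obtain ⟨g, hg⟩ := L.exists_rightInverse_of_surjective (LinearMap.range_eq_top.2 hLsurj)
    refine ⟨M ∘ₗ g, LinearMap.ext fun d => ?_⟩
    have h : g (L d) - d ∈ LinearMap.ker L := by
      rw [LinearMap.mem_ker, map_sub, sub_eq_zero]
      exact LinearMap.congr_fun hg (L d)
    have h2 := hker h
    rwa [LinearMap.mem_ker, map_sub, sub_eq_zero] at h2
  have hJs : ∀ σ, J (s σ) = val σ := by
    intro σ
    have := LinearMap.congr_fun hJ (Pi.single σ 1)
    simpa [L, M, Fintype.linearCombination_apply_single] using this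
  refine ⟨J, fun σ hσ => by simpa [s, val] using hJs ⟨σ, hσ⟩, ?_⟩
  intro J' hJ'
  refine LinearMap.ext_on_range htop fun σ => ?_
  rw [hJs]
  simpa [val] using hJ' σ.1 σ.2

end Laplace

end PartitionResidue

end

noncomputable section

namespace PartitionResidue

open Module

/-! ### Laurent series with coefficients in a ring -/

section LaurentGeneral

open HahnSeries (single ofPowerSeries coeff_mul coeff_mul_left' coeff_mul_right' coeff_single coeff_mul_single single_mul_single ofPowerSeries_apply ofPowerSeries_apply_coeff ofPowerSeries_X ofPowerSeries_C)

/-- Coefficientwise application of a ring homomorphism to a Laurent series. -/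
def laurentMap {R S : Type*} [CommRing R] [CommRing S] (f : R →+* S) :
    LaurentSeries R →+* LaurentSeries S where
  toFun x := x.map f
  map_zero' := HahnSeries.map_zero (f : R →+* S).toMonoidWithZeroHom.toZeroHom
  map_one' := HahnSeries.map_one f.toMonoidWithZeroHom
  map_add' _ _ := HahnSeries.map_add f.toAddMonoidHom
  map_mul' _ _ := HahnSeries.map_mul f.toNonUnitalRingHom

@[simp] theorem laurentMap_coeff {R S : Type*} [CommRing R] [CommRing S] (f : R →+* S)
    (x : LaurentSeries R) (k : ℤ) : (laurentMap f x).coeff k = f (x.coeff k) := rfl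

theorem ofPowerSeries_coeff_of_neg {R : Type*} [CommRing R] (x : PowerSeries R) {k : ℤ}
    (hk : k < 0) : (ofPowerSeries ℤ R x).coeff k = 0 := by
  rw [ofPowerSeries_apply, HahnSeries.embDomain_of_notMem_range]
  rintro ⟨m, hm⟩
  simp at hm
  omega

/-- Coefficientwise application of a derivation to a Laurent series. -/
def laurentDerivation {R : Type*} [CommRing R] [Algebra ℂ R] (D : Derivation ℂ R R)
    (x : LaurentSeries R) : LaurentSeries R := x.map D

@[simp] theorem laurentDerivation_coeff {R : Type*} [CommRing R] [Algebra ℂ R]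
    (D : Derivation ℂ R R) (x : LaurentSeries R) (k : ℤ) :
    (laurentDerivation D x).coeff k = D (x.coeff k) := rfl

theorem laurentDerivation_mul {R : Type*} [CommRing R] [Algebra ℂ R]
    (D : Derivation ℂ R R) (x y : LaurentSeries R) :
    laurentDerivation D (x * y) = laurentDerivation D x * y + x * laurentDerivation D y := by
  -- D only shrinks supports, so the three products can be summed over the same pairs of exponents.
  have hx : (laurentDerivation D x).support ⊆ x.support := fun k hk h => hk (by simp [h])
  have hy : (laurentDerivation D y).support ⊆ y.support := fun k hk h => hk (by simp [h])
  ext k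
  rw [laurentDerivation_coeff, HahnSeries.coeff_add, coeff_mul_left' x.isPWO_support hx,
    coeff_mul_right' y.isPWO_support hy, coeff_mul, map_sum, ← Finset.sum_add_distrib]
  refine Finset.sum_congr rfl fun ij _ => ?_
  simp only [D.leibniz, smul_eq_mul, laurentDerivation_coeff]
  ring

theorem laurentDerivation_add {R : Type*} [CommRing R] [Algebra ℂ R]
    (D : Derivation ℂ R R) (x y : LaurentSeries R) :
    laurentDerivation D (x + y) = laurentDerivation D x + laurentDerivation D y := by
  ext k
  simp

theorem laurentDerivation_one {R : Type*} [CommRing R] [Algebra ℂ R]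
    (D : Derivation ℂ R R) : laurentDerivation D (1 : LaurentSeries R) = 0 := by
  ext k
  rw [laurentDerivation_coeff, HahnSeries.coeff_one]
  split_ifs <;> simp

/-- Here y is the logarithmic derivative of x, carried as a factor so that x need not be inverted.
-/
theorem laurentDerivation_pow {R : Type*} [CommRing R] [Algebra ℂ R]
    (D : Derivation ℂ R R) {x y : LaurentSeries R} (h : laurentDerivation D x = x * y) (m : ℕ) :
    laurentDerivation D (x ^ m) = x ^ m * (m * y) := by
  induction m with
  | zero => simp [laurentDerivation_one]
  | succ m ih =>
    rw [pow_succ, laurentDerivation_mul, ih, h]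
    push_cast
    ring

theorem laurentDerivation_prod {R : Type*} [CommRing R] [Algebra ℂ R]
    (D : Derivation ℂ R R) {κ : Type*} [DecidableEq κ] (s : Finset κ) {x y : κ → LaurentSeries R}
    (h : ∀ i, laurentDerivation D (x i) = x i * y i) :
    laurentDerivation D (∏ i ∈ s, x i) = (∏ i ∈ s, x i) * ∑ i ∈ s, y i := by
  induction s using Finset.induction_on with
  | empty => simp [laurentDerivation_one]
  | insert a s ha ih =>
    rw [Finset.prod_insert ha, Finset.sum_insert ha, laurentDerivation_mul, ih, h]
    ring

/-- The Laurent series with coefficients in a subring. -/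
def laurentSubring {R : Type*} [CommRing R] (S : Subring R) : Subring (LaurentSeries R) where
  carrier := {x | ∀ k, x.coeff k ∈ S}
  zero_mem' := fun k => by simp
  one_mem' := fun k => by
    rw [HahnSeries.coeff_one]
    split_ifs
    · exact one_mem S
    · exact zero_mem S
  add_mem' := fun {x y} hx hy k => by
    rw [HahnSeries.coeff_add]
    exact add_mem (hx k) (hy k)
  neg_mem' := fun {x} hx k => by
    rw [HahnSeries.coeff_neg]
    exact neg_mem (hx k)
  mul_mem' := fun {x y} hx hy k => by
    rw [coeff_mul]
    exact sum_mem fun ij _ => mul_mem (hx _) (hy _)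

end LaurentGeneral

/-! ### The kernel as a Laurent series of rational functions -/

section Kernel

open HahnSeries (single ofPowerSeries coeff_mul coeff_mul_left' coeff_mul_right' coeff_single coeff_mul_single single_mul_single ofPowerSeries_apply ofPowerSeries_apply_coeff ofPowerSeries_X ofPowerSeries_C)

variable {V : Type*} [NormedAddCommGroup V] [NormedSpace ℝ V] {n N : ℕ}
variable {β : Fin N → StrongDual ℝ V}

variable (β) in
/-- Evaluation of rational functions at a point of the complement. -/
def evalAt (z : complementSet β) : rationalFunctions β →+* ℂ :=
  (Pi.evalRingHom (fun _ : complementSet β => ℂ) z).comp (rationalFunctions β).val.toRingHom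

@[simp] theorem evalAt_apply (z : complementSet β) (f : rationalFunctions β) :
    evalAt β z f = (f : complementSet β → ℂ) z := rfl

/-- Elements of R are functions, so identities of series over R reduce to identities of scalar
series along each line. -/
theorem laurent_ext {x y : LaurentSeries (rationalFunctions β)}
    (h : ∀ z, laurentMap (evalAt β z) x = laurentMap (evalAt β z) y) : x = y := by
  ext k
  refine congrFun ?_ _
  funext z
  exact congrArg (fun w : LaurentSeries ℂ => w.coeff k) (h z)

variable (β) in
/-- The composition of a power series in one variable with a linear form, as a Laurent series
graded by the degree. -/
def compLinear (α : StrongDual ℝ V) :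
    PowerSeries ℂ →+* LaurentSeries (rationalFunctions β) :=
  (ofPowerSeries ℤ (rationalFunctions β)).comp
    ((PowerSeries.rescale (linearFn β α)).comp
      (PowerSeries.map (algebraMap ℂ (rationalFunctions β))))

theorem compLinear_coeff (α : StrongDual ℝ V) (a : PowerSeries ℂ) (k : ℕ) :
    (compLinear β α a).coeff k = PowerSeries.coeff k a • linearFn β α ^ k := by
  simp only [compLinear, RingHom.comp_apply, ofPowerSeries_apply_coeff, PowerSeries.coeff_rescale,
    PowerSeries.coeff_map]
  rw [mul_comm, Algebra.smul_def]

theorem compLinear_coeff_of_neg (α : StrongDual ℝ V) (a : PowerSeries ℂ) {k : ℤ} (hk : k < 0) :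
    (compLinear β α a).coeff k = 0 :=
  ofPowerSeries_coeff_of_neg _ hk

theorem laurentMap_compLinear (z : complementSet β) (α : StrongDual ℝ V) (a : PowerSeries ℂ) :
    laurentMap (evalAt β z) (compLinear β α a) =
      ofPowerSeries ℤ ℂ (PowerSeries.rescale ((z : Complexification V) α) a) := by
  ext k
  rcases lt_or_ge k 0 with hk | hk
  · rw [laurentMap_coeff, compLinear_coeff_of_neg _ _ hk, ofPowerSeries_coeff_of_neg _ hk, map_zero]
  · lift k to ℕ using hk
    rw [laurentMap_coeff, compLinear_coeff, ofPowerSeries_apply_coeff, PowerSeries.coeff_rescale]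
    simp [mul_comm]

variable (β) in
/-- The exponential of a linear form. -/
def expLinear (α : StrongDual ℝ V) : LaurentSeries (rationalFunctions β) :=
  compLinear β α (PowerSeries.exp ℂ)

theorem laurentMap_expLinear (z : complementSet β) (α : StrongDual ℝ V) :
    laurentMap (evalAt β z) (expLinear β α) = expSeries ((z : Complexification V) α) :=
  laurentMap_compLinear z α _

theorem expSeries_add (a b : ℂ) : expSeries (a + b) = expSeries a * expSeries b := by
  rw [expSeries, expSeries, expSeries, ← map_mul, PowerSeries.exp_mul_exp_eq_exp_add]

theorem expLinear_add (α γ : StrongDual ℝ V) :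
    expLinear β (α + γ) = expLinear β α * expLinear β γ :=
  laurent_ext fun z => by
    simp only [map_mul, laurentMap_expLinear, map_add, expSeries_add]

theorem expLinear_neg (α : StrongDual ℝ V) :
    expLinear β (-α) = compLinear β α (PowerSeries.rescale (-1) (PowerSeries.exp ℂ)) :=
  laurent_ext fun z => by
    rw [laurentMap_expLinear, laurentMap_compLinear, expSeries, PowerSeries.rescale_rescale]
    simp

/-- The exponent of t records the degree, which ∂_v lowers by one while leaving t alone; the factor
`single 1` restores the grading. -/
theorem laurentDerivation_expLinear (v : Complexification V) (α : StrongDual ℝ V) :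
    laurentDerivation (derivation β v) (expLinear β α) =
      expLinear β α * single 1 (algebraMap ℂ _ (v α)) := by
  ext1
  funext k
  rw [laurentDerivation_coeff, coeff_mul_single]
  rcases lt_or_ge k 0 with hk | hk
  · rw [expLinear, compLinear_coeff_of_neg _ _ hk, compLinear_coeff_of_neg _ _ (by omega)]
    simp
  · lift k to ℕ using hk
    cases k with
    | zero =>
      rw [expLinear, compLinear_coeff, compLinear_coeff_of_neg _ _ (by simp)]
      simp
    | succ k =>
      rw [expLinear, compLinear_coeff]
      have : ((k + 1 : ℕ) : ℤ) - 1 = (k : ℤ) := by simp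
      rw [this, compLinear_coeff, Derivation.map_smul, Derivation.leibniz_pow, derivation_linearFn,
        PowerSeries.coeff_exp, PowerSeries.coeff_exp]
      simp only [add_tsub_cancel_right, smul_eq_mul, nsmul_eq_mul, Algebra.smul_def (R := ℂ),
        Nat.factorial_succ]
      have h2 : ((k + 1 : ℕ) : rationalFunctions β) = algebraMap ℂ _ ((k + 1 : ℕ) : ℂ) := by simp
      rw [h2]
      have h3 : (algebraMap ℚ ℂ (1 / ((k + 1) * k.factorial : ℕ))) * ((k + 1 : ℕ) : ℂ) =
          algebraMap ℚ ℂ (1 / (k.factorial : ℕ)) := by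
        have : (k.factorial : ℂ) ≠ 0 := by exact_mod_cast k.factorial_ne_zero
        have : (k + 1 : ℂ) ≠ 0 := by exact_mod_cast k.succ_ne_zero
        simp
        field_simp
      rw [← h3, map_mul (algebraMap ℂ (rationalFunctions β))]
      ring

theorem constantCoeff_rescale_exp (a : ℂ) :
    PowerSeries.constantCoeff (PowerSeries.rescale a (PowerSeries.exp ℂ)) = 1 := by
  rw [← PowerSeries.coeff_zero_eq_constantCoeff_apply, PowerSeries.coeff_rescale]
  simp

/-- The power series `(1 - e^{-t}) / t`. -/
def toddDenom : PowerSeries ℂ :=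
  PowerSeries.mk fun k =>
    PowerSeries.coeff (k + 1) (1 - PowerSeries.rescale (-1) (PowerSeries.exp ℂ))

theorem X_mul_toddDenom :
    PowerSeries.X * toddDenom = 1 - PowerSeries.rescale (-1) (PowerSeries.exp ℂ) := by
  ext k
  cases k with
  | zero => simp [constantCoeff_rescale_exp]
  | succ k => rw [PowerSeries.coeff_succ_X_mul, toddDenom, PowerSeries.coeff_mk]

theorem constantCoeff_toddDenom : PowerSeries.constantCoeff toddDenom = 1 := by
  rw [← PowerSeries.coeff_zero_eq_constantCoeff_apply, toddDenom, PowerSeries.coeff_mk]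
  simp [PowerSeries.coeff_exp, PowerSeries.coeff_one]

open Classical in
variable (β) in
/-- The expansion of `1 / (1 - w e^{-β_i})`. -/
def geomInv (i : Fin N) (w : ℂ) : LaurentSeries (rationalFunctions β) :=
  if w = 1 then single (-1) (powFn β i (-1)) * compLinear β (β i) toddDenom⁻¹
  else compLinear β (β i)
    (1 - PowerSeries.C w * PowerSeries.rescale (-1) (PowerSeries.exp ℂ))⁻¹

variable (β) in
/-- The series `1 - w e^{-β_i}`. -/
def geomDenom (i : Fin N) (w : ℂ) : LaurentSeries (rationalFunctions β) :=
  1 - HahnSeries.C (algebraMap ℂ _ w) * expLinear β (-β i)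

theorem compLinear_C (α : StrongDual ℝ V) (w : ℂ) :
    compLinear β α (PowerSeries.C w) = HahnSeries.C (algebraMap ℂ _ w) := by
  rw [compLinear, RingHom.comp_apply, RingHom.comp_apply, PowerSeries.map_C]
  have : PowerSeries.rescale (linearFn β α)
      (PowerSeries.C (algebraMap ℂ (rationalFunctions β) w)) =
      PowerSeries.C (algebraMap ℂ (rationalFunctions β) w) := by
    ext1 k
    rw [PowerSeries.coeff_rescale, PowerSeries.coeff_C]
    split_ifs with h
    · simp [h]
    · simp
  rw [this, ofPowerSeries_C]

theorem geomDenom_eq (i : Fin N) (w : ℂ) : geomDenom β i w =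
    compLinear β (β i) (1 - PowerSeries.C w * PowerSeries.rescale (-1) (PowerSeries.exp ℂ)) := by
  rw [geomDenom, expLinear_neg, map_sub, map_mul, compLinear_C, map_one]

theorem geomInv_mul_geomDenom (i : Fin N) (w : ℂ) : geomInv β i w * geomDenom β i w = 1 := by
  rw [geomInv]
  split_ifs with hw
  · have h1 : geomDenom β i w =
        single 1 (linearFn β (β i)) * compLinear β (β i) toddDenom := by
      have hX : compLinear β (β i) PowerSeries.X = single 1 (linearFn β (β i)) := by
        rw [compLinear, RingHom.comp_apply, RingHom.comp_apply, PowerSeries.map_X,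
          PowerSeries.rescale_X, map_mul, ofPowerSeries_X, ofPowerSeries_C]
        simp [HahnSeries.C_apply]
      rw [geomDenom_eq, hw, map_one, one_mul, ← X_mul_toddDenom, map_mul, hX]
    rw [h1, mul_mul_mul_comm, single_mul_single, ← powFn_one, ← powFn_add, ← map_mul,
      PowerSeries.inv_mul_cancel _ (by rw [constantCoeff_toddDenom]; exact one_ne_zero)]
    simp [powFn_zero]
  · rw [geomDenom_eq, ← map_mul, PowerSeries.inv_mul_cancel, map_one]
    simpa [sub_eq_zero, constantCoeff_rescale_exp] using Ne.symm hw

variable (β) in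
/-- The expansion of `e^λ / ∏ (1 - w_i e^{-β_i})^{h_i}`. -/
def kernel (w : Fin N → ℂ) (h : Fin N → ℕ) (α : StrongDual ℝ V) :
    LaurentSeries (rationalFunctions β) :=
  expLinear β α * ∏ i, geomInv β i (w i) ^ h i

/-- Evaluation at z is a ring homomorphism, and an inverse in the field of Laurent series is unique.
Through this, homogeneous components of the kernel function are seen to lie in R. -/
theorem laurentMap_kernel (z : complementSet β) (y : Fin N → ℂ) (h : Fin N → ℕ)
    (p : Complexification V) (α : StrongDual ℝ V) :
    laurentMap (evalAt β z)
      (kernel β (fun i => Complex.exp (p (β i)) * Complex.exp (y i)) h α) =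
      kernelFunction β y h p α z := by
  have hden : ∀ i, laurentMap (evalAt β z)
      (geomDenom β i (Complex.exp (p (β i)) * Complex.exp (y i))) =
      1 - HahnSeries.C (Complex.exp (p (β i)) * Complex.exp (y i)) *
        expSeries (-((z : Complexification V) (β i))) := fun i => by
    rw [geomDenom, map_sub, map_mul, laurentMap_expLinear, map_one, map_neg]
    congr 2
    ext k
    rw [laurentMap_coeff, HahnSeries.C_apply, HahnSeries.C_apply, coeff_single, coeff_single]
    split_ifs <;> simp
  rw [kernel, kernelFunction, map_mul, map_prod, laurentMap_expLinear, div_eq_mul_inv,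
    ← Finset.prod_inv_distrib]
  congr 1
  refine Finset.prod_congr rfl fun i _ => ?_
  rw [map_pow, ← inv_pow, ← hden]
  congr 1
  refine eq_inv_of_mul_eq_one_left ?_
  rw [← map_mul, geomInv_mul_geomDenom, map_one]

theorem homogeneousComponent_kernelFunction (k : ℤ) (y : Fin N → ℂ) (h : Fin N → ℕ)
    (p : Complexification V) (α : StrongDual ℝ V) :
    homogeneousComponent k (kernelFunction β y h p α) =
      ((kernel β (fun i => Complex.exp (p (β i)) * Complex.exp (y i)) h α).coeff k :
        complementSet β → ℂ) := by
  funext z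
  rw [homogeneousComponent, ← laurentMap_kernel]
  rfl

theorem kernel_add_single (w : Fin N → ℂ) (h : Fin N → ℕ) (i : Fin N) (α : StrongDual ℝ V) :
    kernel β w (h + Pi.single i 1) α = kernel β w h α * geomInv β i (w i) := by
  rw [kernel, kernel, mul_assoc]
  congr 1
  simp only [Pi.add_apply, pow_add, Finset.prod_mul_distrib]
  congr 1
  rw [Fintype.prod_eq_single i]
  · rw [Pi.single_eq_same, pow_one]
  · intro j hj
    rw [Pi.single_eq_of_ne hj, pow_zero]

/-- Multiplication by 1 - w_i e^{-β_i} cancels one factor, and its term e^{-β_i} merely translates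
α. -/
theorem kernel_recursion (w : Fin N → ℂ) (h : Fin N → ℕ) (i : Fin N) (α : StrongDual ℝ V) :
    kernel β w (h + Pi.single i 1) α -
        HahnSeries.C (algebraMap ℂ _ (w i)) * kernel β w (h + Pi.single i 1) (α - β i) =
      kernel β w h α := by
  have h1 : kernel β w (h + Pi.single i 1) (α - β i) =
      expLinear β (-β i) * kernel β w (h + Pi.single i 1) α := by
    rw [kernel, kernel, sub_eq_neg_add, expLinear_add, mul_assoc]
  have h2 : kernel β w (h + Pi.single i 1) α * geomDenom β i (w i) = kernel β w h α := by
    rw [kernel_add_single, mul_assoc, geomInv_mul_geomDenom, mul_one]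
  rw [h1, ← h2, geomDenom]
  ring

/-- For g = 1/(1 - w e^{-β}) one has -g w e^{-β} = 1 - g, so the logarithmic derivative is again
expressed through g. This is what turns derivatives into shifts of h. -/
theorem laurentDerivation_geomInv (v : Complexification V) (i : Fin N) (w : ℂ) :
    laurentDerivation (derivation β v) (geomInv β i w) =
      geomInv β i w * (single 1 (algebraMap ℂ _ (v (β i))) * (1 - geomInv β i w)) := by
  have h1 := congrArg (laurentDerivation (derivation β v)) (geomInv_mul_geomDenom (β := β) i w)
  have h2 : laurentDerivation (derivation β v) (geomDenom β i w) =
      (1 - geomDenom β i w) * single 1 (algebraMap ℂ _ (v (β i))) := by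
    have h3 : geomDenom β i w + HahnSeries.C (algebraMap ℂ _ w) * expLinear β (-β i) = 1 := by
      rw [geomDenom]
      ring
    have h4 : laurentDerivation (derivation β v)
        (HahnSeries.C (algebraMap ℂ (rationalFunctions β) w)) = 0 := by
      ext1
      funext k
      rw [laurentDerivation_coeff, HahnSeries.C_apply, coeff_single]
      split_ifs <;> simp
    have h5 := congrArg (laurentDerivation (derivation β v)) h3
    rw [laurentDerivation_add, laurentDerivation_mul, laurentDerivation_one, h4,
      laurentDerivation_expLinear, map_neg, map_neg, HahnSeries.single_neg] at h5
    linear_combination h5 + single 1 (algebraMap ℂ _ (v (β i))) * h3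
  rw [laurentDerivation_mul, laurentDerivation_one, h2] at h1
  have h0 := geomInv_mul_geomDenom (β := β) i w
  linear_combination geomInv β i w * h1 - laurentDerivation (derivation β v) (geomInv β i w) * h0 +
    geomInv β i w * single 1 (algebraMap ℂ _ (v (β i))) * h0

end Kernel

end PartitionResidue

end

noncomputable section

namespace PartitionResidue

open Module

/-! ### Functionals that vanish on the image of a derivation -/

section Derivation

variable {R : Type*} [CommRing R] [Algebra ℂ R]

theorem coeff_single_one_mul_algebraMap (c : ℂ) (x : LaurentSeries R) (k : ℤ) :
    (HahnSeries.single 1 (algebraMap ℂ R c) * x).coeff (k + 1) = c • x.coeff k := by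
  rw [HahnSeries.coeff_single_mul, add_sub_cancel_right, Algebra.smul_def]

theorem coeff_C_algebraMap_mul (c : ℂ) (x : LaurentSeries R) (k : ℤ) :
    (HahnSeries.C (algebraMap ℂ R c) * x).coeff k = c • x.coeff k := by
  rw [HahnSeries.C_apply, HahnSeries.coeff_single_mul, sub_zero, Algebra.smul_def]

theorem single_one_natCast_mul (m : ℕ) (c : ℂ) :
    HahnSeries.single (1 : ℤ) (algebraMap ℂ R ((m : ℂ) * c)) =
      (m : LaurentSeries R) * HahnSeries.single (1 : ℤ) (algebraMap ℂ R c) := by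
  have h : (m : LaurentSeries R) = HahnSeries.C (algebraMap ℂ R m) := by simp
  rw [h, HahnSeries.C_apply, HahnSeries.single_mul_single, zero_add, map_mul]

/-- The functions that are polynomials along the integral curves of `D`. -/
def polynomialAlong (D : Derivation ℂ R R) : Subring R :=
  Subring.closure {f | ∃ c : ℂ, D f = algebraMap ℂ R c}

/-- The constants of a derivation. -/
def derivationKernel (D : Derivation ℂ R R) : Subalgebra ℂ R where
  carrier := {f | D f = 0}
  mul_mem' {a b} ha hb := by
    have ha' : D a = 0 := ha
    have hb' : D b = 0 := hb
    simp [Derivation.leibniz, ha', hb']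
  add_mem' {a b} ha hb := by
    have ha' : D a = 0 := ha
    have hb' : D b = 0 := hb
    simp [ha', hb']
  algebraMap_mem' r := by simp

/-- With one element a of constant nonzero derivative, each generator differs from a multiple of a
by a constant of D. -/
theorem exists_aeval_of_mem_polynomialAlong {D : Derivation ℂ R R} {a : R} {c : ℂ} (hc : c ≠ 0)
    (ha : D a = algebraMap ℂ R c) {f : R} (hf : f ∈ polynomialAlong D) :
    ∃ q : Polynomial (derivationKernel D), f = Polynomial.aeval a q := by
  induction hf using Subring.closure_induction with
  | mem f hf =>
    obtain ⟨d, hf⟩ := hf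
    have hmem : f - (d / c) • a ∈ derivationKernel D := by
      change D _ = 0
      rw [map_sub, Derivation.map_smul, hf, ha, Algebra.smul_def, ← map_mul,
        div_mul_cancel₀ _ hc, sub_self]
    refine ⟨Polynomial.C ⟨_, hmem⟩ +
      Polynomial.C (algebraMap ℂ (derivationKernel D) (d / c)) * Polynomial.X, ?_⟩
    rw [map_add, map_mul, Polynomial.aeval_C, Polynomial.aeval_C, Polynomial.aeval_X]
    change _ = (f - (d / c) • a) + algebraMap ℂ _ (d / c) * a
    rw [Algebra.smul_def]
    ring
  | zero => exact ⟨0, by simp⟩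
  | one => exact ⟨1, by simp⟩
  | add x y _ _ hx hy =>
    obtain ⟨p, rfl⟩ := hx
    obtain ⟨q, rfl⟩ := hy
    exact ⟨p + q, by simp⟩
  | neg x _ hx =>
    obtain ⟨p, rfl⟩ := hx
    exact ⟨-p, by simp⟩
  | mul x y _ _ hx hy =>
    obtain ⟨p, rfl⟩ := hx
    obtain ⟨q, rfl⟩ := hy
    exact ⟨p * q, by simp⟩

/-- For a constant g of D, the element g a^k is D(g a^{k+1}) / ((k+1)c). Everything polynomial in a
over the constants is therefore a derivative. -/
theorem apply_eq_zero_of_mem_polynomialAlong {D : Derivation ℂ R R} {Ψ : R →ₗ[ℂ] ℂ}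
    (hΨ : ∀ f, Ψ (D f) = 0) {a : R} {c : ℂ} (hc : c ≠ 0)
    (ha : D a = algebraMap ℂ R c) {f : R} (hf : f ∈ polynomialAlong D) : Ψ f = 0 := by
  obtain ⟨q, rfl⟩ := exists_aeval_of_mem_polynomialAlong hc ha hf
  clear hf
  induction q using Polynomial.induction_on' with
  | add p q hp hq => rw [map_add, map_add, hp, hq, add_zero]
  | monomial k g =>
    rw [Polynomial.aeval_monomial]
    have hg : D (algebraMap (derivationKernel D) R g) = 0 := g.2
    have h1 : D (a ^ (k + 1) * algebraMap (derivationKernel D) R g) =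
        (((k + 1 : ℕ) : ℂ) * c) • (algebraMap (derivationKernel D) R g * a ^ k) := by
      rw [Derivation.leibniz, hg, smul_zero, zero_add, Derivation.leibniz_pow, ha]
      simp only [add_tsub_cancel_right, smul_eq_mul, nsmul_eq_mul, Algebra.smul_def (R := ℂ),
        map_mul, map_natCast]
      ring
    have h2 := hΨ (a ^ (k + 1) * algebraMap (derivationKernel D) R g)
    rw [h1, map_smul, smul_eq_mul] at h2
    exact (mul_eq_zero.1 h2).resolve_left (mul_ne_zero (by exact_mod_cast k.succ_ne_zero) hc)

omit [Algebra ℂ R] in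
theorem prod_single {ι : Type*} [DecidableEq ι] (s : Finset ι) (f : ι → R) :
    ∏ j ∈ s, HahnSeries.single (-1 : ℤ) (f j) =
      HahnSeries.single (-(s.card : ℤ)) (∏ j ∈ s, f j) := by
  induction s using Finset.induction_on with
  | empty => simp
  | insert a s ha ih =>
    rw [Finset.prod_insert ha, ih, HahnSeries.single_mul_single, Finset.prod_insert ha,
      Finset.card_insert_of_notMem ha]
    congr 2
    push_cast
    ring

end Derivation

/-! ### Functionals that vanish on derivatives, applied to the kernel -/

section Residue

open HahnSeries (single ofPowerSeries coeff_mul coeff_single coeff_mul_single single_mul_single)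

variable {V : Type*} [NormedAddCommGroup V] [NormedSpace ℝ V] {n N : ℕ}
variable {β : Fin N → StrongDual ℝ V}

/-- Logarithmic differentiation: the factor with index i contributes h_i v(β_i)(1 - g_i), and
multiplication by g_i raises h_i by one. -/
theorem laurentDerivation_kernel (v : Complexification V) (w : Fin N → ℂ) (h : Fin N → ℕ)
    (α : StrongDual ℝ V) :
    laurentDerivation (derivation β v) (kernel β w h α) =
      single 1 (algebraMap ℂ _ (v α)) * kernel β w h α +
        ∑ i, single 1 (algebraMap ℂ _ ((h i : ℂ) * v (β i))) *
          (kernel β w h α - kernel β w (h + Pi.single i 1) α) := by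
  rw [kernel, laurentDerivation_mul, laurentDerivation_expLinear,
    laurentDerivation_prod _ _ fun i =>
      laurentDerivation_pow _ (laurentDerivation_geomInv v i (w i)) (h i), ← kernel]
  have h1 : ∀ i, single (1 : ℤ) (algebraMap ℂ (rationalFunctions β) ((h i : ℂ) * v (β i))) *
      (kernel β w h α - kernel β w (h + Pi.single i 1) α) =
      kernel β w h α * ((h i : LaurentSeries (rationalFunctions β)) * (single 1 (algebraMap ℂ _ (v (β i))) * (1 - geomInv β i (w i)))) := by
    intro i
    rw [single_one_natCast_mul, kernel_add_single]
    ring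
  rw [Finset.sum_congr rfl fun i _ => h1 i, ← Finset.mul_sum, kernel]
  ring

variable {Ψ : rationalFunctions β →ₗ[ℂ] ℂ} (hΨ : ∀ v f, Ψ (derivation β v f) = 0)

include hΨ in
-- Ψ kills the derivative of the kernel; the identity is read off from the coefficient of t^{k+1}.
theorem residue_euler (v : Complexification V) (w : Fin N → ℂ) (h : Fin N → ℕ)
    (α : StrongDual ℝ V) (k : ℤ) :
    v α * Ψ ((kernel β w h α).coeff k) = ∑ i, (h i : ℂ) * v (β i) *
      (Ψ ((kernel β w (h + Pi.single i 1) α).coeff k) - Ψ ((kernel β w h α).coeff k)) := by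
  have h1 := congrArg (fun x : LaurentSeries (rationalFunctions β) => Ψ (x.coeff (k + 1)))
    (laurentDerivation_kernel v w h α)
  simp only [laurentDerivation_coeff, hΨ, HahnSeries.coeff_add, HahnSeries.coeff_sum,
    coeff_single_one_mul_algebraMap, map_add, map_sum, map_smul, HahnSeries.coeff_sub, map_sub,
    smul_eq_mul] at h1
  have h2 : ∀ i, (h i : ℂ) * v (β i) *
      (Ψ ((kernel β w (h + Pi.single i 1) α).coeff k) - Ψ ((kernel β w h α).coeff k)) =
      -((h i : ℂ) * v (β i) * (Ψ ((kernel β w h α).coeff k) -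
        Ψ ((kernel β w (h + Pi.single i 1) α).coeff k))) := fun i => by ring
  rw [Finset.sum_congr rfl fun i _ => h2 i, Finset.sum_neg_distrib]
  linear_combination -h1

theorem residue_recursion (w : Fin N → ℂ) (h : Fin N → ℕ) (i : Fin N)
    (α : StrongDual ℝ V) (k : ℤ) :
    Ψ ((kernel β w (h + Pi.single i 1) α).coeff k) -
        w i * Ψ ((kernel β w (h + Pi.single i 1) (α - β i)).coeff k) =
      Ψ ((kernel β w h α).coeff k) := by
  rw [← kernel_recursion w h i α, HahnSeries.coeff_sub, coeff_C_algebraMap_mul,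
    map_sub, map_smul, smul_eq_mul]

include hΨ in
/-- The residue vanishes if the polar hyperplanes are not in general position. -/
theorem residue_eq_zero {v : Complexification V} (hv : v ≠ 0) (w : Fin N → ℂ) (h : Fin N → ℕ)
    (hvh : ∀ i, h i ≠ 0 → w i = 1 → v (β i) = 0) (α : StrongDual ℝ V) (k : ℤ) :
    Ψ ((kernel β w h α).coeff k) = 0 := by
  obtain ⟨α₀, hα₀⟩ : ∃ α, v α ≠ 0 := by
    by_contra! h
    exact hv (ContinuousLinearMap.ext h)
  refine apply_eq_zero_of_mem_polynomialAlong (hΨ v) hα₀ (derivation_linearFn v α₀) ?_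
  -- All coefficients will be polynomial along v. The only denominators come from factors with h_i ≠
  -- 0 and w_i = 1, and for these β_i is constant along v.
  suffices kernel β w h α ∈ laurentSubring (polynomialAlong (derivation β v)) from this k
  have halg : ∀ a : ℂ, algebraMap ℂ _ a ∈ polynomialAlong (derivation β v) := fun a =>
    Subring.subset_closure ⟨0, by simp⟩
  have hlin : ∀ α, linearFn β α ∈ polynomialAlong (derivation β v) := fun α =>
    Subring.subset_closure ⟨_, derivation_linearFn v α⟩
  have hcomp : ∀ α a, compLinear β α a ∈ laurentSubring (polynomialAlong (derivation β v)) := by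
    intro α a k
    rcases lt_or_ge k 0 with hk | hk
    · rw [compLinear_coeff_of_neg _ _ hk]
      exact zero_mem _
    · lift k to ℕ using hk
      rw [compLinear_coeff, Algebra.smul_def]
      exact mul_mem (halg _) (pow_mem (hlin α) k)
  refine mul_mem (hcomp _ _) (prod_mem fun i _ => ?_)
  by_cases hi : h i = 0
  · rw [hi, pow_zero]
    exact one_mem _
  refine pow_mem ?_ _
  rw [geomInv]
  split_ifs with hw
  · refine mul_mem (fun k => ?_) (hcomp _ _)
    rw [coeff_single]
    split_ifs
    · refine Subring.subset_closure ⟨0, ?_⟩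
      simp [derivation_powFn, hvh i hi hw]
    · exact zero_mem _
  · exact hcomp _ _

theorem kernel_sum_single (w : Fin N → ℂ) {κ : Type*} [DecidableEq κ] (s : Finset κ)
    (σ : κ → Fin N) (α : StrongDual ℝ V) :
    kernel β w (∑ j ∈ s, Pi.single (σ j) 1) α =
      expLinear β α * ∏ j ∈ s, geomInv β (σ j) (w (σ j)) := by
  induction s using Finset.induction_on with
  | empty => simp [kernel]
  | insert a s ha ih =>
    rw [Finset.sum_insert ha, Finset.prod_insert ha, add_comm, kernel_add_single, ih]
    ring

/-- The leading coefficient of the kernel of a basis all of whose hyperplanes are polar. -/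
theorem kernel_basis_coeff (w : Fin N → ℂ) (σ : Fin n → Fin N) (hw : ∀ j, w (σ j) = 1)
    (α : StrongDual ℝ V) :
    (kernel β w (∑ j, Pi.single (σ j) 1) α).coeff (-n) = mono β σ (-1) := by
  have hone : ∀ α (a : PowerSeries ℂ), PowerSeries.constantCoeff a = 1 →
      ∃ Q : PowerSeries (rationalFunctions β), PowerSeries.constantCoeff Q = 1 ∧
        compLinear β α a = ofPowerSeries ℤ _ Q := by
    intro α a ha
    refine ⟨_, ?_, rfl⟩
    rw [← PowerSeries.coeff_zero_eq_constantCoeff_apply, RingHom.comp_apply,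
      PowerSeries.coeff_rescale, PowerSeries.coeff_map, PowerSeries.coeff_zero_eq_constantCoeff_apply,
      ha]
    simp
  obtain ⟨Q₀, hQ₀, e₀⟩ := hone α (PowerSeries.exp ℂ) (by simp)
  have hinv : PowerSeries.constantCoeff toddDenom⁻¹ = 1 := by
    rw [PowerSeries.constantCoeff_inv, constantCoeff_toddDenom, inv_one]
  choose Q hQ e using fun j => hone (β (σ j)) toddDenom⁻¹ hinv
  rw [kernel_sum_single]
  -- Each polar factor is t^{-1} β^{-1} times a series with constant term 1, so the lowest
  -- coefficient is the simple fraction and does not involve α.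
  have : expLinear β α * ∏ j, geomInv β (σ j) (w (σ j)) =
      single (-(n : ℤ)) (mono β σ (-1)) * ofPowerSeries ℤ _ (Q₀ * ∏ j, Q j) := by
    simp only [geomInv, hw, if_true, e]
    rw [Finset.prod_mul_distrib, prod_single, expLinear, e₀, Finset.card_univ, Fintype.card_fin,
      map_mul, map_prod (ofPowerSeries ℤ (rationalFunctions β)) Q]
    simp only [mono, Pi.neg_apply, Pi.one_apply]
    ring
  rw [this, HahnSeries.coeff_single_mul, sub_self]
  have h0 : (ofPowerSeries ℤ _ (Q₀ * ∏ j, Q j)).coeff 0 = 1 := by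
    have := HahnSeries.ofPowerSeries_apply_coeff (Γ := ℤ) (Q₀ * ∏ j, Q j) 0
    rw [Nat.cast_zero] at this
    rw [this, PowerSeries.coeff_zero_eq_constantCoeff_apply, map_mul, map_prod, hQ₀]
    simp [hQ]
  rw [h0, mul_one]

end Residue

/-! ### The residue as an exponential polynomial -/

section ExpPoly

variable {V : Type*} [NormedAddCommGroup V] [NormedSpace ℝ V] {n N : ℕ}
variable {β : Fin N → StrongDual ℝ V}

theorem additive_mem_expPoly {W : Type*} [AddCommGroup W] (φ : W →+ ℂ) :
    (fun w => φ w) ∈ expPoly W :=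
  Algebra.subset_adjoin (Or.inl ⟨φ, rfl⟩)

theorem addChar_mem_expPoly {W : Type*} [AddCommGroup W] (χ : AddChar W ℂ) :
    (fun w => χ w) ∈ expPoly W :=
  Algebra.subset_adjoin (Or.inr ⟨χ, rfl⟩)

theorem exp_mem_expPoly {W : Type*} [AddCommGroup W] (φ : W →+ ℂ) :
    (fun w => Complex.exp (φ w)) ∈ expPoly W :=
  addChar_mem_expPoly
    { toFun := fun w => Complex.exp (φ w)
      map_zero_eq_one' := by simp
      map_add_eq_mul' := fun a b => by rw [map_add, Complex.exp_add] }

/-- The exponent of the first nonzero coefficient of a Laurent series is bounded below. -/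
theorem exists_coeff_eq_zero {R : Type*} [CommRing R] (x : LaurentSeries R) :
    ∃ m : ℤ, ∀ k < m, x.coeff k = 0 := by
  by_cases hx : x = 0
  · exact ⟨0, fun k _ => by simp [hx]⟩
  · exact ⟨x.order, fun k hk => HahnSeries.coeff_eq_zero_of_lt_order hk⟩

/-- Only e^α depends on α, and the remaining factor has finite pole order, so a fixed coefficient is
a polynomial in α of bounded degree. -/
theorem kernel_coeff_eq (w : Fin N → ℂ) (h : Fin N → ℕ) (k : ℤ) :
    ∃ (M : ℕ) (g : ℕ → rationalFunctions β), ∀ α,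
      (kernel β w h α).coeff k = ∑ j ∈ Finset.range M, linearFn β α ^ j * g j := by
  obtain ⟨m, hm⟩ := exists_coeff_eq_zero (∏ i, geomInv β i (w i) ^ h i)
  set G := ∏ i, geomInv β i (w i) ^ h i with hG
  refine ⟨(k - m + 1).toNat, fun j => PowerSeries.coeff j (PowerSeries.exp ℂ) • G.coeff (k - j),
    fun α => ?_⟩
  have hs : ({j : ℤ | 0 ≤ j} : Set ℤ).IsPWO := by
    exact (BddBelow.isWF ⟨0, fun x hx => hx⟩).isPWO
  have hsup : (expLinear β α).support ⊆ {j : ℤ | 0 ≤ j} := by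
    intro j hj
    by_contra hneg
    exact hj (compLinear_coeff_of_neg _ _ (not_le.1 hneg))
  rw [kernel, ← hG, HahnSeries.coeff_mul_left' hs hsup]
  refine Finset.sum_of_injOn (fun ij : ℤ × ℤ => ij.1.toNat) ?_ ?_ ?_ ?_
  · rintro ⟨i, j⟩ hij ⟨i', j'⟩ hij' h
    simp only [Finset.mem_coe, Finset.mem_antidiagonal, Set.mem_ofPred_eq] at hij hij' h
    ext <;> simp <;> omega
  · rintro ⟨i, j⟩ hij
    simp only [Finset.mem_coe, Finset.mem_antidiagonal, Set.mem_ofPred_eq] at hij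
    have : m ≤ j := by
      by_contra hj
      exact hij.2.1 (hm j (not_le.1 hj))
    simp
    omega
  · intro j hj hj'
    have : G.coeff (k - j) = 0 := by
      by_contra hne
      refine hj' ⟨((j : ℤ), k - j), ?_, by simp⟩
      simp [hne]
    simp only [this, smul_zero, mul_zero]
  · rintro ⟨i, j⟩ hij
    simp only [Finset.mem_antidiagonal, Set.mem_ofPred_eq] at hij
    obtain ⟨hi, hj, rfl⟩ := hij
    lift i to ℕ using hi
    simp only [Int.toNat_natCast, add_sub_cancel_left]
    rw [expLinear, compLinear_coeff, smul_mul_assoc, mul_smul_comm]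

/-- Pairing of the powers of a varying linear form with a fixed rational function. -/
theorem apply_linearFn_pow_mem (b : Basis (Fin n) ℝ V) [FiniteDimensional ℝ V]
    (Ψ : rationalFunctions β →ₗ[ℂ] ℂ) (j : ℕ) : ∀ g : rationalFunctions β,
    (fun a : dualLattice b => Ψ (linearFn β (a : StrongDual ℝ V) ^ j * g)) ∈
      expPoly (dualLattice b) := by
  have hdec : ∀ α : StrongDual ℝ V, linearFn β α = ∑ i, (α (b i) : ℂ) •
      linearFn β (LinearMap.toContinuousLinearMap (b.coord i)) := by
    intro α
    rw [← linearFn_sum]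
    congr 1
    ext x
    conv_lhs => rw [← b.sum_repr x, map_sum]
    simp [mul_comm]
  induction j with
  | zero =>
    intro g
    simp only [pow_zero, one_mul]
    exact (expPoly (dualLattice b)).algebraMap_mem (Ψ g)
  | succ j ih =>
    intro g
    have : (fun a : dualLattice b => Ψ (linearFn β (a : StrongDual ℝ V) ^ (j + 1) * g)) =
        ∑ i, (fun a : dualLattice b => (((a : StrongDual ℝ V) (b i) : ℝ) : ℂ)) *
          fun a : dualLattice b => Ψ (linearFn β (a : StrongDual ℝ V) ^ j *
            (linearFn β (LinearMap.toContinuousLinearMap (b.coord i)) * g)) := by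
      funext a
      simp only [Finset.sum_apply, Pi.mul_apply]
      conv_lhs => rw [pow_succ, mul_assoc, hdec (a : StrongDual ℝ V)]
      rw [Finset.sum_mul, Finset.mul_sum, map_sum]
      refine Finset.sum_congr rfl fun i _ => ?_
      rw [smul_mul_assoc, mul_smul_comm, map_smul, smul_eq_mul, ← hdec]
    rw [this]
    refine sum_mem fun i _ => mul_mem ?_ (ih _)
    exact additive_mem_expPoly
      { toFun := fun a : dualLattice b => (((a : StrongDual ℝ V) (b i) : ℝ) : ℂ)
        map_zero' := by simp
        map_add' := fun a a' => by simp }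

theorem residue_mem_expPoly (b : Basis (Fin n) ℝ V) [FiniteDimensional ℝ V]
    (Ψ : rationalFunctions β →ₗ[ℂ] ℂ) (w : Fin N → ℂ) (h : Fin N → ℕ) (k : ℤ) :
    (fun a : dualLattice b => Ψ ((kernel β w h (a : StrongDual ℝ V)).coeff k)) ∈
      expPoly (dualLattice b) := by
  obtain ⟨M, g, hg⟩ := kernel_coeff_eq (β := β) w h k
  have : (fun a : dualLattice b => Ψ ((kernel β w h (a : StrongDual ℝ V)).coeff k)) =
      ∑ j ∈ Finset.range M, fun a : dualLattice b =>
        Ψ (linearFn β (a : StrongDual ℝ V) ^ j * g j) := by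
    funext a
    rw [hg, map_sum, Finset.sum_apply]
  rw [this]
  exact sum_mem fun j _ => apply_linearFn_pow_mem b Ψ j (g j)

end ExpPoly

end PartitionResidue

end

noncomputable section

namespace PartitionResidue

open Module

/-! ### Twisted translation operators -/

section Shift

variable {L ι : Type*} [AddCommGroup L] [Fintype ι] (g : ι → L) (u : ι → ℂ)

/-- The operator `F ↦ u^m F(· - ∑ m_i g_i)`. -/
def shift (m : ι → ℤ) : (L → ℂ) →ₗ[ℂ] (L → ℂ) where
  toFun F := fun a => (∏ i, u i ^ m i) * F (a - ∑ i, m i • g i)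
  map_add' F G := funext fun a => by simp [mul_add]
  map_smul' c F := funext fun a => by simp; ring

theorem shift_apply (m : ι → ℤ) (F : L → ℂ) (a : L) :
    shift g u m F a = (∏ i, u i ^ m i) * F (a - ∑ i, m i • g i) := rfl

theorem shift_zero (F : L → ℂ) : shift g u 0 F = F := by
  funext a
  simp [shift_apply]

theorem shift_single [DecidableEq ι] (i : ι) (F : L → ℂ) (a : L) :
    shift g u (Pi.single i 1) F a = u i * F (a - g i) := by
  rw [shift_apply, Fintype.prod_eq_single i, Fintype.sum_eq_single i]
  · simp
  · intro j hj
    simp [hj]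
  · intro j hj
    simp [hj]

variable {u} (hu : ∀ i, u i ≠ 0)

include hu in
theorem shift_add (m m' : ι → ℤ) (F : L → ℂ) :
    shift g u (m + m') F = shift g u m (shift g u m' F) := by
  funext a
  simp only [shift_apply, Pi.add_apply, zpow_add₀ (hu _), Finset.prod_mul_distrib, add_smul,
    Finset.sum_add_distrib, mul_assoc, sub_add_eq_sub_sub]

theorem shift_comm (m m' : ι → ℤ) (F : L → ℂ) :
    shift g u m (shift g u m' F) = shift g u m' (shift g u m F) := by
  funext a
  simp only [shift_apply]
  rw [sub_right_comm]
  ring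

theorem eq_sum_smul_single [DecidableEq ι] (m : ι → ℤ) : m = ∑ i, m i • Pi.single i (1 : ℤ) := by
  conv_lhs => rw [← Finset.univ_sum_single m]
  refine Finset.sum_congr rfl fun i _ => ?_
  rw [← Pi.single_smul, smul_eq_mul, mul_one]

variable {g} {Z : Submodule ℂ (L → ℂ)} (hZ : ∀ m, ∀ F ∈ Z, shift g u m F ∈ Z)

include hu hZ in
-- The exponents m whose operator fixes F modulo Z form a subgroup.
theorem sub_shift_mem [DecidableEq ι] {F : L → ℂ}
    (hF : ∀ i, F - shift g u (Pi.single i 1) F ∈ Z) (m : ι → ℤ) : F - shift g u m F ∈ Z := by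
  let A : AddSubgroup (ι → ℤ) :=
    { carrier := {m | F - shift g u m F ∈ Z}
      zero_mem' := by simp [shift_zero]
      add_mem' := fun {m m'} hm hm' => by
        have := add_mem hm (hZ m _ hm')
        simpa [map_sub, ← shift_add g hu] using this
      neg_mem' := fun {m} hm => by
        have := neg_mem (hZ (-m) _ hm)
        simpa [map_sub, ← shift_add g hu, shift_zero] using this }
  have h : m ∈ A := by
    rw [eq_sum_smul_single m]
    exact sum_mem fun i _ => zsmul_mem (show Pi.single i 1 ∈ A from hF i) _
  exact h

include hu hZ in
-- A relation among the g_i makes the operator with exponent r a scalar; a scalar different from 1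
-- that fixes F modulo Z forces F ∈ Z.
theorem mem_of_relation [DecidableEq ι] {F : L → ℂ}
    (hF : ∀ i, F - shift g u (Pi.single i 1) F ∈ Z) {r : ι → ℤ} (hr : ∑ i, r i • g i = 0)
    (hur : ∏ i, u i ^ r i ≠ 1) : F ∈ Z := by
  have h := sub_shift_mem hu hZ hF r
  have h2 : F - shift g u r F = (1 - ∏ i, u i ^ r i) • F := by
    funext a
    simp [shift_apply, hr]
    ring
  rw [h2] at h
  exact (Z.smul_mem_iff (sub_ne_zero.2 hur.symm)).1 h

include hu hZ in
-- When the products (1 - T_j)(1 - T_k) kill G modulo Z, the map m ↦ (1 - T^m)G is additive modulo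
-- Z. It is evaluated on a relation r for which T^r is the identity.
theorem sum_smul_sub_shift_mem [DecidableEq ι] {G : L → ℂ}
    (hG : ∀ j k, G - shift g u (Pi.single j 1) G -
      shift g u (Pi.single k 1) (G - shift g u (Pi.single j 1) G) ∈ Z)
    {r : ι → ℤ} (hr : ∑ i, r i • g i = 0) (hur : ∏ i, u i ^ r i = 1) :
    ∑ i, (r i : ℂ) • (G - shift g u (Pi.single i 1) G) ∈ Z := by
  have h1 : ∀ j m, G - shift g u m G -
      shift g u (Pi.single j 1) (G - shift g u m G) ∈ Z := by
    intro j m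
    have := sub_shift_mem hu hZ (hG j) m
    rw [map_sub, shift_comm g m] at this
    rw [map_sub]
    convert this using 1
    abel
  have h2 : ∀ m m', G - shift g u m G - shift g u m' (G - shift g u m G) ∈ Z := fun m m' =>
    sub_shift_mem hu hZ (fun j => h1 j m) m'
  let ψ : (ι → ℤ) →+ (L → ℂ) ⧸ Z :=
    { toFun := fun m => Z.mkQ (G - shift g u m G)
      map_zero' := by simp [shift_zero]
      map_add' := fun m m' => by
        rw [← map_add, ← sub_eq_zero, ← map_sub, Submodule.mkQ_apply,
          Submodule.Quotient.mk_eq_zero]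
        have := neg_mem (h2 m m')
        rw [map_sub, ← shift_add g hu, add_comm m' m] at this
        convert this using 1
        abel }
  have h3 : ψ r = ∑ i, r i • ψ (Pi.single i 1) := by
    conv_lhs => rw [eq_sum_smul_single r, map_sum]
    exact Finset.sum_congr rfl fun i _ => map_zsmul _ _ _
  have h4 : ψ r = 0 := by
    have : G - shift g u r G = 0 := by
      funext a
      simp [shift_apply, hr, hur]
    change Z.mkQ (G - shift g u r G) = 0
    rw [this, map_zero]
  rw [← Submodule.Quotient.mk_eq_zero, ← Submodule.mkQ_apply, map_sum, ← h4, h3]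
  refine Finset.sum_congr rfl fun i _ => ?_
  rw [map_smul, Int.cast_smul_eq_zsmul]
  rfl

end Shift

end PartitionResidue

end

noncomputable section

namespace PartitionResidue

open Module Filter

/-! ### Integrality of coordinates of lattice points in a basis. -/

section Integrality

variable {V : Type*} [NormedAddCommGroup V] [NormedSpace ℝ V] {n N : ℕ}

/-- The matrix of the coordinates of elements of the dual lattice. -/
theorem exists_intMatrix (b : Basis (Fin n) ℝ V) {κ : Type*} {u : κ → StrongDual ℝ V}
    (hu : ∀ i, u i ∈ dualLattice b) :
    ∃ B : Matrix κ (Fin n) ℤ, ∀ i j, u i (b j) = B i j := by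
  choose B hB using fun i j => hu i (b j) (Submodule.subset_span ⟨j, rfl⟩)
  exact ⟨Matrix.of B, hB⟩

/-- Cramer's rule: the determinant is a common denominator because the adjugate of an integral
matrix is integral. -/
theorem exists_int_mul_repr (b : Basis (Fin n) ℝ V) [FiniteDimensional ℝ V]
    (hn : finrank ℝ (StrongDual ℝ V) = n) {u : Fin n → StrongDual ℝ V}
    (hu : LinearIndependent ℝ u) (huL : ∀ i, u i ∈ dualLattice b) :
    ∃ d : ℤ, d ≠ 0 ∧ ∀ a ∈ dualLattice b, ∀ j, ∃ k : ℤ, (d : ℝ) * (basisOf hn u hu).repr a j = k := by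
  obtain ⟨B, hB⟩ := exists_intMatrix b huL
  have hBu : B.map (Int.cast : ℤ → ℝ) = Matrix.of fun i j => u i (b j) := by
    ext i j
    simp [hB]
  have hdet : ((B.det : ℤ) : ℝ) = (Matrix.of fun i j => u i (b j)).det := by
    rw [← hBu]
    exact (Int.castRingHom ℝ).map_det B
  refine ⟨B.det, fun h0 => ?_, fun a ha j => ?_⟩
  · refine coordMatrix_det_ne_zero b u hu ?_
    rw [h0] at hdet
    simpa [coordMatrix] using hdet.symm
  · obtain ⟨A, hA⟩ := exists_intMatrix b (κ := Unit) (u := fun _ => a) fun _ => ha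
    refine ⟨(Matrix.vecMul (A ()) B.adjugate) j, ?_⟩
    set ρ : Fin n → ℝ := fun j => (basisOf hn u hu).repr a j with hρ
    have h1 : Matrix.vecMul ρ (B.map (Int.cast : ℤ → ℝ)) = fun j => (A () j : ℝ) := by
      funext m
      have h2 : a (b m) = ∑ j, ρ j * u j (b m) := by
        conv_lhs => rw [← (basisOf hn u hu).sum_repr a]
        simp [hρ]
      simp only [Matrix.vecMul, dotProduct, Matrix.map_apply]
      rw [← hA () m, h2]
      exact Finset.sum_congr rfl fun j _ => by rw [hB]
    have h3 := congrArg (fun x => Matrix.vecMul x (B.map (Int.cast : ℤ → ℝ)).adjugate) h1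
    simp only [Matrix.vecMul_vecMul, Matrix.mul_adjugate, Matrix.vecMul_smul, Matrix.vecMul_one] at h3
    have h4 := congrFun h3 j
    simp only [Pi.smul_apply, smul_eq_mul] at h4
    rw [hdet, ← hBu, h4]
    have h5 : (B.map (Int.cast : ℤ → ℝ)).adjugate = B.adjugate.map (Int.cast : ℤ → ℝ) :=
      ((Int.castRingHom ℝ).map_adjugate B).symm
    rw [h5]
    simp [Matrix.vecMul, dotProduct]

end Integrality

/-! ### Solutions of the difference and Euler equations -/

section Core

variable {V : Type*} [NormedAddCommGroup V] [NormedSpace ℝ V] {n N : ℕ}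

/-- The equations satisfied by weighted partition functions, as functions of the list of
multiplicities and of a point of a group `L` of linear forms. -/
structure IsPartitionFamily {L : AddSubgroup (StrongDual ℝ V)} (g : Fin N → L) (u : Fin N → ℂ)
    (D : (Fin N → ℕ) → L → ℂ) : Prop where
  recursion : ∀ h i a, D (h + Pi.single i 1) a - u i * D (h + Pi.single i 1) (a - g i) = D h a
  euler : ∀ h (v : Complexification V) (a : L), v (a : StrongDual ℝ V) * D h a =
    ∑ i, (h i : ℂ) * v (g i : StrongDual ℝ V) * (D (h + Pi.single i 1) a - D h a)

theorem IsPartitionFamily.sub {L : AddSubgroup (StrongDual ℝ V)} {g : Fin N → L} {u : Fin N → ℂ}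
    {D E : (Fin N → ℕ) → L → ℂ} (hD : IsPartitionFamily g u D) (hE : IsPartitionFamily g u E) :
    IsPartitionFamily g u (fun h a => D h a - E h a) where
  recursion h i a := by
    rw [← hD.recursion h i a, ← hE.recursion h i a]
    ring
  euler h v a := by
    rw [mul_sub, hD.euler, hE.euler, ← Finset.sum_sub_distrib]
    exact Finset.sum_congr rfl fun i _ => by ring

variable {β : Fin N → StrongDual ℝ V} {b : Basis (Fin n) ℝ V}
  {hβ : ∀ i, β i ∈ dualLattice b} {u : Fin N → ℂ} {D : (Fin N → ℕ) → dualLattice b → ℂ}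

theorem IsPartitionFamily.pred (hD : IsPartitionFamily (fun i => ⟨β i, hβ i⟩) u D)
    {h : Fin N → ℕ} {i : Fin N} (hi : h i ≠ 0) (a : dualLattice b) :
    D h a - u i * D h (a - ⟨β i, hβ i⟩) = D (h - Pi.single i 1) a := by
  have e : h = (h - Pi.single i 1) + Pi.single i 1 := by
    funext j
    by_cases hj : j = i
    · subst hj
      simp
      omega
    · simp [hj]
  conv_lhs => rw [e]
  exact hD.recursion _ i a

theorem sum_sub_single {h : Fin N → ℕ} {i : Fin N} (hi : h i ≠ 0) :
    ∑ j, (h - Pi.single i 1 : Fin N → ℕ) j + 1 = ∑ j, h j := by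
  rw [← Finset.add_sum_erase _ _ (Finset.mem_univ i), ← Finset.add_sum_erase _ h (Finset.mem_univ i)]
  have : ∑ j ∈ Finset.univ.erase i, (h - Pi.single i 1 : Fin N → ℕ) j = ∑ j ∈ Finset.univ.erase i, h j :=
    Finset.sum_congr rfl fun j hj => by simp [(Finset.mem_erase.1 hj).1]
  rw [this]
  simp
  omega

theorem sum_add_single (h : Fin N → ℕ) (i : Fin N) :
    ∑ j, (h + Pi.single i 1 : Fin N → ℕ) j = ∑ j, h j + 1 := by
  simp [Finset.sum_add_distrib]

/-- The order in which the multiplicities are treated. -/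
def multLT (h' h : Fin N → ℕ) : Prop :=
  ∑ i, h' i < ∑ i, h i ∨ (∑ i, h' i = ∑ i, h i ∧
    (Finset.univ.filter fun i => h' i ≠ 0).card < (Finset.univ.filter fun i => h i ≠ 0).card)

theorem wellFounded_multLT : WellFounded (multLT (N := N)) := by
  refine Subrelation.wf (r := InvImage (Prod.Lex (· < ·) (· < ·)) fun h : Fin N → ℕ =>
    (∑ i, h i, (Finset.univ.filter fun i => h i ≠ 0).card)) ?_ (InvImage.wf _
      (Prod.lex ⟨_, Nat.lt_wfRel.wf⟩ ⟨_, Nat.lt_wfRel.wf⟩).wf)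
  rintro h' h (hlt | ⟨heq, hlt⟩)
  · exact Prod.Lex.left _ _ hlt
  · change Prod.Lex _ _ (_, _) (_, _)
    rw [heq]
    exact Prod.Lex.right _ hlt

variable [FiniteDimensional ℝ V] (hn : finrank ℝ (StrongDual ℝ V) = n)

include hn in
-- The core of the uniqueness argument. Modulo eventually vanishing functions, summing the Euler
-- equations over a dual basis yields n D_h = (∑ h_i) D_h.
theorem IsPartitionFamily.eventually_eq_zero
    (hD : IsPartitionFamily (fun i => ⟨β i, hβ i⟩) u D) (hu : ∀ i, u i ≠ 0)
    {l : Filter (dualLattice b)} (hl : ∀ c, Tendsto (fun a => a - c) l l)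
    {h : Fin N → ℕ} {σ : Fin n → Fin N} (hσ : LinearIndependent ℝ (β ∘ σ))
    (hσh : ∀ j, h (σ j) ≠ 0) (hcard : ∑ i, h i ≠ n)
    (ih : ∀ h', multLT h' h → ∀ᶠ a in l, D h' a = 0) : ∀ᶠ a in l, D h a = 0 := by
  set g : Fin N → dualLattice b := fun i => ⟨β i, hβ i⟩ with hg
  let ι := {i // h i ≠ 0}
  let gι : ι → dualLattice b := fun i => g i
  let uι : ι → ℂ := fun i => u i
  have huι : ∀ i, uι i ≠ 0 := fun i => hu i
  let Z : Submodule ℂ (dualLattice b → ℂ) :=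
    { carrier := {F | ∀ᶠ a in l, F a = 0}
      zero_mem' := Eventually.of_forall fun _ => rfl
      add_mem' := fun {F G} hF hG => by
        filter_upwards [hF, hG] with a h1 h2
        simp [h1, h2]
      smul_mem' := fun c F hF => by
        filter_upwards [hF] with a h1
        simp [h1] }
  have memZ : ∀ F, F ∈ Z ↔ ∀ᶠ a in l, F a = 0 := fun F => Iff.rfl
  have hZ : ∀ m, ∀ F ∈ Z, shift gι uι m F ∈ Z := by
    intro m F hF
    rw [memZ] at hF ⊢
    filter_upwards [(hl (∑ i, m i • gι i)).eventually hF] with a ha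
    rw [shift_apply, ha, mul_zero]
  have hX : ∀ (h' : Fin N → ℕ) (j : ι), h' j ≠ 0 →
      D h' - shift gι uι (Pi.single j 1) (D h') = D (h' - Pi.single (j : Fin N) 1) := by
    intro h' j hj
    funext a
    rw [Pi.sub_apply, shift_single]
    exact hD.pred hj a
  have hXD : ∀ j : ι, D h - shift gι uι (Pi.single j 1) (D h) ∈ Z := by
    intro j
    rw [hX h j j.2]
    refine ih _ (Or.inl ?_)
    have := sum_sub_single j.2
    omega
  -- If the twists violate some relation among the support vectors, invariance alone forces
  -- vanishing. Otherwise every relation acts as the identity.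
  by_cases hrel : ∃ r : ι → ℤ, ∑ i, r i • gι i = 0 ∧ ∏ i, uι i ^ r i ≠ 1
  · obtain ⟨r, hr, hur⟩ := hrel
    exact mem_of_relation huι hZ hXD hr hur
  push Not at hrel
  have hXX : ∀ i j k : ι, D (h + Pi.single (i : Fin N) 1) -
        shift gι uι (Pi.single j 1) (D (h + Pi.single (i : Fin N) 1)) -
      shift gι uι (Pi.single k 1) (D (h + Pi.single (i : Fin N) 1) -
        shift gι uι (Pi.single j 1) (D (h + Pi.single (i : Fin N) 1))) ∈ Z := by
    intro i j k
    have hj : (h + Pi.single (i : Fin N) 1 : Fin N → ℕ) j ≠ 0 := by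
      have := j.2
      simp only [Pi.add_apply]
      omega
    rw [hX _ j hj]
    have hs1 := sum_sub_single hj
    have hs2 := sum_add_single h i
    -- The second difference normally lowers the sum below that of h. It is unavailable only if j =
    -- k ≠ i and h_j = 1; then the first difference already has the same sum and a smaller support,
    -- which is why the order `multLT` has a second component.
    by_cases hk : (h + Pi.single (i : Fin N) 1 - Pi.single (j : Fin N) 1 : Fin N → ℕ) k = 0
    · have hkj : k = j := by
        by_contra hne
        have hne' : (k : Fin N) ≠ j := fun e => hne (Subtype.ext e)
        have := k.2
        simp [hne'] at hk
        omega
      subst hkj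
      have hz : D (h + Pi.single (i : Fin N) 1 - Pi.single (k : Fin N) 1) ∈ Z := by
        refine ih _ (Or.inr ⟨by omega, ?_⟩)
        refine Finset.card_lt_card ⟨fun m hm => ?_, fun hsub => ?_⟩
        · rw [Finset.mem_filter] at hm ⊢
          refine ⟨hm.1, fun h0 => hm.2 ?_⟩
          have : m ≠ i := fun e => i.2 (e ▸ h0)
          simp [h0, this]
        · have := hsub (Finset.mem_filter.2 ⟨Finset.mem_univ (k : Fin N), k.2⟩)
          exact (Finset.mem_filter.1 this).2 hk
      exact Z.sub_mem hz (hZ _ _ hz)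
    · rw [hX _ k hk]
      refine ih _ (Or.inl ?_)
      have := sum_sub_single hk
      omega
  obtain ⟨d, hd, hdk⟩ := exists_int_mul_repr b hn hσ fun i => hβ (σ i)
  set B := basisOf hn _ hσ with hB
  have hdecomp : ∀ i : ι, ∀ᶠ a in l, D h a = ∑ j, ((B.repr (β i) j : ℝ) : ℂ) *
      (D (h + Pi.single (i : Fin N) 1) a - u (σ j) *
        D (h + Pi.single (i : Fin N) 1) (a - g (σ j))) := by
    intro i
    choose k hk using hdk (β i) (hβ i)
    -- The relation d β_i = ∑ k_j β_{σ j} with denominators cleared. Additivity of (1 - T^m) on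
    -- D_{h+e_i} then expresses D_h = (1 - T_i) D_{h+e_i} through the basis.
    let r : ι → ℤ := d • Pi.single i 1 - ∑ j, k j • Pi.single (⟨σ j, hσh j⟩ : ι) 1
    have hr : ∑ m, r m • gι m = 0 := by
      have h1 : ∑ m, r m • gι m = d • g i - ∑ j, k j • g (σ j) := by
        simp only [r, Pi.sub_apply, Pi.smul_apply, Finset.sum_apply, sub_smul,
          Finset.sum_sub_distrib, Finset.sum_smul]
        congr 1
        · rw [Fintype.sum_eq_single i]
          · simp [gι]
          · intro m hm
            simp [hm]
        · rw [Finset.sum_comm]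
          refine Finset.sum_congr rfl fun j _ => ?_
          rw [Fintype.sum_eq_single ⟨σ j, hσh j⟩]
          · simp [gι]
          · intro m hm
            simp [hm]
      rw [h1, sub_eq_zero]
      apply Subtype.ext
      have h2 : (d : ℝ) • β i = ∑ j, (k j : ℝ) • β (σ j) := by
        conv_lhs => rw [← B.sum_repr (β i)]
        rw [Finset.smul_sum]
        refine Finset.sum_congr rfl fun j _ => ?_
        rw [← hk j, smul_smul]
        simp [hB]
      refine ContinuousLinearMap.ext fun x => ?_
      have := congrArg (fun f : StrongDual ℝ V => f x) h2
      simpa [hg] using this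
    have h3 := sum_smul_sub_shift_mem huι hZ (hXX i) hr (hrel r hr)
    rw [memZ] at h3
    filter_upwards [h3] with a ha
    have hterm : ∀ m : ι, (D (h + Pi.single (i : Fin N) 1) -
        shift gι uι (Pi.single m 1) (D (h + Pi.single (i : Fin N) 1))) a =
        D (h + Pi.single (i : Fin N) 1) a - u m * D (h + Pi.single (i : Fin N) 1) (a - g m) := by
      intro m
      rw [Pi.sub_apply, shift_single]
    simp only [Finset.sum_apply, Pi.smul_apply, smul_eq_mul, hterm] at ha
    have h4 : ∑ m : ι, (r m : ℂ) * (D (h + Pi.single (i : Fin N) 1) a -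
        u m * D (h + Pi.single (i : Fin N) 1) (a - g m)) =
        (d : ℂ) * D h a - ∑ j, (k j : ℂ) * (D (h + Pi.single (i : Fin N) 1) a -
        u (σ j) * D (h + Pi.single (i : Fin N) 1) (a - g (σ j))) := by
      simp only [r, Pi.sub_apply, Pi.smul_apply, Finset.sum_apply, Int.cast_sub, sub_mul,
        Finset.sum_sub_distrib, Int.cast_sum, Finset.sum_mul]
      congr 1
      · rw [Fintype.sum_eq_single i]
        · rw [← hD.recursion h i a]
          simp [hg]
        · intro m hm
          simp [hm]
      · rw [Finset.sum_comm]
        refine Finset.sum_congr rfl fun j _ => ?_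
        rw [Fintype.sum_eq_single ⟨σ j, hσh j⟩]
        · simp
        · intro m hm
          simp [hm]
    rw [h4, sub_eq_zero] at ha
    have hd' : (d : ℂ) ≠ 0 := by exact_mod_cast hd
    refine mul_left_cancel₀ hd' ?_
    rw [ha, Finset.mul_sum]
    refine Finset.sum_congr rfl fun j _ => ?_
    rw [← mul_assoc]
    congr 1
    exact_mod_cast (hk j).symm
  have hall := (eventually_all.2 hdecomp).and (eventually_all.2 hXD)
  filter_upwards [hall] with a ⟨h1, h2⟩
  have h2' : ∀ j, D h a = u (σ j) * D h (a - g (σ j)) := by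
    intro j
    have := h2 ⟨σ j, hσh j⟩
    rw [Pi.sub_apply, shift_single, sub_eq_zero] at this
    exact this
  have hv : ∀ j i, dualVec hn σ hσ j (β i) = ((B.repr (β i) j : ℝ) : ℂ) := fun j i => rfl
  have hgi : ∀ i, (g i : StrongDual ℝ V) = β i := fun _ => rfl
  have hE : ∀ j, D h a = ∑ i, (h i : ℂ) * ((B.repr (β i) j : ℝ) : ℂ) *
      (D (h + Pi.single i 1) a - u (σ j) * D (h + Pi.single i 1) (a - g (σ j))) := by
    intro j
    have e1 := hD.euler h (dualVec hn σ hσ j) a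
    have e2 := hD.euler h (dualVec hn σ hσ j) (a - g (σ j))
    have e3 : dualVec hn σ hσ j ((a - g (σ j) : dualLattice b) : StrongDual ℝ V) =
        dualVec hn σ hσ j (a : StrongDual ℝ V) - 1 := by
      have := dualVec_apply hn σ hσ j j
      rw [if_pos rfl] at this
      rw [AddSubgroup.coe_sub, map_sub, this]
    rw [e3] at e2
    -- Invariance of D_h cancels all but the commutator of T_{σ j} with multiplication by the j-th
    -- coordinate, which is one copy of D_h.
    have e4 : D h a = dualVec hn σ hσ j (a : StrongDual ℝ V) * D h a -
        u (σ j) * ((dualVec hn σ hσ j (a : StrongDual ℝ V) - 1) * D h (a - g (σ j))) := by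
      linear_combination (dualVec hn σ hσ j (a : StrongDual ℝ V) - 1) * (h2' j) * (-1)
    rw [e4, e1, e2, Finset.mul_sum, ← Finset.sum_sub_distrib]
    refine Finset.sum_congr rfl fun i _ => ?_
    rw [hgi, hv]
    linear_combination (-(h i : ℂ) * ((B.repr (β i) j : ℝ) : ℂ)) * h2' j
  -- After exchanging the sums, the inner sum over the basis is D_h(a) by `hdecomp`, whatever i is.
  have hsum : ∑ _j : Fin n, D h a = ∑ i, (h i : ℂ) * D h a := by
    rw [Finset.sum_congr rfl fun j _ => hE j, Finset.sum_comm]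
    refine Finset.sum_congr rfl fun i _ => ?_
    by_cases hi : h i = 0
    · simp [hi]
    · conv_rhs => rw [h1 ⟨i, hi⟩, Finset.mul_sum]
      exact Finset.sum_congr rfl fun j _ => by ring
  rw [Finset.sum_const, Finset.card_univ, Fintype.card_fin, nsmul_eq_mul, ← Finset.sum_mul,
    ← Nat.cast_sum] at hsum
  by_contra hne
  exact hcard (by exact_mod_cast (mul_right_cancel₀ hne hsum).symm)

end Core

end PartitionResidue

end

noncomputable section

namespace PartitionResidue

open Module Filter

/-! ### Propagation of the vanishing from the depth of a chamber -/

section Propagation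

variable {V : Type*} [NormedAddCommGroup V] [NormedSpace ℝ V] {n N : ℕ}
variable {β : Fin N → StrongDual ℝ V} {c : Set (StrongDual ℝ V)}

theorem mem_sub_box_iff {h : Fin N → ℕ} {a : StrongDual ℝ V} :
    a ∈ c - box (fun i => (h i : ℝ) • β i) ↔
      ∃ s : Fin N → ℝ, (∀ i, 0 ≤ s i ∧ s i ≤ h i) ∧ a + ∑ i, s i • β i ∈ c := by
  constructor
  · rintro ⟨x, hx, _, ⟨t, ht, rfl⟩, rfl⟩
    refine ⟨fun i => t i * h i, fun i => ⟨mul_nonneg (ht i).1 (Nat.cast_nonneg _), ?_⟩, ?_⟩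
    · exact mul_le_of_le_one_left (Nat.cast_nonneg _) (ht i).2
    · simpa [mul_smul] using hx
  · rintro ⟨s, hs, hx⟩
    refine ⟨_, hx, ∑ i, s i • β i, ⟨fun i => s i / h i, fun i => ⟨?_, ?_⟩, ?_⟩, by simp⟩
    · exact div_nonneg (hs i).1 (Nat.cast_nonneg _)
    · exact div_le_one_of_le₀ (hs i).2 (Nat.cast_nonneg _)
    · refine Finset.sum_congr rfl fun i _ => ?_
      rw [smul_smul]
      by_cases hi : h i = 0
      · have := hs i
        rw [hi, Nat.cast_zero] at this
        rw [hi, le_antisymm this.2 this.1]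
        simp
      · rw [div_mul_cancel₀ _ (by exact_mod_cast hi)]

variable (b : Basis (Fin n) ℝ V)

variable (c) in
/-- The filter of the points of the dual lattice that lie deep inside the cone `c`. -/
def deep : Filter (dualLattice b) :=
  ⨅ s ∈ c, 𝓟 {a : dualLattice b | (a : StrongDual ℝ V) - s ∈ c}

variable {b}
variable [FiniteDimensional ℝ V] (hn : finrank ℝ (StrongDual ℝ V) = n)

include hn in
theorem IsChamber.exists_smul_add_mem (hc : IsChamber n β c) (hcβ : c ⊆ cone β)
    {a₀ : StrongDual ℝ V} (ha₀ : a₀ ∈ c) (r : ℝ) :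
    ∃ T : ℝ, 0 ≤ T ∧ ∀ y : StrongDual ℝ V, ‖y‖ ≤ r → T • a₀ + y ∈ c := by
  obtain ⟨ε, hε, hball⟩ := Metric.isOpen_iff.1 hc.isOpen a₀ ha₀
  have hT : 0 < (|r| + 1) / ε := by positivity
  refine ⟨(|r| + 1) / ε, hT.le, fun y hy => ?_⟩
  have h1 : a₀ + ((|r| + 1) / ε)⁻¹ • y ∈ c := by
    refine hball ?_
    rw [Metric.mem_ball, dist_eq_norm, add_sub_cancel_left, norm_smul, Real.norm_eq_abs,
      abs_of_pos (inv_pos.2 hT), inv_div, div_mul_eq_mul_div, div_lt_iff₀ (by positivity)]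
    have := le_abs_self r
    nlinarith
  have h2 := hc.smul_mem hn hcβ h1 hT
  rwa [smul_add, smul_smul, mul_inv_cancel₀ hT.ne', one_smul] at h2

include hn in
-- The translates s + c are directed because c is closed under addition, so one of them is enough.
theorem eventually_deep_iff (hc : IsChamber n β c) (hcβ : c ⊆ cone β)
    {p : dualLattice b → Prop} : (∀ᶠ a in deep c b, p a) ↔
      ∃ s ∈ c, ∀ a : dualLattice b, (a : StrongDual ℝ V) - s ∈ c → p a := by
  have hdir : DirectedOn ((fun s => {a : dualLattice b | (a : StrongDual ℝ V) - s ∈ c}) ⁻¹'o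
      (· ≥ ·)) c := by
    intro s hs t ht
    refine ⟨s + t, hc.add_mem hn hcβ hs ht, fun a ha => ?_, fun a ha => ?_⟩
    · have h1 : (a : StrongDual ℝ V) - (s + t) ∈ c := ha
      have := hc.add_mem hn hcβ h1 ht
      rwa [show (a : StrongDual ℝ V) - (s + t) + t = a - s by abel] at this
    · have h1 : (a : StrongDual ℝ V) - (s + t) ∈ c := ha
      have := hc.add_mem hn hcβ h1 hs
      rwa [show (a : StrongDual ℝ V) - (s + t) + s = a - t by abel] at this
  exact (hasBasis_biInf_principal hdir hc.nonempty).eventually_iff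

include hn in
-- A bounded displacement is absorbed by a large multiple of an interior vector.
theorem tendsto_sub_deep (hc : IsChamber n β c) (hcβ : c ⊆ cone β) (m : dualLattice b) :
    Tendsto (fun a => a - m) (deep c b) (deep c b) := by
  intro S hS
  obtain ⟨s, hs, hS⟩ := (eventually_deep_iff hn hc hcβ).1 (show ∀ᶠ a in deep c b, a ∈ S from hS)
  obtain ⟨T, hT0, hT⟩ := hc.exists_smul_add_mem hn hcβ hs ‖-(m : StrongDual ℝ V)‖
  have h1 := hT _ le_rfl
  refine (eventually_deep_iff hn hc hcβ).2 ⟨T • s + s, ?_, fun a ha => hS _ ?_⟩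
  · have := hc.smul_mem hn hcβ hs (t := T + 1) (by linarith)
    rwa [add_smul, one_smul] at this
  · have := hc.add_mem hn hcβ ha h1
    rw [AddSubgroup.coe_sub]
    rwa [show (a : StrongDual ℝ V) - (T • s + s) + (T • s + -(m : StrongDual ℝ V)) =
      a - m - s by abel] at this

variable {hβ : ∀ i, β i ∈ dualLattice b} {u : Fin N → ℂ} {D : (Fin N → ℕ) → dualLattice b → ℂ}

omit [FiniteDimensional ℝ V] in
theorem coe_add_sum_zsmul (hβ : ∀ i, β i ∈ dualLattice b) (a : dualLattice b) (m : Fin N → ℤ) :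
    ((a + ∑ j, m j • (⟨β j, hβ j⟩ : dualLattice b) : dualLattice b) : StrongDual ℝ V) =
      a + ∑ j, (m j : ℝ) • β j := by
  refine ContinuousLinearMap.ext fun x => ?_
  simp

/-- The twisted value of `F` at the translate of `a` by `∑ m_i g_i`. -/
def twistedValue (g : Fin N → dualLattice b) (u : Fin N → ℂ) (F : dualLattice b → ℂ)
    (a : dualLattice b) (m : Fin N → ℤ) : ℂ :=
  (∏ i, u i ^ (-m i)) * F (a + ∑ i, m i • g i)

omit [FiniteDimensional ℝ V] in
-- If s - m leaves room for one more unit at i, the point a + ∑ m_j g_j lies in c - Box(Φ, h - e_i).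
-- There D_{h-e_i} vanishes, and the difference equation becomes a twisted periodicity.
theorem IsPartitionFamily.twistedValue_step
    (hD : IsPartitionFamily (fun i => ⟨β i, hβ i⟩) u D) (hu : ∀ i, u i ≠ 0)
    {h : Fin N → ℕ}
    (hz : ∀ i, h i ≠ 0 → ∀ a : dualLattice b, (a : StrongDual ℝ V) ∈
      c - box (fun j => ((h - Pi.single i 1 : Fin N → ℕ) j : ℝ) • β j) →
        D (h - Pi.single i 1) a = 0)
    {a : dualLattice b} {s : Fin N → ℝ} (hs : (a : StrongDual ℝ V) + ∑ i, s i • β i ∈ c)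
    {m : Fin N → ℤ} (hm : ∀ i, 0 ≤ s i - m i ∧ s i - m i ≤ h i) {i : Fin N}
    (hi : s i - m i + 1 ≤ h i) :
    twistedValue (fun i => ⟨β i, hβ i⟩) u (D h) a (m - Pi.single i 1) =
      twistedValue (fun i => ⟨β i, hβ i⟩) u (D h) a m := by
  set g : Fin N → dualLattice b := fun i => ⟨β i, hβ i⟩ with hg
  have hi0 : h i ≠ 0 := by
    intro h0
    have := (hm i).1
    rw [h0, Nat.cast_zero] at hi
    linarith
  have h1 := hD.pred hi0 (a + ∑ j, m j • g j)
  have hcoe : ((a + ∑ j, m j • g j : dualLattice b) : StrongDual ℝ V) =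
      a + ∑ j, (m j : ℝ) • β j := coe_add_sum_zsmul hβ a m
  rw [hz i hi0, sub_eq_zero] at h1
  · have e : a + ∑ j, (m - Pi.single i 1 : Fin N → ℤ) j • g j = a + ∑ j, m j • g j - g i := by
      simp only [Pi.sub_apply, sub_smul, Finset.sum_sub_distrib]
      rw [Fintype.sum_eq_single (f := fun j => (Pi.single i 1 : Fin N → ℤ) j • g j) i]
      · simp [add_sub_assoc]
      · intro j hj
        simp [hj]
    have e2 : ∏ j, u j ^ (-(m - Pi.single i 1 : Fin N → ℤ) j) = (∏ j, u j ^ (-m j)) * u i := by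
      have e3 : ∀ j, u j ^ (-(m - Pi.single i 1 : Fin N → ℤ) j) =
          u j ^ (-m j) * u j ^ (Pi.single i 1 : Fin N → ℤ) j := fun j => by
        rw [← zpow_add₀ (hu j), Pi.sub_apply, neg_sub, neg_add_eq_sub]
      simp only [e3, Finset.prod_mul_distrib]
      rw [Fintype.prod_eq_single (f := fun j => u j ^ (Pi.single i 1 : Fin N → ℤ) j) i]
      · simp [mul_comm]
      · intro j hj
        simp [hj]
    rw [twistedValue, twistedValue, e, e2, h1]
    ring
  · rw [mem_sub_box_iff]
    refine ⟨fun j => s j - m j, fun j => ⟨(hm j).1, ?_⟩, ?_⟩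
    · by_cases hj : j = i
      · subst hj
        have : ((h - Pi.single j 1 : Fin N → ℕ) j : ℝ) = h j - 1 := by
          simp only [Pi.sub_apply, Pi.single_eq_same]
          rw [Nat.cast_sub (Nat.one_le_iff_ne_zero.2 hi0), Nat.cast_one]
        rw [this]
        linarith
      · simpa [hj] using (hm j).2
    · rw [hcoe]
      rw [add_assoc, ← Finset.sum_add_distrib]
      simpa only [← add_smul, add_sub_cancel] using hs

omit [FiniteDimensional ℝ V] in
-- The admissible integer points form a box, so two of them are joined by unit steps inside it;
-- induction on their ℓ¹ distance.
theorem IsPartitionFamily.twistedValue_eq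
    (hD : IsPartitionFamily (fun i => ⟨β i, hβ i⟩) u D) (hu : ∀ i, u i ≠ 0)
    {h : Fin N → ℕ}
    (hz : ∀ i, h i ≠ 0 → ∀ a : dualLattice b, (a : StrongDual ℝ V) ∈
      c - box (fun j => ((h - Pi.single i 1 : Fin N → ℕ) j : ℝ) • β j) →
        D (h - Pi.single i 1) a = 0)
    {a : dualLattice b} {s : Fin N → ℝ} (hs : (a : StrongDual ℝ V) + ∑ i, s i • β i ∈ c)
    {m' : Fin N → ℤ} (hm' : ∀ i, 0 ≤ s i - m' i ∧ s i - m' i ≤ h i) (d : ℕ) :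
    ∀ {m : Fin N → ℤ}, (∀ i, 0 ≤ s i - m i ∧ s i - m i ≤ h i) →
      ∑ i, (m i - m' i).natAbs = d →
      twistedValue (fun i => ⟨β i, hβ i⟩) u (D h) a m =
        twistedValue (fun i => ⟨β i, hβ i⟩) u (D h) a m' := by
  induction d with
  | zero =>
    intro m hm hd
    congr 1
    funext i
    have := (Finset.sum_eq_zero_iff.1 hd) i (Finset.mem_univ i)
    omega
  | succ d ih =>
    intro m hm hd
    obtain ⟨i, hi⟩ : ∃ i, m i ≠ m' i := by
      by_contra! hall
      simp [hall] at hd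
    have hother : ∀ m₁ : Fin N → ℤ, (∀ j, j ≠ i → m₁ j = m j) →
        (m₁ i - m' i).natAbs + 1 = (m i - m' i).natAbs → ∑ j, (m₁ j - m' j).natAbs = d := by
      intro m₁ h1 h2
      rw [← Finset.add_sum_erase _ _ (Finset.mem_univ i)] at hd ⊢
      rw [Finset.sum_congr rfl fun j hj => by rw [h1 j (Finset.mem_erase.1 hj).1]]
      omega
    rcases lt_or_gt_of_ne hi with hlt | hgt
    · have hlt' : (m i : ℝ) + 1 ≤ m' i := by exact_mod_cast hlt
      have hm₁ : ∀ j, 0 ≤ s j - ((m + Pi.single i 1 : Fin N → ℤ) j : ℝ) ∧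
          s j - ((m + Pi.single i 1 : Fin N → ℤ) j : ℝ) ≤ h j := by
        intro j
        by_cases hj : j = i
        · subst hj
          have h1 := hm j
          have h2 := hm' j
          simp only [Pi.add_apply, Pi.single_eq_same, Int.cast_add, Int.cast_one]
          constructor <;> linarith
        · simpa [hj] using hm j
      have hstep := hD.twistedValue_step hu hz hs hm₁ (i := i) (by
        have := (hm i).2
        simp only [Pi.add_apply, Pi.single_eq_same, Int.cast_add, Int.cast_one]
        linarith)
      rw [add_sub_cancel_right] at hstep
      rw [hstep]
      refine ih hm₁ (hother _ (fun j hj => by simp [hj]) ?_)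
      simp
      omega
    · have hgt' : (m' i : ℝ) + 1 ≤ m i := by exact_mod_cast hgt
      have hstep := hD.twistedValue_step hu hz hs hm (i := i) (by
        have := (hm' i).2
        linarith)
      rw [← hstep]
      refine ih (fun j => ?_) (hother _ (fun j hj => by simp [hj]) ?_)
      · by_cases hj : j = i
        · subst hj
          have h1 := hm j
          have h2 := hm' j
          simp only [Pi.sub_apply, Pi.single_eq_same, Int.cast_sub, Int.cast_one]
          constructor <;> linarith
        · simpa [hj] using hm j
      · simp
        omega

/-- Close to y, rounding down gives a value between ⌈y⌉ - 1 and ⌊y⌋. Both are within distance 1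
below y, and 1 ≤ h. -/
theorem eventually_sub_floor (x m : ℝ) (t : ℝ) {h : ℕ} (hh : m = 0 ∧ x = 0 ∨ h ≠ 0) :
    ∀ᶠ t' in nhds t, 0 ≤ x + t * m - ⌊x + t' * m⌋ ∧ x + t * m - ⌊x + t' * m⌋ ≤ h := by
  rcases hh with ⟨rfl, rfl⟩ | hh
  · simp
  have hcont : Continuous fun t' : ℝ => x + t' * m := by fun_prop
  have h1 : (1 : ℝ) ≤ h := by exact_mod_cast Nat.one_le_iff_ne_zero.2 hh
  set y := x + t * m with hy
  have hlt : ∀ᶠ t' in nhds t, x + t' * m < ⌊y⌋ + 1 :=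
    (hcont.tendsto t).eventually (gt_mem_nhds (Int.lt_floor_add_one y))
  have hgt : ∀ᶠ t' in nhds t, (⌈y⌉ : ℝ) - 1 < x + t' * m :=
    (hcont.tendsto t).eventually (lt_mem_nhds (by linarith [Int.ceil_lt_add_one y]))
  filter_upwards [hlt, hgt] with t' ht1 ht2
  have e1 : ⌊x + t' * m⌋ ≤ ⌊y⌋ := by
    have : ⌊x + t' * m⌋ < ⌊y⌋ + 1 := Int.floor_lt.2 (by push_cast; exact ht1)
    omega
  have e2 : ⌈y⌉ - 1 ≤ ⌊x + t' * m⌋ := Int.le_floor.2 (by push_cast; exact ht2.le)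
  have e1' : (⌊x + t' * m⌋ : ℝ) ≤ ⌊y⌋ := by exact_mod_cast e1
  have e2' : (⌈y⌉ : ℝ) - 1 ≤ ⌊x + t' * m⌋ := by exact_mod_cast e2
  have := Int.floor_le y
  have := Int.le_ceil y
  constructor <;> linarith

include hn in
-- Twisted values do not change along the rounded half-line that leads from a into the depth of c.
theorem IsPartitionFamily.eq_zero_of_deep (hc : IsChamber n β c) (hcβ : c ⊆ cone β)
    (hD : IsPartitionFamily (fun i => ⟨β i, hβ i⟩) u D) (hu : ∀ i, u i ≠ 0)
    {h : Fin N → ℕ} {σ : Fin n → Fin N} (hσ : LinearIndependent ℝ (β ∘ σ))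
    (hσh : ∀ j, h (σ j) ≠ 0)
    (hz : ∀ i, h i ≠ 0 → ∀ a : dualLattice b, (a : StrongDual ℝ V) ∈
      c - box (fun j => ((h - Pi.single i 1 : Fin N → ℕ) j : ℝ) • β j) →
        D (h - Pi.single i 1) a = 0)
    (hdeep : ∀ᶠ a in deep c b, D h a = 0) (a : dualLattice b)
    (ha : (a : StrongDual ℝ V) ∈ c - box (fun j => (h j : ℝ) • β j)) : D h a = 0 := by
  set g : Fin N → dualLattice b := fun i => ⟨β i, hβ i⟩ with hg
  obtain ⟨x, hx, hxc⟩ := mem_sub_box_iff.1 ha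
  obtain ⟨a₀, ha₀⟩ := hc.nonempty
  -- The direction is written on σ, inside the support of h: where h_i = 0 the box leaves no room to
  -- move.
  obtain ⟨m, hm, hm0⟩ : ∃ m : Fin N → ℝ, ∑ i, m i • β i = a₀ ∧ ∀ i, h i = 0 → m i = 0 := by
    refine ⟨fun i => ∑ j, if σ j = i then (basisOf hn _ hσ).repr a₀ j else 0, ?_, ?_⟩
    · simp only [Finset.sum_smul, ite_smul, zero_smul]
      rw [Finset.sum_comm]
      simp only [Finset.sum_ite_eq, Finset.mem_univ, if_true]
      conv_rhs => rw [← (basisOf hn _ hσ).sum_repr a₀]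
      simp
    · intro i hi
      refine Finset.sum_eq_zero fun j _ => if_neg ?_
      rintro rfl
      exact hσh j hi
  have hx0 : ∀ i, h i = 0 → x i = 0 := fun i hi => by
    have := hx i
    rw [hi, Nat.cast_zero] at this
    exact le_antisymm this.2 this.1
  have hcase : ∀ i, m i = 0 ∧ x i = 0 ∨ h i ≠ 0 := fun i => by
    by_cases hi : h i = 0
    · exact Or.inl ⟨hm0 i hi, hx0 i hi⟩
    · exact Or.inr hi
  have hmem : ∀ t : ℝ, 0 ≤ t → (a : StrongDual ℝ V) + ∑ i, (x i + t * m i) • β i ∈ c := by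
    intro t ht
    have e : (a : StrongDual ℝ V) + ∑ i, (x i + t * m i) • β i =
        (a + ∑ i, x i • β i) + t • a₀ := by
      simp only [add_smul, Finset.sum_add_distrib, mul_smul, ← Finset.smul_sum, hm, add_assoc]
    rw [e]
    rcases ht.eq_or_lt with rfl | ht
    · simpa using hxc
    · exact hc.add_mem hn hcβ hxc (hc.smul_mem hn hcβ ha₀ ht)
  let q : Set.Ici (0 : ℝ) → ℂ := fun t =>
    twistedValue g u (D h) a fun i => ⌊x i + (t : ℝ) * m i⌋
  -- For nearby parameters both rounded points are admissible for the same real point x + tm.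
  have hq : IsLocallyConstant q := by
    rw [IsLocallyConstant.iff_eventually_eq]
    intro t
    have h1 : ∀ᶠ t' : ℝ in nhds (t : ℝ), ∀ i, 0 ≤ x i + t * m i - ⌊x i + t' * m i⌋ ∧
        x i + t * m i - ⌊x i + t' * m i⌋ ≤ h i :=
      eventually_all.2 fun i => eventually_sub_floor (x i) (m i) t (hcase i)
    have h2 := h1.self_of_nhds
    filter_upwards [continuous_subtype_val.continuousAt.eventually h1] with t' ht'
    exact hD.twistedValue_eq hu hz (hmem t t.2) h2 _ ht' rfl
  have hconst : ∀ t : Set.Ici (0 : ℝ), q t = q ⟨0, Set.self_mem_Ici⟩ := fun t =>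
    hq.apply_eq_of_isPreconnected (isPreconnected_iff_preconnectedSpace.1 isPreconnected_Ici).isPreconnected_univ
      trivial trivial
  have hzero : ∃ t : Set.Ici (0 : ℝ), q t = 0 := by
    obtain ⟨s, hs, hsz⟩ := (eventually_deep_iff hn hc hcβ).1 hdeep
    -- Rounding costs at most ∑ ‖β_i‖, and ‖s‖ pays for the depth required.
    obtain ⟨T, hT0, hT⟩ := hc.exists_smul_add_mem hn hcβ ha₀ (‖s‖ + ∑ i, ‖β i‖)
    refine ⟨⟨T, hT0⟩, ?_⟩
    have hco : ((a + ∑ i, ⌊x i + T * m i⌋ • g i : dualLattice b) : StrongDual ℝ V) =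
        a + ∑ i, (⌊x i + T * m i⌋ : ℝ) • β i := coe_add_sum_zsmul hβ a _
    have : D h (a + ∑ i, ⌊x i + T * m i⌋ • g i) = 0 := by
      refine hsz _ ?_
      have e : ((a + ∑ i, ⌊x i + T * m i⌋ • g i : dualLattice b) : StrongDual ℝ V) - s =
          (a + ∑ i, x i • β i) + (T • a₀ + (-s - ∑ i, Int.fract (x i + T * m i) • β i)) := by
        rw [hco, ← hm, Finset.smul_sum]
        have : ∀ i, (⌊x i + T * m i⌋ : ℝ) • β i =
            x i • β i + T • m i • β i - Int.fract (x i + T * m i) • β i := fun i => by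
          rw [smul_smul, ← add_smul, ← sub_smul, Int.self_sub_fract]
        simp only [this, Finset.sum_sub_distrib, Finset.sum_add_distrib]
        abel
      rw [e]
      refine hc.add_mem hn hcβ hxc (hT _ ?_)
      refine (norm_sub_le _ _).trans (add_le_add (norm_neg s).le ?_)
      refine (norm_sum_le _ _).trans (Finset.sum_le_sum fun i _ => ?_)
      rw [norm_smul, Real.norm_eq_abs, Int.abs_fract]
      exact mul_le_of_le_one_left (norm_nonneg _) (Int.fract_lt_one _).le
    change twistedValue g u (D h) a (fun i => ⌊x i + T * m i⌋) = 0
    rw [twistedValue, this, mul_zero]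
  obtain ⟨t, ht⟩ := hzero
  have h0 : q ⟨0, Set.self_mem_Ici⟩ = 0 := by rw [← hconst t, ht]
  -- At t = 0 both ⌊x⌋ and 0 are admissible for x, so the path may start at a itself.
  have hself : twistedValue g u (D h) a (fun i => ⌊x i + (0 : ℝ) * m i⌋) =
      twistedValue g u (D h) a 0 := by
    refine hD.twistedValue_eq hu hz hxc (m' := 0) (fun i => by simpa using hx i) _ (fun i => ?_) rfl
    have := (eventually_sub_floor (x i) (m i) 0 (hcase i)).self_of_nhds
    simpa using this
  have h1 : twistedValue g u (D h) a 0 = D h a := by simp [twistedValue]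
  rw [← h1, ← hself]
  exact h0

end Propagation

end PartitionResidue

end

noncomputable section

namespace PartitionResidue

open Module Filter

/-! ### Vanishing of partition families -/

section Vanishing

variable {V : Type*} [NormedAddCommGroup V] [NormedSpace ℝ V] {n N : ℕ}
variable {β : Fin N → StrongDual ℝ V} {c : Set (StrongDual ℝ V)} {b : Basis (Fin n) ℝ V}
variable {hβ : ∀ i, β i ∈ dualLattice b} {u : Fin N → ℂ} {D : (Fin N → ℕ) → dualLattice b → ℂ}

/-- The indicator of σ lies below h and has the same sum. -/
theorem eq_sum_single_of_sum_eq {h : Fin N → ℕ} {σ : Fin n → Fin N} (hσ : Function.Injective σ)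
    (hσh : ∀ j, h (σ j) ≠ 0) (hcard : ∑ i, h i = n) : h = ∑ j, Pi.single (σ j) 1 := by
  have hval : ∀ i, (∑ j, Pi.single (σ j) 1 : Fin N → ℕ) i ≤ h i := by
    intro i
    rw [Finset.sum_apply]
    by_cases hi : ∃ j, σ j = i
    · obtain ⟨j, rfl⟩ := hi
      rw [Fintype.sum_eq_single j]
      · have := hσh j
        simp
        omega
      · intro k hk
        have : σ j ≠ σ k := fun e => hk (hσ e).symm
        simp [this]
    · push Not at hi
      rw [Finset.sum_eq_zero]
      · exact Nat.zero_le _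
      · intro j _
        simp [(hi j).symm]
  have hsum : ∑ i, (∑ j, Pi.single (σ j) 1 : Fin N → ℕ) i = ∑ i, h i := by
    rw [hcard]
    simp only [Finset.sum_apply]
    rw [Finset.sum_comm]
    simp
  funext i
  exact (((Finset.sum_eq_sum_iff_of_le fun i _ => hval i).1 hsum) i (Finset.mem_univ i)).symm

theorem mem_sub_box_of_mem {h : Fin N → ℕ} {a : StrongDual ℝ V} (ha : a ∈ c) :
    a ∈ c - box (fun i => (h i : ℝ) • β i) :=
  mem_sub_box_iff.2 ⟨0, fun i => ⟨le_rfl, Nat.cast_nonneg _⟩, by simpa using ha⟩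

variable [FiniteDimensional ℝ V] (hn : finrank ℝ (StrongDual ℝ V) = n)

include hn

/-- A family that satisfies the difference and Euler equations vanishes near a chamber as soon as it
does for the lists supported on a basis, and for those whose support does not span. -/
theorem IsPartitionFamily.eq_zero (hc : IsChamber n β c) (hcβ : c ⊆ cone β)
    (hD : IsPartitionFamily (fun i => ⟨β i, hβ i⟩) u D) (hu : ∀ i, u i ≠ 0)
    (hflat : ∀ h : Fin N → ℕ, (∀ σ : Fin n → Fin N, LinearIndependent ℝ (β ∘ σ) →
      ∃ j, h (σ j) = 0) → ∀ a : dualLattice b,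
        (a : StrongDual ℝ V) ∈ c - box (fun j => (h j : ℝ) • β j) → D h a = 0)
    (hbasis : ∀ σ : Fin n → Fin N, LinearIndependent ℝ (β ∘ σ) → ∀ a : dualLattice b,
      (a : StrongDual ℝ V) ∈
        c - box (fun i => ((∑ j, Pi.single (σ j) 1 : Fin N → ℕ) i : ℝ) • β i) →
        D (∑ j, Pi.single (σ j) 1) a = 0) (h : Fin N → ℕ) :
    ∀ a : dualLattice b,
      (a : StrongDual ℝ V) ∈ c - box (fun j => (h j : ℝ) • β j) → D h a = 0 := by
  induction h using wellFounded_multLT.induction with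
  | _ h ih =>
  by_cases hex : ∃ σ : Fin n → Fin N, LinearIndependent ℝ (β ∘ σ) ∧ ∀ j, h (σ j) ≠ 0
  · obtain ⟨σ, hσ, hσh⟩ := hex
    -- The Euler argument gives nothing exactly when ∑ h_i = n; there h is the indicator of a basis
    -- and the hypothesis applies.
    by_cases hcard : ∑ i, h i = n
    · have := eq_sum_single_of_sum_eq (hσ.injective.of_comp) hσh hcard
      rw [this]
      exact hbasis σ hσ
    · refine hD.eq_zero_of_deep hn hc hcβ hu hσ hσh (fun i hi => ih _ (Or.inl ?_)) ?_
      · have := sum_sub_single hi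
        omega
      · refine hD.eventually_eq_zero hn hu (tendsto_sub_deep hn hc hcβ) hσ hσh hcard
          fun h' hh' => (eventually_deep_iff hn hc hcβ).2 ?_
        obtain ⟨s, hs⟩ := hc.nonempty
        refine ⟨s, hs, fun a ha => ih h' hh' a (mem_sub_box_of_mem ?_)⟩
        have := hc.add_mem hn hcβ ha hs
        rwa [sub_add_cancel] at this
  · push Not at hex
    exact hflat h hex

omit [FiniteDimensional ℝ V] in
-- Carathéodory puts the vector in the cone of an independent subfamily, and regularity forces that
-- subfamily to have n elements.
theorem exists_tuple_mem_of_mem_cone {a : StrongDual ℝ V} [FiniteDimensional ℝ V]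
    (hreg : a ∉ singularSet n β) (s : Finset (Fin N)) (ha : a ∈ cone (fun i : s => β i)) :
    ∃ σ : Fin n → Fin N, LinearIndependent ℝ (β ∘ σ) ∧ ∀ j, σ j ∈ s := by
  obtain ⟨t, hts, hti, x, hx, rfl⟩ := exists_linearIndepOn_of_mem_cone β s ha
  have hle : t.card ≤ n := by
    have := LinearIndependent.fintype_card_le_finrank (R := ℝ) hti
    simpa [hn] using this
  have hcard : t.card = n := by
    refine le_antisymm hle (not_lt.1 fun h => hreg ⟨t, h, ?_⟩)
    exact sum_mem_cone_subtype β t t subset_rfl x fun i hi => (hx i hi).le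
  obtain ⟨σ, hinj, hσ, rfl⟩ := exists_tuple β t hti hcard
  exact ⟨σ, hσ, fun j => hts (by simp)⟩

end Vanishing

/-! ### Weighted partition functions -/

section Partition

/-- The coefficients of `(1 - u q)^{-h}`, as a function on the integers. -/
def weight (u : ℂ) (h : ℕ) (x : ℤ) : ℂ :=
  if 0 ≤ x then u ^ x.toNat * (Nat.multichoose h x.toNat : ℂ) else 0

theorem weight_of_neg (u : ℂ) (h : ℕ) {x : ℤ} (hx : x < 0) : weight u h x = 0 :=
  if_neg (not_le.2 hx)

theorem weight_natCast (u : ℂ) (h x : ℕ) : weight u h x = u ^ x * (Nat.multichoose h x : ℂ) := by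
  simp [weight]

theorem weight_recursion (u : ℂ) (h : ℕ) (x : ℤ) :
    weight u (h + 1) x - u * weight u (h + 1) (x - 1) = weight u h x := by
  rcases lt_or_ge x 0 with hx | hx
  · rw [weight_of_neg _ _ hx, weight_of_neg _ _ hx, weight_of_neg _ _ (by omega)]
    simp
  lift x to ℕ using hx
  cases x with
  | zero =>
    rw [weight_natCast, weight_natCast, weight_of_neg _ _ (by simp)]
    simp
  | succ x =>
    have : ((x + 1 : ℕ) : ℤ) - 1 = x := by simp
    rw [this, weight_natCast, weight_natCast, weight_natCast, Nat.multichoose_succ_succ, pow_succ]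
    push_cast
    ring

theorem mul_multichoose_succ (h x : ℕ) :
    h * Nat.multichoose (h + 1) x = (h + x) * Nat.multichoose h x := by
  cases h with
  | zero => cases x <;> simp [Nat.multichoose_zero_succ]
  | succ h =>
    rw [Nat.multichoose_eq, Nat.multichoose_eq]
    have e1 : h + 1 + 1 + x - 1 = h + 1 + x := by omega
    have e2 : h + 1 + x - 1 = h + x := by omega
    rw [e1, e2]
    have := Nat.add_one_mul_choose_eq (h + x) h
    have c1 := Nat.choose_symm_of_eq_add (show h + x = x + h by omega)
    have c2 := Nat.choose_symm_of_eq_add (show h + 1 + x = x + (h + 1) by omega)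
    rw [c1, c2]
    have e3 : h + x + 1 = h + 1 + x := by omega
    rw [e3] at this
    rw [mul_comm, ← this]

/-- The coefficient form of q d/dq applied to (1 - uq)^{-h}. -/
theorem weight_euler (u : ℂ) (h : ℕ) (x : ℤ) :
    (h : ℂ) * (weight u (h + 1) x - weight u h x) = x * weight u h x := by
  rcases lt_or_ge x 0 with hx | hx
  · rw [weight_of_neg _ _ hx, weight_of_neg _ _ hx]
    simp
  lift x to ℕ using hx
  have := congrArg (Nat.cast : ℕ → ℂ) (mul_multichoose_succ h x)
  push_cast at this
  rw [weight_natCast, weight_natCast]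
  push_cast
  linear_combination u ^ x * this

variable {V : Type*} [NormedAddCommGroup V] [NormedSpace ℝ V] {n N : ℕ}
variable {β : Fin N → StrongDual ℝ V} {b : Basis (Fin n) ℝ V}

/-- The product of the weights of the coordinates. -/
def totalWeight (u : Fin N → ℂ) (h : Fin N → ℕ) (x : Fin N → ℤ) : ℂ :=
  ∏ i, weight (u i) (h i) (x i)

theorem totalWeight_update (u : Fin N → ℂ) (h h' : Fin N → ℕ) (x x' : Fin N → ℤ) (i : Fin N)
    (hh : ∀ j ≠ i, h' j = h j) (hx : ∀ j ≠ i, x' j = x j) :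
    totalWeight u h' x' = weight (u i) (h' i) (x' i) *
      ∏ j ∈ Finset.univ.erase i, weight (u j) (h j) (x j) := by
  rw [totalWeight, ← Finset.mul_prod_erase _ _ (Finset.mem_univ i)]
  congr 1
  refine Finset.prod_congr rfl fun j hj => ?_
  rw [hh j (Finset.mem_erase.1 hj).1, hx j (Finset.mem_erase.1 hj).1]

theorem totalWeight_recursion (u : Fin N → ℂ) (h : Fin N → ℕ) (i : Fin N) (x : Fin N → ℤ) :
    totalWeight u (h + Pi.single i 1) x -
      u i * totalWeight u (h + Pi.single i 1) (x - Pi.single i 1) = totalWeight u h x := by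
  rw [totalWeight_update u h (h + Pi.single i 1) x x i (fun j hj => by simp [hj]) fun _ _ => rfl,
    totalWeight_update u h (h + Pi.single i 1) x (x - Pi.single i 1) i (fun j hj => by simp [hj])
      (fun j hj => by simp [hj]),
    totalWeight_update u h h x x i (fun _ _ => rfl) fun _ _ => rfl, ← weight_recursion (u i) (h i)]
  simp only [Pi.add_apply, Pi.sub_apply, Pi.single_eq_same]
  ring

theorem totalWeight_euler (u : Fin N → ℂ) (h : Fin N → ℕ) (i : Fin N) (x : Fin N → ℤ) :
    (h i : ℂ) * (totalWeight u (h + Pi.single i 1) x - totalWeight u h x) =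
      x i * totalWeight u h x := by
  rw [totalWeight_update u h (h + Pi.single i 1) x x i (fun j hj => by simp [hj]) fun _ _ => rfl,
    totalWeight_update u h h x x i (fun _ _ => rfl) fun _ _ => rfl]
  have := weight_euler (u i) (h i) (x i)
  simp only [Pi.add_apply, Pi.single_eq_same]
  linear_combination (∏ j ∈ Finset.univ.erase i, weight (u j) (h j) (x j)) * this

open Classical in
variable (β) in
/-- The terms of the weighted partition function. -/
def partitionTerm (u : Fin N → ℂ) (h : Fin N → ℕ) (a : StrongDual ℝ V) (x : Fin N → ℤ) : ℂ :=
  if ∑ i, (x i : ℝ) • β i = a then totalWeight u h x else 0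

variable (β) in
/-- The weighted partition function. -/
def partitionSum (u : Fin N → ℂ) (h : Fin N → ℕ) (a : StrongDual ℝ V) : ℂ :=
  ∑ᶠ x, partitionTerm β u h a x

theorem partitionTerm_ne_zero {u : Fin N → ℂ} {h : Fin N → ℕ} {a : StrongDual ℝ V}
    {x : Fin N → ℤ} (hx : partitionTerm β u h a x ≠ 0) :
    (∀ i, 0 ≤ x i) ∧ (∀ i, h i = 0 → x i = 0) ∧ ∑ i, (x i : ℝ) • β i = a := by
  rw [partitionTerm] at hx
  split_ifs at hx with hxa
  swap
  · exact absurd rfl hx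
  have hw : ∀ i, weight (u i) (h i) (x i) ≠ 0 := fun i =>
    Finset.prod_ne_zero_iff.1 hx i (Finset.mem_univ i)
  have hpos : ∀ i, 0 ≤ x i := fun i => not_lt.1 fun hneg => hw i (weight_of_neg _ _ hneg)
  refine ⟨hpos, fun i hi => ?_, hxa⟩
  have h1 := hw i
  have h2 := hpos i
  by_contra hne
  refine h1 ?_
  obtain ⟨m, hm⟩ : ∃ m : ℕ, x i = (m + 1 : ℕ) := ⟨(x i).toNat - 1, by omega⟩
  rw [hm, hi, weight_natCast, Nat.multichoose_zero_succ]
  simp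

/-- Pairing with v bounds each coordinate by a(v)/β_i(v). -/
theorem finite_partition (hhalf : ∃ v : V, ∀ i, 0 < β i v) (a : StrongDual ℝ V) :
    {x : Fin N → ℤ | (∀ i, 0 ≤ x i) ∧ ∑ i, (x i : ℝ) • β i = a}.Finite := by
  obtain ⟨v, hv⟩ := hhalf
  refine (Set.finite_Icc (0 : Fin N → ℤ) fun i => ⌊a v / β i v⌋).subset ?_
  rintro x ⟨hx, rfl⟩
  refine ⟨hx, fun i => Int.le_floor.2 ?_⟩
  rw [le_div_iff₀ (hv i)]
  have : (x i : ℝ) * β i v ≤ ∑ j, (x j : ℝ) * β j v :=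
    Finset.single_le_sum (f := fun j => (x j : ℝ) * β j v)
      (fun j _ => mul_nonneg (by exact_mod_cast hx j) (hv j).le) (Finset.mem_univ i)
  simpa using this

theorem finite_support_partitionTerm (hhalf : ∃ v : V, ∀ i, 0 < β i v) (u : Fin N → ℂ)
    (h : Fin N → ℕ) (a : StrongDual ℝ V) : (Function.support (partitionTerm β u h a)).Finite :=
  (finite_partition hhalf a).subset fun _ hx =>
    ⟨(partitionTerm_ne_zero hx).1, (partitionTerm_ne_zero hx).2.2⟩

theorem exists_of_partitionSum_ne_zero {u : Fin N → ℂ} {h : Fin N → ℕ} {a : StrongDual ℝ V}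
    (ha : partitionSum β u h a ≠ 0) : ∃ x : Fin N → ℤ,
    (∀ i, 0 ≤ x i) ∧ (∀ i, h i = 0 → x i = 0) ∧ ∑ i, (x i : ℝ) • β i = a := by
  by_contra! hex
  refine ha ((finsum_congr fun x => ?_).trans finsum_zero)
  by_contra hx
  exact hex x (partitionTerm_ne_zero hx).1 (partitionTerm_ne_zero hx).2.1
    (partitionTerm_ne_zero hx).2.2

open Classical in
theorem partitionTerm_sub (u : Fin N → ℂ) (h : Fin N → ℕ) (i : Fin N) (a : StrongDual ℝ V)
    (x : Fin N → ℤ) : partitionTerm β u h (a - β i) (x - Pi.single i 1) =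
      if ∑ i, (x i : ℝ) • β i = a then totalWeight u h (x - Pi.single i 1) else 0 := by
  have e : ∑ j, (((x - Pi.single i 1 : Fin N → ℤ) j : ℤ) : ℝ) • β j =
      ∑ j, (x j : ℝ) • β j - β i := by
    have e0 : ∀ j, (((x - Pi.single i 1 : Fin N → ℤ) j : ℤ) : ℝ) • β j =
        (x j : ℝ) • β j - ((Pi.single i 1 : Fin N → ℤ) j : ℝ) • β j := fun j => by
      refine ContinuousLinearMap.ext fun v => ?_
      simp [sub_mul]
    rw [Finset.sum_congr rfl fun j _ => e0 j, Finset.sum_sub_distrib]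
    rw [Fintype.sum_eq_single (f := fun j => ((Pi.single i 1 : Fin N → ℤ) j : ℝ) • β j) i]
    · simp
    · intro j hj
      simp [hj]
  rw [partitionTerm, e]
  simp only [sub_left_inj]

theorem finsum_comp_sub {G : Type*} [AddGroup G] (f : G → ℂ) (c : G) :
    ∑ᶠ x, f (x - c) = ∑ᶠ x, f x :=
  finsum_comp_equiv (Equiv.subRight c)

theorem finite_support_comp_sub {G : Type*} [AddGroup G] {f : G → ℂ}
    (hf : (Function.support f).Finite) (c : G) : (Function.support fun x => f (x - c)).Finite :=
  hf.preimage (Equiv.subRight c).injective.injOn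

theorem partitionSum_recursion (hhalf : ∃ v : V, ∀ i, 0 < β i v) (u : Fin N → ℂ)
    (h : Fin N → ℕ) (i : Fin N) (a : StrongDual ℝ V) :
    partitionSum β u (h + Pi.single i 1) a -
      u i * partitionSum β u (h + Pi.single i 1) (a - β i) = partitionSum β u h a := by
  have hfin := finite_support_partitionTerm (β := β) hhalf u
  have hfin2 := finite_support_comp_sub (hfin (h + Pi.single i 1) (a - β i)) (Pi.single i 1)
  rw [partitionSum, partitionSum, partitionSum,
    ← finsum_comp_sub (partitionTerm β u (h + Pi.single i 1) (a - β i)) (Pi.single i 1),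
    ← smul_eq_mul, smul_finsum]
  refine (finsum_sub_distrib (hfin _ _)
    (hfin2.subset (Function.support_const_smul_subset (u i) _))).symm.trans ?_
  refine finsum_congr fun x => ?_
  rw [Pi.smul_apply, partitionTerm_sub, partitionTerm, partitionTerm, ← totalWeight_recursion u h i x]
  split_ifs <;> simp

/-- On the summation set v(a) = ∑ x_i v(β_i), and each factor x_i is absorbed by
`totalWeight_euler`. -/
theorem partitionSum_euler (hhalf : ∃ v : V, ∀ i, 0 < β i v) (u : Fin N → ℂ)
    (h : Fin N → ℕ) (v : Complexification V) (a : StrongDual ℝ V) :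
    v a * partitionSum β u h a = ∑ i, (h i : ℂ) * v (β i) *
      (partitionSum β u (h + Pi.single i 1) a - partitionSum β u h a) := by
  have hfin := finite_support_partitionTerm (β := β) hhalf u
  have e1 : ∀ i, (h i : ℂ) * v (β i) *
      (partitionSum β u (h + Pi.single i 1) a - partitionSum β u h a) =
      ∑ᶠ x, ((h i : ℂ) * v (β i)) •
        (partitionTerm β u (h + Pi.single i 1) a x - partitionTerm β u h a x) := fun i => by
    rw [partitionSum, partitionSum, ← finsum_sub_distrib (hfin _ _) (hfin _ _), ← smul_eq_mul,
      smul_finsum]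
  rw [Finset.sum_congr rfl fun i _ => e1 i, ← finsum_sum_comm, partitionSum, ← smul_eq_mul,
    smul_finsum]
  · refine finsum_congr fun x => ?_
    simp only [partitionTerm, smul_eq_mul]
    split_ifs with hx
    · rw [← hx, map_sum, Finset.sum_mul]
      refine Finset.sum_congr rfl fun i _ => ?_
      have := totalWeight_euler u h i x
      rw [map_smul, Complex.real_smul, Complex.ofReal_intCast]
      linear_combination -v (β i) * this
    · simp
  · intro i _
    refine ((hfin (h + Pi.single i 1) a).union (hfin h a)).subset ?_
    refine (Function.support_const_smul_subset ((h i : ℂ) * v (β i)) _).trans ?_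
    exact Function.support_sub _ _

theorem isPartitionFamily_partitionSum (hhalf : ∃ v : V, ∀ i, 0 < β i v)
    (hβ : ∀ i, β i ∈ dualLattice b) (u : Fin N → ℂ) :
    IsPartitionFamily (L := dualLattice b) (fun i => ⟨β i, hβ i⟩) u
      fun h a => partitionSum β u h a :=
  ⟨fun h i a => partitionSum_recursion hhalf u h i a,
    fun h v a => partitionSum_euler hhalf u h v a⟩

/-! ### Comparison with sums of values of functions -/

theorem cPoly_natCast (k : ℕ) {h : ℕ} (hh : 1 ≤ h) :
    cPoly (k : ℝ) h = (Nat.multichoose h k : ℝ) := by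
  obtain ⟨h, rfl⟩ : ∃ h', h = h' + 1 := ⟨h - 1, by omega⟩
  have h1 : ∏ m ∈ Finset.range h, ((k : ℝ) + ((m : ℝ) + 1)) =
      (h.factorial * (k + h).choose h : ℕ) := by
    rw [← Nat.ascFactorial_eq_factorial_mul_choose, Nat.ascFactorial_eq_prod_range]
    push_cast
    exact Finset.prod_congr rfl fun m _ => by ring
  have h2 : (h.factorial : ℝ) ≠ 0 := by exact_mod_cast h.factorial_ne_zero
  rw [cPoly, Nat.add_sub_cancel, h1, Nat.multichoose_eq, Nat.cast_mul, mul_div_cancel_left₀ _ h2]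
  rw [show h + 1 + k - 1 = k + h by omega, Nat.choose_symm_add]

theorem fhy_intCast (y : Fin N → ℂ) {h : Fin N → ℕ} (hh : ∀ i, 1 ≤ h i) {x : Fin N → ℤ}
    (hx : ∀ i, 0 ≤ x i) :
    fhy h y (fun i => (x i : ℝ)) = totalWeight (fun i => Complex.exp (y i)) h x := by
  rw [fhy, totalWeight, Complex.exp_sum, ← Finset.prod_mul_distrib]
  refine Finset.prod_congr rfl fun i _ => ?_
  obtain ⟨k, hk⟩ := Int.eq_ofNat_of_zero_le (hx i)
  rw [hk, weight_natCast, Int.cast_natCast, cPoly_natCast _ (hh i), ← Complex.exp_nat_mul]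
  congr 1
  push_cast
  rw [mul_comm]

theorem latticeSum_eq (f : (Fin N → ℝ) → ℂ) (a : StrongDual ℝ V) :
    latticeSum f β a = ∑ᶠ x ∈ {x : Fin N → ℤ | (∀ i, 0 ≤ x i) ∧ ∑ i, (x i : ℝ) • β i = a},
      f fun i => (x i : ℝ) := by
  have hinj : Function.Injective fun (x : Fin N → ℤ) (i : Fin N) => (x i : ℝ) := by
    intro x x' hxx
    funext i
    have := congrFun hxx i
    simpa using this
  rw [latticeSum, ← finsum_mem_image (g := fun (x : Fin N → ℤ) (i : Fin N) => (x i : ℝ))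
    hinj.injOn]
  refine finsum_mem_congr (Set.ext fun x => ⟨?_, ?_⟩) fun _ _ => rfl
  · rintro ⟨⟨hx0, hxa⟩, hxi⟩
    choose k hk using hxi
    have hkx : (fun i => (k i : ℝ)) = x := funext fun i => (hk i).symm
    refine ⟨k, ⟨fun i => ?_, ?_⟩, hkx⟩
    · have := hx0 i
      rw [hk i] at this
      exact_mod_cast this
    · rw [← hxa, ← hkx]
  · rintro ⟨k, ⟨hk0, hka⟩, rfl⟩
    exact ⟨⟨fun i => Int.cast_nonneg (hk0 i), hka⟩, fun i => ⟨k i, rfl⟩⟩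

theorem latticeSum_fhy (y : Fin N → ℂ) {h : Fin N → ℕ} (hh : ∀ i, 1 ≤ h i)
    (a : StrongDual ℝ V) :
    latticeSum (fhy h y) β a = partitionSum β (fun i => Complex.exp (y i)) h a := by
  rw [latticeSum_eq, partitionSum, finsum_mem_def]
  refine finsum_congr fun x => ?_
  by_cases hx : (∀ i, 0 ≤ x i) ∧ ∑ i, (x i : ℝ) • β i = a
  · rw [Set.indicator_of_mem (by exact hx), partitionTerm, if_pos hx.2]
    exact fhy_intCast y hh hx.1
  · rw [Set.indicator_of_notMem (by exact hx)]
    by_contra hne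
    exact hx ⟨(partitionTerm_ne_zero (Ne.symm hne)).1, (partitionTerm_ne_zero (Ne.symm hne)).2.2⟩

/-! ### Partition functions outside the cone and on degenerate supports -/

variable {c : Set (StrongDual ℝ V)} [FiniteDimensional ℝ V]
  (hn : finrank ℝ (StrongDual ℝ V) = n)

include hn

theorem partitionSum_eq_zero_of_not_subset (hc : IsChamber n β c) (hcβ : ¬ c ⊆ cone β)
    (u : Fin N → ℂ) {h : Fin N → ℕ} {a : StrongDual ℝ V}
    (ha : a ∈ c - box (fun i => (h i : ℝ) • β i)) : partitionSum β u h a = 0 := by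
  by_contra hne
  obtain ⟨x, hx0, -, rfl⟩ := exists_of_partitionSum_ne_zero hne
  obtain ⟨s, hs, hsc⟩ := mem_sub_box_iff.1 ha
  refine hc.disjoint_cone hn hcβ hsc ⟨fun i => x i + s i, fun i => ?_, ?_⟩
  · exact add_nonneg (by exact_mod_cast hx0 i) (hs i).1
  · simp only [add_smul, Finset.sum_add_distrib]

/-- A nonzero value would put a vector of c in the cone of the support of h, which would then
contain a basis. -/
theorem partitionSum_eq_zero_of_degenerate (hc : IsChamber n β c) (u : Fin N → ℂ)
    {h : Fin N → ℕ} (hdeg : ∀ σ : Fin n → Fin N, LinearIndependent ℝ (β ∘ σ) →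
      ∃ j, h (σ j) = 0) {a : StrongDual ℝ V}
    (ha : a ∈ c - box (fun i => (h i : ℝ) • β i)) : partitionSum β u h a = 0 := by
  by_contra hne
  obtain ⟨x, hx0, hxh, rfl⟩ := exists_of_partitionSum_ne_zero hne
  obtain ⟨s, hs, hsc⟩ := mem_sub_box_iff.1 ha
  have e : ∑ i, (x i : ℝ) • β i + ∑ i, s i • β i =
      ∑ i ∈ Finset.univ.filter (fun i => h i ≠ 0), (x i + s i) • β i := by
    rw [← Finset.sum_add_distrib, Finset.sum_filter]
    refine Finset.sum_congr rfl fun i _ => ?_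
    split_ifs with hi
    · rw [add_smul]
    · rw [not_not] at hi
      have := hs i
      rw [hi, Nat.cast_zero] at this
      rw [hxh i hi, le_antisymm this.2 this.1]
      simp
  rw [e] at hsc
  obtain ⟨σ, hσ, hσh⟩ := exists_tuple_mem_of_mem_cone hn (hc.notMem_singularSet hsc)
    (Finset.univ.filter fun i => h i ≠ 0) (sum_mem_cone_subtype β _ _ subset_rfl _ fun i _ =>
      add_nonneg (by exact_mod_cast hx0 i) (hs i).1)
  obtain ⟨j, hj⟩ := hdeg σ hσ
  exact (Finset.mem_filter.1 (hσh j)).2 hj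

end Partition

end PartitionResidue

end

noncomputable section

namespace PartitionResidue

open Module Filter

/-! ### Poles modulo the lattice -/

section Poles

/-- The index of the sublattice Bℤ^n; it is the source of vol(σ) in the count of poles. -/
theorem card_quotient_mulVec {n : ℕ} (B : Matrix (Fin n) (Fin n) ℤ) (hB : B.det ≠ 0) :
    Nat.card ((Fin n → ℤ) ⧸ LinearMap.range B.mulVecLin) = B.det.natAbs := by
  have hinj : Function.Injective B.mulVecLin := Matrix.mulVec_injective_of_det_ne_zero hB
  rw [← Submodule.natAbs_det_equiv _ (LinearEquiv.ofInjective B.mulVecLin hinj)]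
  congr 1
  rw [← LinearMap.det_toLin' B]
  rfl

variable {V : Type*} [NormedAddCommGroup V] [NormedSpace ℝ V] {n N : ℕ}
variable {β : Fin N → StrongDual ℝ V} {b : Basis (Fin n) ℝ V}

theorem mem_lattice_iff (γ : V) : γ ∈ lattice b ↔ ∃ m : Fin n → ℤ, γ = ∑ a, (m a : ℝ) • b a := by
  rw [lattice, Submodule.mem_span_range_iff_exists_fun]
  simp only [Int.cast_smul_eq_zsmul, eq_comm]

theorem LatticeEquiv.refl (p : Complexification V) : LatticeEquiv b p p :=
  ⟨0, zero_mem _, fun α => by simp⟩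

theorem LatticeEquiv.symm {p q : Complexification V} (h : LatticeEquiv b p q) :
    LatticeEquiv b q p := by
  obtain ⟨γ, hγ, h⟩ := h
  refine ⟨-γ, neg_mem hγ, fun α => ?_⟩
  rw [map_neg, Complex.ofReal_neg, mul_neg, ← h α]
  ring

theorem LatticeEquiv.trans {p q r : Complexification V} (h : LatticeEquiv b p q)
    (h' : LatticeEquiv b q r) : LatticeEquiv b p r := by
  obtain ⟨γ, hγ, h⟩ := h
  obtain ⟨γ', hγ', h'⟩ := h'
  refine ⟨γ + γ', add_mem hγ hγ', fun α => ?_⟩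
  rw [map_add, Complex.ofReal_add, mul_add, ← h α, ← h' α]
  ring

theorem LatticeEquiv.add_right {p q : Complexification V} (h : LatticeEquiv b p q)
    (r : Complexification V) : LatticeEquiv b (p + r) (q + r) := by
  obtain ⟨γ, hγ, h⟩ := h
  refine ⟨γ, hγ, fun α => ?_⟩
  rw [← h α, add_apply, add_apply]
  ring

theorem LatticeEquiv.exp_eq {p q : Complexification V} (h : LatticeEquiv b p q)
    {α : StrongDual ℝ V} (hα : α ∈ dualLattice b) : Complex.exp (p α) = Complex.exp (q α) := by
  obtain ⟨γ, hγ, h⟩ := h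
  obtain ⟨k, hk⟩ := hα γ hγ
  refine Complex.exp_eq_exp_iff_exists_int.2 ⟨k, ?_⟩
  have := h α
  rw [hk] at this
  push_cast at this
  linear_combination this

variable (β) in
/-- The points at which all the factors indexed by `σ` have a pole. -/
def basisPoles (y : Fin N → ℂ) (σ : Fin n → Fin N) : Set (Complexification V) :=
  {p | ∀ j, Complex.exp (p (β (σ j))) = Complex.exp (-y (σ j))}

theorem mem_basisPoles_iff {y : Fin N → ℂ} {σ : Fin n → Fin N} {p : Complexification V} :
    p ∈ basisPoles β y σ ↔ ∃ k : Fin n → ℤ, ∀ j,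
      p (β (σ j)) = -y (σ j) + k j * (2 * Real.pi * Complex.I) := by
  simp only [basisPoles, Set.mem_ofPred_eq, Complex.exp_eq_exp_iff_exists_int]
  exact Classical.skolem

theorem LatticeEquiv.mem_basisPoles (hβ : ∀ i, β i ∈ dualLattice b) {y : Fin N → ℂ}
    {σ : Fin n → Fin N} {p q : Complexification V} (h : LatticeEquiv b p q)
    (hq : q ∈ basisPoles β y σ) : p ∈ basisPoles β y σ := fun j => by
  rw [h.exp_eq (hβ (σ j))]
  exact hq j

variable [FiniteDimensional ℝ V] (hn : finrank ℝ (StrongDual ℝ V) = n)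

include hn in
theorem exists_basisPole {σ : Fin n → Fin N} (hσ : LinearIndependent ℝ (β ∘ σ))
    (z : Fin n → ℂ) : ∃ p : Complexification V, ∀ j, p (β (σ j)) = z j := by
  refine ⟨∑ j, z j • dualVec hn σ hσ j, fun j => ?_⟩
  rw [sum_apply, Fintype.sum_eq_single j]
  · rw [smul_apply, dualVec_apply]
    simp
  · intro i hi
    rw [smul_apply, dualVec_apply, if_neg (Ne.symm hi), smul_zero]

include hn in
-- Choosing logarithms parametrises the poles of σ by ℤ^n, and a translation by 2πiΓ moves the
-- parameter by Bℤ^n.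
theorem latticeEquiv_iff {σ : Fin n → Fin N} (hσ : LinearIndependent ℝ (β ∘ σ))
    {y : Fin N → ℂ} {B : Matrix (Fin n) (Fin n) ℤ} (hB : ∀ j a, β (σ j) (b a) = B j a)
    {p q : Complexification V} {k l : Fin n → ℤ}
    (hp : ∀ j, p (β (σ j)) = -y (σ j) + k j * (2 * Real.pi * Complex.I))
    (hq : ∀ j, q (β (σ j)) = -y (σ j) + l j * (2 * Real.pi * Complex.I)) :
    LatticeEquiv b p q ↔ k - l ∈ LinearMap.range B.mulVecLin := by
  have hpi : (2 * Real.pi * Complex.I : ℂ) ≠ 0 := Complex.two_pi_I_ne_zero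
  have hval : ∀ (m : Fin n → ℤ) j, β (σ j) (∑ a, (m a : ℝ) • b a) = ((B.mulVec m j : ℤ) : ℝ) := by
    intro m j
    simp [Matrix.mulVec, dotProduct, hB, mul_comm]
  constructor
  · rintro ⟨γ, hγ, h⟩
    obtain ⟨m, rfl⟩ := (mem_lattice_iff γ).1 hγ
    refine ⟨m, funext fun j => ?_⟩
    have h1 := h (β (σ j))
    rw [hp, hq, hval, Complex.ofReal_intCast] at h1
    have h2 : ((k j : ℂ) - l j) = (B.mulVec m j : ℤ) := by
      refine mul_right_cancel₀ hpi ?_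
      linear_combination h1
    rw [Matrix.mulVecLin_apply, Pi.sub_apply]
    exact_mod_cast h2.symm
  · rintro ⟨m, hm⟩
    refine ⟨∑ a, (m a : ℝ) • b a, (mem_lattice_iff _).2 ⟨m, rfl⟩, fun α => ?_⟩
    have key : ∀ j, (p - q) (β (σ j)) = (2 * (Real.pi : ℂ) * Complex.I) *
        ((β (σ j) (∑ a, (m a : ℝ) • b a) : ℝ) : ℂ) := by
      intro j
      have h1 := congrFun hm j
      rw [Matrix.mulVecLin_apply, Pi.sub_apply] at h1
      rw [hval, h1, sub_apply, hp, hq]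
      push_cast
      ring
    generalize ∑ a, (m a : ℝ) • b a = γ at key ⊢
    change (p - q) α = _
    rw [← (basisOf hn _ hσ).sum_repr α]
    simp only [map_sum, map_smul, basisOf_apply, Function.comp_apply, key,
      sum_apply, smul_apply, Complex.real_smul,
      Complex.ofReal_sum, Finset.mul_sum, smul_eq_mul, Complex.ofReal_mul]
    refine Finset.sum_congr rfl fun j _ => ?_
    ring

omit [FiniteDimensional ℝ V] in
theorem intMatrix_det {u : Fin n → StrongDual ℝ V} {B : Matrix (Fin n) (Fin n) ℤ}
    (hB : ∀ j a, u j (b a) = B j a) :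
    ((B.det : ℤ) : ℝ) = (Matrix.of fun i j => u i (b j)).det := by
  have hBu : B.map (Int.cast : ℤ → ℝ) = Matrix.of fun i j => u i (b j) := by
    ext i j
    simp [hB]
  rw [← hBu]
  exact (Int.castRingHom ℝ).map_det B

omit [FiniteDimensional ℝ V] in
theorem intMatrix_det_ne_zero {u : Fin n → StrongDual ℝ V} (hu : LinearIndependent ℝ u)
    {B : Matrix (Fin n) (Fin n) ℤ} (hB : ∀ j a, u j (b a) = B j a) : B.det ≠ 0 := by
  intro h0
  refine coordMatrix_det_ne_zero b u hu ?_
  have := intMatrix_det hB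
  rw [h0] at this
  simpa [coordMatrix] using this.symm

omit [FiniteDimensional ℝ V] in
theorem latticeVolume_eq {u : Fin n → StrongDual ℝ V} {B : Matrix (Fin n) (Fin n) ℤ}
    (hB : ∀ j a, u j (b a) = B j a) : latticeVolume b u = (B.det.natAbs : ℝ) := by
  rw [latticeVolume, ← intMatrix_det hB, Nat.cast_natAbs, Int.cast_abs]

variable {y : Fin N → ℂ} {c : Set (StrongDual ℝ V)} {RG : Finset (Complexification V)}

omit [FiniteDimensional ℝ V] in
theorem IsReducedPoleSet.eq_of_latticeEquiv (hRG : IsReducedPoleSet b β y c RG)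
    {p q : Complexification V} (hp : p ∈ RG) (hq : q ∈ RG) (h : LatticeEquiv b p q) : p = q :=
  (hRG.2 q (hRG.1 q hq)).unique ⟨hp, h⟩ ⟨hq, LatticeEquiv.refl q⟩

omit [FiniteDimensional ℝ V] in
theorem basisPoles_subset {σ : Fin n → Fin N} (hσ : LinearIndependent ℝ (β ∘ σ))
    (hcσ : c ⊆ cone (β ∘ σ)) : basisPoles β y σ ⊆ poleSet n β y c :=
  fun _ hp => ⟨σ, hσ, hcσ, hp⟩

open Classical in
include hn in
/-- The number of classes of points that are poles of a given basis. -/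
theorem IsReducedPoleSet.card_filter (hβ : ∀ i, β i ∈ dualLattice b)
    (hRG : IsReducedPoleSet b β y c RG) {σ : Fin n → Fin N}
    (hσ : LinearIndependent ℝ (β ∘ σ)) (hcσ : c ⊆ cone (β ∘ σ)) :
    ((RG.filter (· ∈ basisPoles β y σ)).card : ℝ) = latticeVolume b (β ∘ σ) := by
  obtain ⟨B, hB⟩ := exists_intMatrix b (u := β ∘ σ) fun j => hβ (σ j)
  have hB' : ∀ j a, β (σ j) (b a) = B j a := hB
  rw [latticeVolume_eq hB, ← card_quotient_mulVec B (intMatrix_det_ne_zero hσ hB),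
    ← Fintype.card_coe, ← Nat.card_eq_fintype_card]
  congr 1
  have hmem : ∀ p : {p // p ∈ RG.filter (· ∈ basisPoles β y σ)}, ∃ k : Fin n → ℤ, ∀ j,
      (p : Complexification V) (β (σ j)) = -y (σ j) + k j * (2 * Real.pi * Complex.I) := fun p =>
    mem_basisPoles_iff.1 (Finset.mem_filter.1 p.2).2
  choose k hk using hmem
  refine Nat.card_eq_of_bijective
    (fun p => (Submodule.Quotient.mk (k p) : (Fin n → ℤ) ⧸ LinearMap.range B.mulVecLin)) ⟨?_, ?_⟩
  · intro p q hpq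
    rw [Submodule.Quotient.eq] at hpq
    exact Subtype.ext (hRG.eq_of_latticeEquiv (Finset.mem_filter.1 p.2).1
      (Finset.mem_filter.1 q.2).1 ((latticeEquiv_iff hn hσ hB' (hk p) (hk q)).2 hpq))
  · intro Q
    obtain ⟨l, rfl⟩ := Submodule.Quotient.mk_surjective _ Q
    obtain ⟨q, hq⟩ := exists_basisPole hn hσ fun j =>
      -y (σ j) + l j * (2 * Real.pi * Complex.I)
    have hqσ : q ∈ basisPoles β y σ := mem_basisPoles_iff.2 ⟨l, hq⟩
    obtain ⟨p, ⟨hp, hpq⟩, -⟩ := hRG.2 q (basisPoles_subset hσ hcσ hqσ)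
    refine ⟨⟨p, Finset.mem_filter.2 ⟨hp, hpq.mem_basisPoles hβ hqσ⟩⟩, ?_⟩
    rw [Submodule.Quotient.eq]
    exact (latticeEquiv_iff hn hσ hB' (hk _) hq).1 hpq

open Classical in
/-- The sum of a nontrivial character over the poles of a basis vanishes. -/
theorem IsReducedPoleSet.sum_exp_eq_zero (hβ : ∀ i, β i ∈ dualLattice b)
    (hRG : IsReducedPoleSet b β y c RG) {σ : Fin n → Fin N}
    (hσ : LinearIndependent ℝ (β ∘ σ)) (hcσ : c ⊆ cone (β ∘ σ)) {a : StrongDual ℝ V}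
    (ha : a ∈ dualLattice b) {j : Fin n} (hj : ∀ k : ℤ, (basisOf hn _ hσ).repr a j ≠ k) :
    ∑ p ∈ RG.filter (· ∈ basisPoles β y σ), Complex.exp (-(p a)) = 0 := by
  set S := RG.filter (· ∈ basisPoles β y σ) with hS
  -- Translation by r permutes the classes of poles of σ and multiplies e^{-p(a)} by e^{-2πi x_j},
  -- where x_j is the j-th coordinate of a. This factor differs from 1 for nonintegral x_j, so the
  -- sum must vanish.
  set r : Complexification V := (2 * Real.pi * Complex.I : ℂ) • dualVec hn σ hσ j with hr
  have hrep : ∀ p ∈ S, ∃ q ∈ S, LatticeEquiv b q (p + r) := by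
    intro p hp
    have hpr : p + r ∈ basisPoles β y σ := by
      intro i
      rw [← (Finset.mem_filter.1 hp).2 i, add_apply, hr,
        smul_apply, dualVec_apply]
      split_ifs
      · rw [smul_eq_mul, mul_one, Complex.exp_periodic]
      · rw [smul_zero, add_zero]
    obtain ⟨q, ⟨hq, hqp⟩, -⟩ := hRG.2 _ (basisPoles_subset hσ hcσ hpr)
    exact ⟨q, Finset.mem_filter.2 ⟨hq, hqp.mem_basisPoles hβ hpr⟩, hqp⟩
  choose! τ hτS hτ using hrep
  have hinj : Set.InjOn τ S := by
    intro p hp q hq hpq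
    have h1 := (hτ p hp).symm.trans (hpq ▸ hτ q hq)
    have h2 := h1.add_right (-r)
    have hcancel : ∀ p : Complexification V, p + r + -r = p := fun p =>
      ContinuousLinearMap.ext fun α => by simp
    rw [hcancel, hcancel] at h2
    exact hRG.eq_of_latticeEquiv (Finset.mem_filter.1 hp).1 (Finset.mem_filter.1 hq).1 h2
  have himage : S.image τ = S := by
    refine Finset.eq_of_subset_of_card_le (fun q hq => ?_)
      (Finset.card_image_of_injOn hinj).ge
    obtain ⟨p, hp, rfl⟩ := Finset.mem_image.1 hq
    exact hτS p hp
  set x := (basisOf hn _ hσ).repr a j with hx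
  have hra : r a = 2 * Real.pi * Complex.I * (x : ℂ) := rfl
  have hterm : ∀ p ∈ S, Complex.exp (-(τ p a)) = Complex.exp (-(r a)) * Complex.exp (-(p a)) := by
    intro p hp
    rw [Complex.exp_neg, (hτ p hp).exp_eq ha, ← Complex.exp_neg, add_apply,
      ← Complex.exp_add]
    congr 1
    ring
  have hsum : ∑ p ∈ S, Complex.exp (-(p a)) =
      Complex.exp (-(r a)) * ∑ p ∈ S, Complex.exp (-(p a)) := by
    conv_lhs => rw [← himage, Finset.sum_image hinj, Finset.sum_congr rfl hterm]
    rw [Finset.mul_sum]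
  by_contra hne
  have h1 : Complex.exp (-(r a)) = 1 := by
    refine mul_right_cancel₀ hne ?_
    rw [← hsum, one_mul]
  obtain ⟨k, hk⟩ := Complex.exp_eq_one_iff.1 h1
  refine hj (-k) ?_
  have h2 : (x : ℂ) = -k := by
    refine mul_left_cancel₀ Complex.two_pi_I_ne_zero ?_
    rw [hra] at hk
    linear_combination -hk
  exact_mod_cast h2

include hn in
-- Choosing a basis and logarithms for each pole injects the classes into a finite disjoint union of
-- quotients ℤ^n/Bℤ^n.
theorem exists_isReducedPoleSet (hβ : ∀ i, β i ∈ dualLattice b) (y : Fin N → ℂ)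
    (c : Set (StrongDual ℝ V)) : ∃ RG, IsReducedPoleSet b β y c RG := by
  classical
  let s : Setoid (poleSet n β y c) :=
    { r := fun p q => LatticeEquiv b (p : Complexification V) q
      iseqv := ⟨fun _ => LatticeEquiv.refl _, fun h => h.symm, fun h h' => h.trans h'⟩ }
  have hfin : Finite (Quotient s) := by
    choose B hB using fun σ : Fin n → Fin N => exists_intMatrix b (u := β ∘ σ) fun j => hβ (σ j)
    let T := Σ σ : {σ : Fin n → Fin N // LinearIndependent ℝ (β ∘ σ)},
      (Fin n → ℤ) ⧸ LinearMap.range (B σ).mulVecLin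
    have hT : Finite T := by
      have : ∀ σ : {σ : Fin n → Fin N // LinearIndependent ℝ (β ∘ σ)},
          Finite ((Fin n → ℤ) ⧸ LinearMap.range (B σ).mulVecLin) := fun σ =>
        Nat.finite_of_card_ne_zero (by
          rw [card_quotient_mulVec _ (intMatrix_det_ne_zero σ.2 (hB σ))]
          exact Int.natAbs_ne_zero.2 (intMatrix_det_ne_zero σ.2 (hB σ)))
      infer_instance
    have hT' : ∀ (σ σ' : {σ : Fin n → Fin N // LinearIndependent ℝ (β ∘ σ)}) (k k' : Fin n → ℤ),
        (⟨σ, Submodule.Quotient.mk k⟩ : T) = ⟨σ', Submodule.Quotient.mk k'⟩ →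
          k - k' ∈ LinearMap.range (B σ).mulVecLin := by
      intro σ σ' k k' h
      obtain ⟨rfl, h2⟩ := Sigma.mk.inj_iff.1 h
      exact (Submodule.Quotient.eq _).1 (eq_of_heq h2)
    choose σ hσ hcσ hpσ using fun p : poleSet n β y c => p.2
    choose k hk using fun p : poleSet n β y c =>
      (mem_basisPoles_iff (y := y) (σ := σ p) (p := (p : Complexification V))).1 (hpσ p)
    let F : poleSet n β y c → T := fun p => ⟨⟨σ p, hσ p⟩, Submodule.Quotient.mk (k p)⟩
    refine Finite.of_injective (fun Q : Quotient s => F Q.out) fun Q Q' h => ?_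
    rw [← Quotient.out_equiv_out]
    change LatticeEquiv b _ _
    have h' : F Q.out = F Q'.out := h
    have hσeq : σ Q.out = σ Q'.out := congrArg (fun t : T => (t.1 : Fin n → Fin N)) h'
    have hk2 := hk Q'.out
    rw [← hσeq] at hk2
    refine (latticeEquiv_iff hn (hσ Q.out) (hB (σ Q.out)) (hk Q.out) hk2).2 ?_
    exact hT' _ _ _ _ h'
  have := Fintype.ofFinite (Quotient s)
  refine ⟨Finset.univ.image fun Q : Quotient s => (Q.out : Complexification V), ?_, ?_⟩
  · intro p hp
    obtain ⟨Q, -, rfl⟩ := Finset.mem_image.1 hp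
    exact Q.out.2
  · intro q hq
    refine ⟨((Quotient.mk s ⟨q, hq⟩).out : poleSet n β y c), ⟨?_, ?_⟩, ?_⟩
    · exact Finset.mem_image_of_mem _ (Finset.mem_univ _)
    · exact Quotient.mk_out (s := s) ⟨q, hq⟩
    · rintro p ⟨hp, hpq⟩
      obtain ⟨Q, -, rfl⟩ := Finset.mem_image.1 hp
      have : Q = Quotient.mk s ⟨q, hq⟩ := by
        rw [← Quotient.out_eq Q]
        exact Quotient.sound hpq
      rw [this]

end Poles

end PartitionResidue

end

noncomputable section

namespace PartitionResidue

open Module Filter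

/-! ### Partition functions and residues for a basis -/

section BasisCase

variable {V : Type*} [NormedAddCommGroup V] [NormedSpace ℝ V] {n N : ℕ}
variable {β : Fin N → StrongDual ℝ V} {b : Basis (Fin n) ℝ V} {c : Set (StrongDual ℝ V)}

theorem sum_single_apply {σ : Fin n → Fin N} (hσ : Function.Injective σ) (j : Fin n) :
    (∑ k, Pi.single (σ k) 1 : Fin N → ℕ) (σ j) = 1 := by
  rw [Finset.sum_apply, Fintype.sum_eq_single j]
  · simp
  · intro k hk
    simp [hσ.ne hk.symm]

theorem sum_single_apply_of_notMem {σ : Fin n → Fin N} {i : Fin N} (hi : i ∉ Set.range σ) :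
    (∑ k, Pi.single (σ k) 1 : Fin N → ℕ) i = 0 := by
  rw [Finset.sum_apply, Finset.sum_eq_zero]
  intro k _
  have : i ≠ σ k := fun e => hi ⟨k, e.symm⟩
  simp [this]

theorem sum_smul_eq_of_support {σ : Fin n → Fin N} (hσ : Function.Injective σ) {x : Fin N → ℝ}
    (hx : ∀ i ∉ Set.range σ, x i = 0) : ∑ i, x i • β i = ∑ j, x (σ j) • (β ∘ σ) j :=
  (Fintype.sum_of_injective σ hσ (fun j => x (σ j) • (β ∘ σ) j) (fun i => x i • β i)
    (fun i hi => by rw [hx i hi]; simp) fun _ => rfl).symm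

variable [FiniteDimensional ℝ V] (hn : finrank ℝ (StrongDual ℝ V) = n)

theorem repr_sum_smul {σ : Fin n → Fin N} (hσ : LinearIndependent ℝ (β ∘ σ)) {x : Fin N → ℝ}
    (hx : ∀ i ∉ Set.range σ, x i = 0) (j : Fin n) :
    (basisOf hn _ hσ).repr (∑ i, x i • β i) j = x (σ j) := by
  have e : ∑ i, x i • β i = ∑ j, x (σ j) • basisOf hn _ hσ j := by
    rw [sum_smul_eq_of_support hσ.injective.of_comp hx]
    simp only [basisOf_apply]
  rw [e, Basis.repr_sum_self]

include hn in
theorem partitionSum_basis_eq_zero (hc : IsChamber n β c) {σ : Fin n → Fin N}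
    (hσ : LinearIndependent ℝ (β ∘ σ)) (hcσ : ¬ c ⊆ cone (β ∘ σ)) (u : Fin N → ℂ)
    {a : StrongDual ℝ V}
    (ha : a ∈ c - box (fun i => ((∑ j, Pi.single (σ j) 1 : Fin N → ℕ) i : ℝ) • β i)) :
    partitionSum β u (∑ j, Pi.single (σ j) 1) a = 0 := by
  by_contra hne
  obtain ⟨x, hx0, hxh, rfl⟩ := exists_of_partitionSum_ne_zero hne
  obtain ⟨s, hs, hsc⟩ := mem_sub_box_iff.1 ha
  refine hcσ (hc.subset_cone hn σ hσ hsc ⟨fun j => x (σ j) + s (σ j), fun j => ?_, ?_⟩)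
  · exact add_nonneg (by exact_mod_cast hx0 _) (hs _).1
  · rw [← Finset.sum_add_distrib]
    simp only [← add_smul]
    refine sum_smul_eq_of_support (x := fun i => (x i : ℝ) + s i) hσ.injective.of_comp
      fun i hi => ?_
    have h0 := sum_single_apply_of_notMem hi
    have := hs i
    rw [h0, Nat.cast_zero] at this
    rw [hxh i h0, le_antisymm this.2 this.1]
    simp

theorem partitionSum_basis_eq_zero_of_repr {σ : Fin n → Fin N}
    (hσ : LinearIndependent ℝ (β ∘ σ)) (u : Fin N → ℂ) {a : StrongDual ℝ V} {j : Fin n}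
    (hj : ∀ k : ℤ, (basisOf hn _ hσ).repr a j ≠ k) :
    partitionSum β u (∑ j, Pi.single (σ j) 1) a = 0 := by
  by_contra hne
  obtain ⟨x, -, hxh, rfl⟩ := exists_of_partitionSum_ne_zero hne
  refine hj (x (σ j)) (repr_sum_smul hn hσ (x := fun i => (x i : ℝ)) (fun i hi => ?_) j)
  simp [hxh i (sum_single_apply_of_notMem hi)]

/-- The coordinates of a vector of c - Box(σ) in the basis exceed -1, so integral ones are
nonnegative and give the only lattice point of the polytope. -/
theorem partitionSum_basis (hc : IsChamber n β c) {σ : Fin n → Fin N}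
    (hσ : LinearIndependent ℝ (β ∘ σ)) (hcσ : c ⊆ cone (β ∘ σ)) (u : Fin N → ℂ)
    {a : StrongDual ℝ V}
    (ha : a ∈ c - box (fun i => ((∑ j, Pi.single (σ j) 1 : Fin N → ℕ) i : ℝ) • β i))
    {k : Fin n → ℤ} (hk : ∀ j, (basisOf hn _ hσ).repr a j = k j) :
    partitionSum β u (∑ j, Pi.single (σ j) 1) a = ∏ j, u (σ j) ^ k j := by
  have hinj : Function.Injective σ := hσ.injective.of_comp
  have hk0 : ∀ j, 0 ≤ k j := by
    intro j
    obtain ⟨s, hs, hsc⟩ := mem_sub_box_iff.1 ha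
    have h1 := repr_pos_of_mem_cone hn σ hσ (hcσ hsc) (hc.notMem_singularSet hsc) j
    have h2 := (hs (σ j)).2
    rw [sum_single_apply hinj, Nat.cast_one] at h2
    rw [map_add, Finsupp.add_apply, repr_sum_smul hn hσ (fun i hi => ?_), hk] at h1
    · have h3 : (-1 : ℝ) < k j := by linarith
      have : (-1 : ℤ) < k j := by exact_mod_cast h3
      omega
    · have := hs i
      rw [sum_single_apply_of_notMem hi, Nat.cast_zero] at this
      exact le_antisymm this.2 this.1
  set x₀ : Fin N → ℤ := Function.extend σ k 0 with hx₀
  have hx₀σ : ∀ j, x₀ (σ j) = k j := fun j => hinj.extend_apply k 0 j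
  have hx₀' : ∀ i ∉ Set.range σ, x₀ i = 0 := fun i hi => by
    rw [hx₀, Function.extend_apply' _ _ _ hi]
    rfl
  rw [partitionSum, finsum_eq_single _ x₀]
  · have hxa : ∑ i, (x₀ i : ℝ) • β i = a := by
      rw [← (basisOf hn _ hσ).sum_repr a,
        sum_smul_eq_of_support (x := fun i => (x₀ i : ℝ)) hinj fun i hi => by simp [hx₀' i hi]]
      simp only [hx₀σ, hk, basisOf_apply]
    rw [partitionTerm, if_pos hxa, totalWeight]
    refine (Fintype.prod_of_injective σ hinj _ _ (fun i hi => ?_) fun j => ?_).symm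
    · rw [sum_single_apply_of_notMem hi, hx₀' i hi]
      simp [weight]
    · obtain ⟨m, hm⟩ := Int.eq_ofNat_of_zero_le (hk0 j)
      rw [sum_single_apply hinj, hx₀σ, hm, weight_natCast, Nat.multichoose_one]
      simp
  · intro x hx
    by_contra hne
    obtain ⟨-, hxh, rfl⟩ := partitionTerm_ne_zero hne
    refine hx (funext fun i => ?_)
    have hsupp : ∀ i ∉ Set.range σ, x i = 0 := fun i hi => hxh i (sum_single_apply_of_notMem hi)
    by_cases hi : i ∈ Set.range σ
    · obtain ⟨j, rfl⟩ := hi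
      have := hk j
      rw [repr_sum_smul hn hσ (x := fun i => (x i : ℝ)) fun i hi => by simp [hsupp i hi]] at this
      rw [hx₀σ]
      exact_mod_cast this
    · rw [hsupp i hi, hx₀' i hi]

variable {Ψ : rationalFunctions β →ₗ[ℂ] ℂ} {y : Fin N → ℂ} {RG : Finset (Complexification V)}

omit [FiniteDimensional ℝ V] in
variable (n Ψ y RG) in
/-- The sum over the poles of the values at the kernel of a functional on rational functions, as a
function of arbitrary multiplicities. -/
def residueSum (h : Fin N → ℕ) (a : StrongDual ℝ V) : ℂ :=
  ∑ p ∈ RG, Complex.exp (-(p a)) *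
    Ψ ((kernel β (fun i => Complex.exp (p (β i)) * Complex.exp (y i)) h a).coeff (-(n : ℤ)))

theorem residueSum_mem_expPoly (h : Fin N → ℕ) :
    (fun a : dualLattice b => residueSum n Ψ y RG h a) ∈ expPoly (dualLattice b) := by
  have e : (fun a : dualLattice b => residueSum n Ψ y RG h a) =
      ∑ p ∈ RG, (fun a : dualLattice b => Complex.exp (-(p (a : StrongDual ℝ V)))) *
        fun a : dualLattice b => Ψ ((kernel β (fun i => Complex.exp (p (β i)) *
          Complex.exp (y i)) h (a : StrongDual ℝ V)).coeff (-(n : ℤ))) := by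
    funext a
    rw [Finset.sum_apply]
    rfl
  rw [e]
  refine sum_mem fun p _ => mul_mem ?_ (residue_mem_expPoly b Ψ _ h _)
  exact exp_mem_expPoly (-(p.toLinearMap.toAddMonoidHom.comp (dualLattice b).subtype))

variable (hΨ : ∀ v f, Ψ (derivation β v f) = 0)

omit [FiniteDimensional ℝ V] in
include hΨ in
-- The prefactor e^{-p(a)} turns the constant e^{p(β_i)} e^{y_i} of the recursion into e^{y_i}, the
-- same for every pole, so the equations can be summed over p.
theorem isPartitionFamily_residueSum (hβ : ∀ i, β i ∈ dualLattice b) :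
    IsPartitionFamily (L := dualLattice b) (fun i => ⟨β i, hβ i⟩) (fun i => Complex.exp (y i))
      fun h a => residueSum n Ψ y RG h a where
  recursion h i a := by
    change residueSum n Ψ y RG (h + Pi.single i 1) a -
      Complex.exp (y i) * residueSum n Ψ y RG (h + Pi.single i 1) ((a : StrongDual ℝ V) - β i) = _
    simp only [residueSum]
    rw [Finset.mul_sum, ← Finset.sum_sub_distrib]
    refine Finset.sum_congr rfl fun p _ => ?_
    rw [← residue_recursion (Ψ := Ψ) _ h i (a : StrongDual ℝ V) (-(n : ℤ)), map_sub, neg_sub',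
      sub_neg_eq_add, Complex.exp_add]
    ring
  euler h v a := by
    change v a * residueSum n Ψ y RG h a = ∑ i, (h i : ℂ) * v (β i) *
      (residueSum n Ψ y RG (h + Pi.single i 1) a - residueSum n Ψ y RG h a)
    simp only [residueSum]
    simp only [← Finset.sum_sub_distrib, Finset.mul_sum]
    rw [Finset.sum_comm]
    refine Finset.sum_congr rfl fun p _ => ?_
    rw [mul_left_comm, residue_euler hΨ, Finset.mul_sum]
    exact Finset.sum_congr rfl fun i _ => by ring

include hn hΨ in
-- A support without a basis does not span, so some nonzero direction is annihilated by all β_i that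
-- occur.
theorem residueSum_eq_zero_of_degenerate {h : Fin N → ℕ}
    (hdeg : ∀ σ : Fin n → Fin N, LinearIndependent ℝ (β ∘ σ) → ∃ j, h (σ j) = 0)
    (a : StrongDual ℝ V) : residueSum n Ψ y RG h a = 0 := by
  have hlt : Submodule.span ℝ (β '' {i | h i ≠ 0}) < ⊤ := by
    refine lt_top_iff_ne_top.2 fun htop => ?_
    obtain ⟨σ, hσ, hσh⟩ := exists_basis_tuple_mem hn htop
    obtain ⟨j, hj⟩ := hdeg σ hσ
    exact hσh j hj
  obtain ⟨f, hf0, hf⟩ := Submodule.exists_le_ker_of_lt_top _ hlt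
  set v : Complexification V := Complex.ofRealCLM.comp (LinearMap.toContinuousLinearMap f) with hv
  have hvf : ∀ α, v α = (f α : ℂ) := fun α => rfl
  have hv0 : v ≠ 0 := by
    intro h0
    refine hf0 (LinearMap.ext fun α => ?_)
    have := congrArg (fun w : Complexification V => w α) h0
    rw [hvf] at this
    simpa using this
  refine Finset.sum_eq_zero fun p _ => ?_
  rw [residue_eq_zero hΨ hv0 _ h (fun i hi _ => ?_), mul_zero]
  rw [hvf, LinearMap.mem_ker.1 (hf (Submodule.subset_span ⟨i, hi, rfl⟩)), Complex.ofReal_zero]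

open Classical in
include hn hΨ in
-- If the j-th factor is not polar at p, the dual direction j is tangent to all polar hyperplanes
-- and the term vanishes; otherwise the residue is that of f_σ.
theorem residueSum_basis_eq {σ : Fin n → Fin N} (hσ : LinearIndependent ℝ (β ∘ σ))
    (a : StrongDual ℝ V) : residueSum n Ψ y RG (∑ j, Pi.single (σ j) 1) a =
      (∑ p ∈ RG.filter (· ∈ basisPoles β y σ), Complex.exp (-(p a))) * Ψ (mono β σ (-1)) := by
  rw [residueSum, Finset.sum_filter, Finset.sum_mul]
  refine Finset.sum_congr rfl fun p _ => ?_
  have hw : ∀ j, Complex.exp (p (β (σ j))) = Complex.exp (-y (σ j)) ↔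
      Complex.exp (p (β (σ j))) * Complex.exp (y (σ j)) = 1 := fun j => by
    rw [Complex.exp_neg, mul_eq_one_iff_eq_inv₀ (Complex.exp_ne_zero _)]
  split_ifs with hp
  · rw [kernel_basis_coeff _ σ fun j => (hw j).1 (hp j)]
  · obtain ⟨j, hj⟩ : ∃ j, Complex.exp (p (β (σ j))) ≠ Complex.exp (-y (σ j)) := by
      by_contra! h
      exact hp h
    rw [residue_eq_zero hΨ (dualVec_ne_zero hn σ hσ j) _ _ fun i hi hwi => ?_]
    · simp
    · by_cases hir : i ∈ Set.range σ
      · obtain ⟨k, rfl⟩ := hir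
        rw [dualVec_apply, if_neg]
        rintro rfl
        exact hj ((hw _).2 hwi)
      · exact absurd (sum_single_apply_of_notMem hir) hi

variable (hJ : ∀ σ : Fin n → Fin N, LinearIndependent ℝ (β ∘ σ) →
  (c ⊆ cone (β ∘ σ) → Ψ (mono β σ (-1)) = ((latticeVolume b (β ∘ σ) : ℝ) : ℂ)⁻¹) ∧
  (¬ c ⊆ cone (β ∘ σ) → Ψ (mono β σ (-1)) = 0))

include hΨ hJ in
-- For integral coordinates all poles of σ contribute equally, and their number cancels 1/vol(σ).
theorem residueSum_basis (hβ : ∀ i, β i ∈ dualLattice b) (hRG : IsReducedPoleSet b β y c RG)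
    {σ : Fin n → Fin N} (hσ : LinearIndependent ℝ (β ∘ σ)) (hcσ : c ⊆ cone (β ∘ σ))
    {a : StrongDual ℝ V} {k : Fin n → ℤ} (hk : ∀ j, (basisOf hn _ hσ).repr a j = k j) :
    residueSum n Ψ y RG (∑ j, Pi.single (σ j) 1) a = ∏ j, Complex.exp (y (σ j)) ^ k j := by
  classical
  have hterm : ∀ p ∈ RG.filter (· ∈ basisPoles β y σ),
      Complex.exp (-(p a)) = ∏ j, Complex.exp (y (σ j)) ^ k j := by
    intro p hp
    conv_lhs => rw [← (basisOf hn _ hσ).sum_repr a]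
    rw [map_sum, ← Finset.sum_neg_distrib, Complex.exp_sum]
    refine Finset.prod_congr rfl fun j _ => ?_
    have h1 := (Finset.mem_filter.1 hp).2 j
    rw [map_smul, hk, basisOf_apply, Function.comp_apply, Complex.real_smul, Complex.ofReal_intCast,
      ← mul_neg, Complex.exp_int_mul, Complex.exp_neg, h1, Complex.exp_neg, inv_inv]
  have hvol : (latticeVolume b (β ∘ σ) : ℂ) ≠ 0 := by
    rw [Complex.ofReal_ne_zero, latticeVolume, abs_ne_zero]
    exact coordMatrix_det_ne_zero b _ hσ
  rw [residueSum_basis_eq hn hΨ hσ, Finset.sum_congr rfl hterm, Finset.sum_const, (hJ σ hσ).1 hcσ,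
    nsmul_eq_mul, mul_right_comm]
  have := hRG.card_filter hn hβ hσ hcσ
  rw [← this, Complex.ofReal_natCast] at hvol ⊢
  rw [mul_inv_cancel₀ hvol, one_mul]

include hn hΨ hJ in
/-- The weighted partition functions agree near a chamber with the residue sums. -/
theorem partitionSum_eq_residueSum (hhalf : ∃ v : V, ∀ i, 0 < β i v)
    (hβ : ∀ i, β i ∈ dualLattice b) (hc : IsChamber n β c) (hRG : IsReducedPoleSet b β y c RG)
    (h : Fin N → ℕ) (a : dualLattice b)
    (ha : (a : StrongDual ℝ V) ∈ c - box (fun j => (h j : ℝ) • β j)) :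
    partitionSum β (fun i => Complex.exp (y i)) h a = residueSum n Ψ y RG h a := by
  by_cases hcβ : c ⊆ cone β
  · have hD := (isPartitionFamily_partitionSum hhalf hβ fun i => Complex.exp (y i)).sub
      (isPartitionFamily_residueSum (n := n) (y := y) (RG := RG) hΨ hβ)
    refine sub_eq_zero.1 (hD.eq_zero hn hc hcβ (fun i => Complex.exp_ne_zero _) ?_ ?_ h a ha)
    · intro h hdeg a ha
      rw [partitionSum_eq_zero_of_degenerate hn hc _ hdeg ha,
        residueSum_eq_zero_of_degenerate hn hΨ hdeg, sub_zero]
    · intro σ hσ a ha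
      by_cases hcσ : c ⊆ cone (β ∘ σ)
      · by_cases hint : ∀ j, ∃ k : ℤ, (basisOf hn _ hσ).repr (a : StrongDual ℝ V) j = k
        · choose k hk using hint
          rw [partitionSum_basis hn hc hσ hcσ _ ha hk,
            residueSum_basis hn hΨ hJ hβ hRG hσ hcσ hk, sub_self]
        · push Not at hint
          obtain ⟨j, hj⟩ := hint
          rw [partitionSum_basis_eq_zero_of_repr hn hσ _ hj, residueSum_basis_eq hn hΨ hσ,
            hRG.sum_exp_eq_zero hn hβ hσ hcσ a.2 hj, zero_mul, sub_zero]
      · rw [partitionSum_basis_eq_zero hn hc hσ hcσ _ ha, residueSum_basis_eq hn hΨ hσ,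
          (hJ σ hσ).2 hcσ, mul_zero, sub_zero]
  -- Outside C(Φ) no basis cone contains c, so there are no poles and both sides are 0.
  · rw [partitionSum_eq_zero_of_not_subset hn hc hcβ _ ha, residueSum, Finset.sum_eq_zero]
    intro p hp
    obtain ⟨σ, hσ, hcσ, -⟩ := hRG.1 p hp
    exact absurd (hcσ.trans (cone_tuple_subset β σ)) hcβ

end BasisCase

end PartitionResidue

end

noncomputable section

namespace PartitionResidue

open Module Filter

/-! ### The residue formula -/

section Formula

variable {V : Type*} [NormedAddCommGroup V] [NormedSpace ℝ V] {n N : ℕ}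
variable {β : Fin N → StrongDual ℝ V} {b : Basis (Fin n) ℝ V} {c : Set (StrongDual ℝ V)}

/-- The Jeffrey–Kirwan residue of the total residue is a linear functional that kills derivatives
and has the expected values at simple fractions. -/
theorem exists_residueFunctional [FiniteDimensional ℝ V] (hn : finrank ℝ (StrongDual ℝ V) = n)
    (hspan : Submodule.span ℝ (Set.range β) = ⊤) (hhalf : ∃ v : V, ∀ i, 0 < β i v)
    (hc : IsChamber n β c) : ∃ Ψ : rationalFunctions β →ₗ[ℂ] ℂ,
      (∀ v f, Ψ (derivation β v f) = 0) ∧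
      (∀ σ : Fin n → Fin N, LinearIndependent ℝ (β ∘ σ) →
        (c ⊆ cone (β ∘ σ) → Ψ (mono β σ (-1)) = ((latticeVolume b (β ∘ σ) : ℝ) : ℂ)⁻¹) ∧
        (¬ c ⊆ cone (β ∘ σ) → Ψ (mono β σ (-1)) = 0)) ∧
      ∀ f : rationalFunctions β, jkResidue b β c (totalResidue n β f) = Ψ f := by
  have hJ := (existsUnique_isJKFunctional b β hc hhalf).exists
  refine ⟨hJ.choose.comp (totalResidueLinear hn hspan), fun v f => ?_, fun σ hσ => ?_, fun f => ?_⟩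
  · rw [LinearMap.comp_apply, totalResidueLinear_derivation, map_zero]
  · rw [LinearMap.comp_apply, totalResidueLinear_mono hn hspan σ hσ, hJ.choose_spec σ hσ]
    exact ⟨fun h => if_pos h, fun h => if_neg h⟩
  · rw [jkResidue, dif_pos hJ]
    rfl

theorem residueFormula_eq {Ψ : rationalFunctions β →ₗ[ℂ] ℂ}
    (hΨ : ∀ f : rationalFunctions β, jkResidue b β c (totalResidue n β f) = Ψ f)
    (y : Fin N → ℂ) (h : Fin N → ℕ) (RG : Finset (Complexification V)) :
    residueFormula b β y h c RG = fun a : dualLattice b => residueSum n Ψ y RG h a := by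
  funext a
  rw [residueFormula, residueSum]
  refine Finset.sum_congr rfl fun p _ => ?_
  rw [totalResidueFormal, homogeneousComponent_kernelFunction, hΨ]

/-- The residue formula for the weighted partition functions. -/
theorem residueFormula_spec [FiniteDimensional ℝ V] (hn : finrank ℝ (StrongDual ℝ V) = n)
    (hβ : ∀ i, β i ∈ dualLattice b) (hspan : Submodule.span ℝ (Set.range β) = ⊤)
    (hhalf : ∃ v : V, ∀ i, 0 < β i v) (hc : IsChamber n β c) {y : Fin N → ℂ} {h : Fin N → ℕ}
    (hh : ∀ i, 1 ≤ h i) {RG : Finset (Complexification V)} (hRG : IsReducedPoleSet b β y c RG) :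
    residueFormula b β y h c RG ∈ expPoly (dualLattice b) ∧
      ∀ a : dualLattice b, (a : StrongDual ℝ V) ∈ c - box (fun i => (h i : ℝ) • β i) →
        latticeSum (fhy h y) β a = residueFormula b β y h c RG a := by
  obtain ⟨Ψ, hΨ, hΨσ, hΨJ⟩ := exists_residueFunctional (b := b) hn hspan hhalf hc
  rw [residueFormula_eq hΨJ]
  refine ⟨residueSum_mem_expPoly h, fun a ha => ?_⟩
  rw [latticeSum_fhy y hh]
  exact partitionSum_eq_residueSum hn hΨ hΨσ hhalf hβ hc hRG h a ha

end Formula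

/-! ### Exponential-polynomial functions on a lattice -/

section ExpPoly

variable {N : ℕ}

/-- The span of the restrictions to `ℤ^N` of the functions `f_{h,y}`. -/
def fhySpan (N : ℕ) : Submodule ℂ ((Fin N → ℤ) → ℂ) :=
  Submodule.span ℂ {g | ∃ (h : Fin N → ℕ) (y : Fin N → ℂ), (∀ i, 1 ≤ h i) ∧
    g = fun x => fhy h y fun i => (x i : ℝ)}

theorem mul_cPoly (x : ℝ) {h : ℕ} (hh : 1 ≤ h) :
    x * cPoly x h = h * (cPoly x (h + 1) - cPoly x h) := by
  obtain ⟨h, rfl⟩ : ∃ h', h = h' + 1 := ⟨h - 1, by omega⟩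
  have h2 : (h.factorial : ℝ) ≠ 0 := by exact_mod_cast h.factorial_ne_zero
  have h3 : ((h : ℝ) + 1) ≠ 0 := by positivity
  rw [cPoly, cPoly, Nat.add_sub_cancel, Nat.add_sub_cancel, Finset.prod_range_succ,
    Nat.factorial_succ]
  push_cast
  field_simp
  ring

theorem mul_fhy (h : Fin N → ℕ) (y : Fin N → ℂ) (i : Fin N) (hi : 1 ≤ h i) (x : Fin N → ℝ) :
    (x i : ℂ) * fhy h y x = h i * (fhy (h + Pi.single i 1) y x - fhy h y x) := by
  have e : ∀ h' : Fin N → ℕ, (∀ j ≠ i, h' j = h j) → ∏ j, (cPoly (x j) (h' j) : ℂ) =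
      (cPoly (x i) (h' i) : ℂ) * ∏ j ∈ Finset.univ.erase i, (cPoly (x j) (h j) : ℂ) := by
    intro h' hh'
    rw [← Finset.mul_prod_erase _ _ (Finset.mem_univ i)]
    congr 1
    exact Finset.prod_congr rfl fun j hj => by rw [hh' j (Finset.mem_erase.1 hj).1]
  have h1 := congrArg (Complex.ofReal) (mul_cPoly (x i) hi)
  push_cast at h1
  rw [fhy, fhy, e h fun _ _ => rfl, e (h + Pi.single i 1) fun j hj => by simp [hj]]
  simp only [Pi.add_apply, Pi.single_eq_same]
  linear_combination (Complex.exp (∑ i, y i * (x i : ℂ)) *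
    ∏ j ∈ Finset.univ.erase i, (cPoly (x j) (h j) : ℂ)) * h1

theorem mul_mem_fhySpan {g : (Fin N → ℤ) → ℂ}
    (hg : ∀ (h : Fin N → ℕ) (y : Fin N → ℂ), (∀ i, 1 ≤ h i) →
      (fun x => g x * fhy h y fun i => (x i : ℝ)) ∈ fhySpan N)
    {f : (Fin N → ℤ) → ℂ} (hf : f ∈ fhySpan N) : g * f ∈ fhySpan N := by
  induction hf using Submodule.span_induction with
  | mem f hf =>
    obtain ⟨h, y, hh, rfl⟩ := hf
    exact hg h y hh
  | zero => rw [mul_zero]; exact zero_mem _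
  | add f f' _ _ hf hf' => rw [mul_add]; exact add_mem hf hf'
  | smul t f _ hf => rw [mul_smul_comm]; exact Submodule.smul_mem _ _ hf

theorem intCast_eq_sum (x : Fin N → ℤ) :
    (fun i => (x i : ℝ)) = ∑ i, x i • (Pi.single i (1 : ℝ) : Fin N → ℝ) := by
  funext j
  simp [Finset.sum_apply, Pi.single_apply]

theorem addChar_map_sum {W ι : Type*} [AddCommGroup W] (χ : AddChar W ℂ) (s : Finset ι)
    (f : ι → W) : χ (∑ i ∈ s, f i) = ∏ i ∈ s, χ (f i) := by
  classical
  induction s using Finset.induction_on with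
  | empty => simp
  | insert i s hi ih => rw [Finset.sum_insert hi, Finset.prod_insert hi, AddChar.map_add_eq_mul, ih]

/-- The span contains 1 and is stable under multiplication by both kinds of characters. Only their
values on ℤ^N matter, so no continuity is needed. -/
theorem restrict_mem_fhySpan {f : (Fin N → ℝ) → ℂ} (hf : f ∈ expPoly (Fin N → ℝ)) :
    (fun x : Fin N → ℤ => f fun i => (x i : ℝ)) ∈ fhySpan N := by
  suffices key : ∀ g ∈ fhySpan N,
      (fun x : Fin N → ℤ => f fun i => (x i : ℝ)) * g ∈ fhySpan N by
    have := key 1 (Submodule.subset_span ⟨1, 0, fun _ => le_rfl, ?_⟩)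
    · rwa [mul_one] at this
    · funext x
      simp [fhy, cPoly]
  induction hf using Algebra.adjoin_induction with
  | mem f hf =>
    intro g hg
    refine mul_mem_fhySpan (fun h y hh => ?_) hg
    rcases hf with ⟨φ, rfl⟩ | ⟨χ, rfl⟩
    · have e : (fun x : Fin N → ℤ => φ (fun i => (x i : ℝ)) * fhy h y fun i => (x i : ℝ)) =
          ∑ i, (φ (Pi.single i 1) * h i) •
            ((fun x : Fin N → ℤ => fhy (h + Pi.single i 1) y fun i => (x i : ℝ)) -
              fun x : Fin N → ℤ => fhy h y fun i => (x i : ℝ)) := by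
        funext x
        conv_lhs => enter [1]; rw [intCast_eq_sum]
        rw [map_sum, Finset.sum_mul, Finset.sum_apply]
        refine Finset.sum_congr rfl fun i _ => ?_
        have := mul_fhy h y i (hh i) fun i => (x i : ℝ)
        rw [map_zsmul, zsmul_eq_mul]
        simp only [Pi.smul_apply, Pi.sub_apply, smul_eq_mul]
        push_cast at this
        linear_combination φ (Pi.single i 1) * this
      rw [e]
      refine sum_mem fun i _ => Submodule.smul_mem _ _ (sub_mem ?_ ?_)
      · exact Submodule.subset_span ⟨_, y, fun j => (hh j).trans (Nat.le_add_right _ _), rfl⟩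
      · exact Submodule.subset_span ⟨h, y, hh, rfl⟩
    -- On ℤ^N a multiplicative character is determined by its nonzero values at the unit vectors;
    -- logarithms of these values shift y.
    · refine Submodule.subset_span
        ⟨h, fun i => Complex.log (χ (Pi.single i 1)) + y i, hh, funext fun x => ?_⟩
      have hχ : χ (fun i => (x i : ℝ)) =
          Complex.exp (∑ i, Complex.log (χ (Pi.single i 1)) * (x i : ℂ)) := by
        rw [intCast_eq_sum, Complex.exp_sum, addChar_map_sum]
        refine Finset.prod_congr rfl fun i _ => ?_
        rw [AddChar.map_zsmul_eq_zpow, mul_comm, Complex.exp_int_mul, Complex.exp_log]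
        exact (AddChar.val_isUnit χ _).ne_zero
      change χ (fun i => (x i : ℝ)) * _ = _
      rw [hχ, fhy, fhy, ← mul_assoc, ← Complex.exp_add, ← Finset.sum_add_distrib]
      congr 2
      refine Finset.sum_congr rfl fun i _ => ?_
      push_cast
      ring
  | algebraMap t =>
    intro g hg
    exact Submodule.smul_mem _ t hg
  | add f f' _ _ hf hf' =>
    intro g hg
    have := add_mem (hf g hg) (hf' g hg)
    rwa [← add_mul] at this
  | mul f f' _ _ hf hf' =>
    intro g hg
    have := hf _ (hf' g hg)
    rwa [← mul_assoc] at this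

end ExpPoly

/-! ### Sums of exponential-polynomial functions over partition polytopes -/

section Sums

variable {V : Type*} [NormedAddCommGroup V] [NormedSpace ℝ V] {n N : ℕ}
variable {β : Fin N → StrongDual ℝ V} {b : Basis (Fin n) ℝ V} {c : Set (StrongDual ℝ V)}

theorem sub_box_subset {h : Fin N → ℕ} (hh : ∀ i, 1 ≤ h i) :
    c - box β ⊆ c - box (fun i => (h i : ℝ) • β i) := by
  refine Set.sub_subset_sub_left ?_
  rintro _ ⟨t, ht, rfl⟩
  have hpos : ∀ i, (1 : ℝ) ≤ h i := fun i => by exact_mod_cast hh i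
  refine ⟨fun i => t i / h i, fun i => ⟨?_, ?_⟩, Finset.sum_congr rfl fun i _ => ?_⟩
  · exact div_nonneg (ht i).1 (Nat.cast_nonneg _)
  · exact div_le_one_of_le₀ ((ht i).2.trans (hpos i)) (Nat.cast_nonneg _)
  · rw [smul_smul, div_mul_cancel₀ _ (zero_lt_one.trans_le (hpos i)).ne']

/-- The sums are linear in f. Since h ≥ 1, c - Box(Φ) lies in every c - Box(Φ, h) and serves as a
common domain. -/
theorem exists_expPoly_eq_latticeSum (hhalf : ∃ v : V, ∀ i, 0 < β i v)
    (hfhy : ∀ (h : Fin N → ℕ) (y : Fin N → ℂ), (∀ i, 1 ≤ h i) →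
      ∃ P ∈ expPoly (dualLattice b), ∀ a : dualLattice b,
        (a : StrongDual ℝ V) ∈ c - box (fun i => (h i : ℝ) • β i) →
          latticeSum (fhy h y) β a = P a)
    {f : (Fin N → ℝ) → ℂ} (hf : f ∈ expPoly (Fin N → ℝ)) :
    ∃ P ∈ expPoly (dualLattice b), ∀ a : dualLattice b,
      (a : StrongDual ℝ V) ∈ c - box β → latticeSum f β a = P a := by
  simp only [latticeSum_eq] at hfhy ⊢
  suffices key : ∀ g ∈ fhySpan N, ∃ P ∈ expPoly (dualLattice b), ∀ a : dualLattice b,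
      (a : StrongDual ℝ V) ∈ c - box β →
        ∑ᶠ x ∈ {x : Fin N → ℤ | (∀ i, 0 ≤ x i) ∧ ∑ i, (x i : ℝ) • β i = a}, g x = P a from
    key _ (restrict_mem_fhySpan hf)
  intro g hg
  induction hg using Submodule.span_induction with
  | mem g hg =>
    obtain ⟨h, y, hh, rfl⟩ := hg
    obtain ⟨P, hP, hPa⟩ := hfhy h y hh
    exact ⟨P, hP, fun a ha => hPa a (sub_box_subset hh ha)⟩
  | zero => exact ⟨0, zero_mem _, fun a _ => by simp⟩
  | add g g' _ _ hg hg' =>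
    obtain ⟨P, hP, hPa⟩ := hg
    obtain ⟨P', hP', hPa'⟩ := hg'
    refine ⟨P + P', add_mem hP hP', fun a ha => ?_⟩
    rw [Pi.add_apply, ← hPa a ha, ← hPa' a ha,
      ← finsum_mem_add_distrib (finite_partition hhalf (a : StrongDual ℝ V))]
    rfl
  | smul t g _ hg =>
    obtain ⟨P, hP, hPa⟩ := hg
    refine ⟨t • P, Subalgebra.smul_mem _ hP t, fun a ha => ?_⟩
    rw [Pi.smul_apply, ← hPa a ha, smul_eq_mul,
      mul_finsum_mem]
    rfl

end Sums

end PartitionResidue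

end

/-! ### The main theorem. -/

theorem mainTheorem3 {V : Type*} [NormedAddCommGroup V] [NormedSpace ℝ V] {n N : ℕ}
    (b : Module.Basis (Fin n) ℝ V) (β : Fin N → StrongDual ℝ V)
    (hβ : ∀ i, β i ∈ PartitionResidue.dualLattice b)
    (hspan : Submodule.span ℝ (Set.range β) = ⊤)
    (hhalf : ∃ v : V, ∀ i, 0 < β i v)
    (c : Set (StrongDual ℝ V)) (hc : PartitionResidue.IsChamber n β c) :
    -- the total residue and the Jeffrey–Kirwan functional are well defined
    (∀ f ∈ PartitionResidue.rationalFunctions β,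
      ∃! s : PartitionResidue.simpleElements n β,
        f - (s : PartitionResidue.complementSet β → ℂ) ∈ PartitionResidue.derivatives β) ∧
    (∃! J : PartitionResidue.simpleElements n β →ₗ[ℂ] ℂ,
      PartitionResidue.IsJKFunctional b β c J) ∧
    -- the residue formula
    (∀ (y : Fin N → ℂ) (h : Fin N → ℕ), (∀ i, 1 ≤ h i) →
      (∀ (p : PartitionResidue.Complexification V) (a : StrongDual ℝ V),
        PartitionResidue.homogeneousComponent (-(n : ℤ))
          (PartitionResidue.kernelFunction β y h p a) ∈
            PartitionResidue.rationalFunctions β) ∧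
      (∃ RG, PartitionResidue.IsReducedPoleSet b β y c RG) ∧
      ∀ RG, PartitionResidue.IsReducedPoleSet b β y c RG →
        PartitionResidue.residueFormula b β y h c RG ∈
          PartitionResidue.expPoly (PartitionResidue.dualLattice b) ∧
        ∀ a : PartitionResidue.dualLattice b,
          (a : StrongDual ℝ V) ∈ c - PartitionResidue.box (fun i => (h i : ℝ) • β i) →
          PartitionResidue.latticeSum (PartitionResidue.fhy h y) β a =
            PartitionResidue.residueFormula b β y h c RG a) ∧
    -- sums of arbitrary exponential-polynomial functions
    (∀ f ∈ PartitionResidue.expPoly (Fin N → ℝ),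
      ∃ P ∈ PartitionResidue.expPoly (PartitionResidue.dualLattice b),
        ∀ a : PartitionResidue.dualLattice b,
          (a : StrongDual ℝ V) ∈ c - PartitionResidue.box β →
          PartitionResidue.latticeSum f β a = P a) ∧
    (c ⊆ PartitionResidue.cone β → closure c ⊆ c - PartitionResidue.box β) := by
  have : FiniteDimensional ℝ V := Module.Finite.of_basis b
  have hn := PartitionResidue.finrank_strongDual b
  refine ⟨fun f hf => PartitionResidue.existsUnique_simple hn hspan ⟨f, hf⟩,
    PartitionResidue.existsUnique_isJKFunctional b β hc hhalf, fun y h hh => ⟨fun p a => ?_,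
      PartitionResidue.exists_isReducedPoleSet hn hβ y c,
      fun RG hRG => PartitionResidue.residueFormula_spec hn hβ hspan hhalf hc hh hRG⟩, fun f hf => ?_,
    fun hcβ => hc.closure_subset hn hcβ⟩
  · rw [PartitionResidue.homogeneousComponent_kernelFunction]
    exact Subtype.property _
  · refine PartitionResidue.exists_expPoly_eq_latticeSum hhalf (fun h y hh => ?_) hf
    obtain ⟨RG, hRG⟩ := PartitionResidue.exists_isReducedPoleSet hn hβ y c
    exact ⟨_, PartitionResidue.residueFormula_spec hn hβ hspan hhalf hc hh hRG⟩
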